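/- Let $g:[0,+\infty)\to\mathbb{R}$ and $G(s)=\int_0^s g$. Assume $(H_1)$ $g\in\mathscr{C}^5((0,+\infty))\cap\mathscr{C}^1([0,+\infty))$, $g^{(k)}(s)=o(s^{1-k})$ as $s\to0^+$ for every $k\in\{0,1,\dots,5\}$, and $g$ does not vanish identically on any neighbourhood of $0$ in $[0,+\infty)$. For $\omega>0$ small enough, there is a unique nonzero, nonnegative, even function $\phi_\omega\in H^1(\mathbb{R})$, of class $\mathscr{C}^2$ and vanishing at infinity, such that $$\phi_\omega''=\omega\phi_\omega-\phi_\omega^3+\phi_\omega\,g(\phi_\omega^2)\quad\text{on }\mathbb{R}.$$ With $\varepsilon_\omega:=\sup_{0\leqslant s\leqslant3\omega}|s\,g''(s)|$ (where $s\,g''(s)$ is read as $0$ at $s=0$), assume moreover $(H_2)$ $\displaystyle\lim_{\omega\to0^+}\frac{1}{\varepsilon_\omega^2\sqrt{\omega}}\int_{\mathbb{R}}\Big(-3g(\phi_\omega^2)+\phi_\omega^2g'(\phi_\omega^2)+4\frac{G(\phi_\omega^2)}{\phi_\omega^2}\Big)\,dx=+\infty.$ Let $L_+=-\partial_x^2+\omega-3\phi_\omega^2+g(\phi_\omega^2)+2\phi_\omega^2g'(\phi_\omega^2)$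 and $L_-=-\partial_x^2+\omega-\phi_\omega^2+g(\phi_\omega^2)$, acting in the sense of distributions. **Theorem 1.** Under $(H_1)$ and $(H_2)$ there is $\omega_0>0$, depending only on $g$, such that for every $\omega\in(0,\omega_0)$ the profile $\phi_\omega$ above exists and is unique, and the solutions $(X,Y,\lambda)\in H^1(\mathbb{R};\mathbb{C})^2\times\mathbb{C}$ of the system $$L_-X=\lambda Y,\qquad L_+Y=\lambda X$$ are exactly the following: $X=Y=0$ with $\lambda\in\mathbb{C}$ arbitrary; or $\lambda=0$, $X\in\operatorname{span}_{\mathbb{C}}(\phi_\omega)$ and $Y\in\operatorname{span}_{\mathbb{C}}(\phi_\omega')$. -/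

import Mathlib

open MeasureTheory Filter Topology Asymptotics


noncomputable section

namespace NLS

/-- `ψ` is a (real) test function on the line: smooth with compact support. -/
def IsTest (ψ : ℝ → ℝ) : Prop := ContDiff ℝ ((⊤ : ℕ∞) : WithTop ℕ∞) ψ ∧ HasCompactSupport ψ

/-- `v` is the weak (distributional) derivative of `u` on the line. -/
def HasWeakDeriv {E : Type*} [NormedAddCommGroup E] [NormedSpace ℝ E] (u v : ℝ → E) : Prop :=
  LocallyIntegrable u ∧ LocallyIntegrable v ∧
    ∀ ψ : ℝ → ℝ, IsTest ψ → ∫ x, deriv ψ x • u x = -∫ x, ψ x • v x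

/-- The Sobolev space `H¹(ℝ)`: square integrable functions whose weak derivative is square
integrable. -/
def MemH1 {E : Type*} [NormedAddCommGroup E] [NormedSpace ℝ E] (u : ℝ → E) : Prop :=
  MemLp u 2 ∧ ∃ v : ℝ → E, MemLp v 2 ∧ HasWeakDeriv u v

/-- The hypothesis `(H₁)`. The nonlinearity is a function on `[0, ∞)`; only the values of
`g : ℝ → ℝ` there are used. -/
def H1 (g : ℝ → ℝ) : Prop :=
  ContDiffOn ℝ 5 g (Set.Ioi 0) ∧
  ContDiffOn ℝ 1 g (Set.Ici 0) ∧
  (∀ k : ℕ, k ≤ 5 → (fun s : ℝ => iteratedDeriv k g s) =o[𝓝[>] 0] fun s : ℝ => s ^ (1 - (k : ℤ))) ∧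
  ¬ ∀ᶠ s in 𝓝[≥] (0 : ℝ), g s = 0

/-- The primitive `G(s) = ∫₀ˢ g`. -/
def primitive (g : ℝ → ℝ) (s : ℝ) : ℝ := ∫ t in (0 : ℝ)..s, g t

/-- `ε_ω = sup_{0 ≤ s ≤ 3ω} |s g''(s)|` (the value of `s g''(s)` at `s = 0` is taken to be `0`). -/
def eps (g : ℝ → ℝ) (ω : ℝ) : ℝ :=
  sSup ((fun s : ℝ => |s * iteratedDeriv 2 g s|) '' Set.Icc 0 (3 * ω))

/-- `φ` is a solitary wave profile of frequency `ω`: a nonzero, nonnegative, even `H¹` solution of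
`φ'' = ω φ - φ³ + φ g(φ²)` vanishing at infinity. -/
structure IsSolitaryWave (g : ℝ → ℝ) (ω : ℝ) (φ : ℝ → ℝ) : Prop where
  memH1 : MemH1 φ
  contDiff : ContDiff ℝ 2 φ
  eqn : ∀ x, deriv (deriv φ) x = ω * φ x - φ x ^ 3 + φ x * g (φ x ^ 2)
  even : ∀ x, φ (-x) = φ x
  nonneg : ∀ x, 0 ≤ φ x
  ne_zero : φ ≠ 0
  tendsto_zero : Tendsto φ (cocompact ℝ) (𝓝 0)

/-- The solitary wave profile `φ_ω`. -/
def solitaryWave (g : ℝ → ℝ) (ω : ℝ) : ℝ → ℝ := Classical.epsilon (IsSolitaryWave g ω)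

/-- The hypothesis `(H₂)`. -/
def H2 (g : ℝ → ℝ) : Prop :=
  Tendsto
    (fun ω : ℝ => 1 / (eps g ω ^ 2 * √ω) *
      ∫ x : ℝ, (-3 * g (solitaryWave g ω x ^ 2)
        + solitaryWave g ω x ^ 2 * deriv g (solitaryWave g ω x ^ 2)
        + 4 * (primitive g (solitaryWave g ω x ^ 2) / solitaryWave g ω x ^ 2)))
    (𝓝[>] 0) atTop

/-- The potential of `L₊ = -∂ₓ² + ω - 3 φ_ω² + g(φ_ω²) + 2 φ_ω² g'(φ_ω²)`. -/
def potPlus (g : ℝ → ℝ) (ω x : ℝ) : ℝ :=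
  ω - 3 * solitaryWave g ω x ^ 2 + g (solitaryWave g ω x ^ 2)
    + 2 * solitaryWave g ω x ^ 2 * deriv g (solitaryWave g ω x ^ 2)

/-- The potential of `L₋ = -∂ₓ² + ω - φ_ω² + g(φ_ω²)`. -/
def potMinus (g : ℝ → ℝ) (ω x : ℝ) : ℝ :=
  ω - solitaryWave g ω x ^ 2 + g (solitaryWave g ω x ^ 2)

/-- `(-∂ₓ² + V) u = f` in the sense of distributions on the line. -/
def SchrodingerEq (V : ℝ → ℝ) (u f : ℝ → ℂ) : Prop :=
  ∀ ψ : ℝ → ℝ, IsTest ψ →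
    ∫ x, (-deriv (deriv ψ) x + V x * ψ x) • u x = ∫ x, ψ x • f x

/-- The system `L₋ X = lam Y`, `L₊ Y = lam X`. -/
def LinearizedSystem (g : ℝ → ℝ) (ω : ℝ) (X Y : ℝ → ℂ) (lam : ℂ) : Prop :=
  SchrodingerEq (potMinus g ω) X (fun x => lam * Y x) ∧
  SchrodingerEq (potPlus g ω) Y (fun x => lam * X x)

end NLS

end

/-! Write `p = φ'/φ` and `S = φ ∂ φ⁻¹ = ∂ - p`, so that `L₋ = S* S`. For a solution `(X, Y)` of the
system put `Z = S² X`, and let `φ W = 2 (φ'' Y - φ' Y') - lam φ X`, a Wronskian of `Y` with `φ'`,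
which lies in the kernel of `L₊`; then `S* W = lam S X`. The pair `(Z, W)` solves `(-∂² + ω + b₁) Z
= lam W`, `(-∂² + ω + b₂) W = lam Z`, where `b₁ = pertOne g (φ²)` and `b₂ = pertTwo g (φ²)`. The
cubic term has disappeared: both potentials vanish when `g = 0`, and in general they are `O(ε_ω φ²)`
(`hasDerivAt_transOneDeriv`, `hasDerivAt_transTwoDeriv`, `H1.abs_pert_le`).

It remains to show `Z = 0`. The potentials `ω + b₁` and `ω + b₂` are bounded below by `ω / 2`, so
comparing the two energy identities forces `lam` to be real or `Z = 0`
(`im_eq_zero_or_eq_zero_of_system`). For real `l ≥ 0`, the sum `A = Z + W` and the difference `B = Z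
- W` diagonalize the main part: `A'' = (ω - l) A + f A + d B` and `B'' = (ω + l) B + f B + d A`,
with `f = (b₁ + b₂) / 2` and `d = (b₁ - b₂) / 2`. The equation for `B` is coercive, so `B` is of
order `ε_ω` relative to `A`. The one for `A` is not, but a virial identity, indifferent to the sign
of `ω - l`, gives `2 ∫ A'² + A(0)² ∫ f + errors = 0`. The integral `∫ f` is the one in `(H₂)`, and
the errors are absorbed by `∫ A'²` except for `O(ε_ω² √ω) A(0)²`, which `(H₂)` dominates. Hence `A =
0` (`eq_zero_of_virial`), and then `W = -Z` makes the equation for `Z` coercive.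

When `Z = φ (X/φ)''` vanishes, `(X/φ)'` is a constant `β` and `lam Y = -2 β φ'`. If `lam ≠ 0` then
`L₊ Y = 0`, so `X = 0` and next `Y = 0`; if `lam = 0` then `β = 0`, and the kernel of `L₊` is found
by a Wronskian argument (`IsSolitaryWave.eigen_solutions`).

The profile is handled through `k = 1/φ`. On the zero energy level, `k'' = (ω + pertTwo g (k⁻²)) k`,
again without cubic term. The right side is globally Lipschitz once truncated below the minimum of
`k`, and convexity makes `k` grow at least quadratically. Existence, uniqueness and decay of `φ` all
follow. -/

noncomputable section

namespace NLS

/-! ### Test functions, weak derivatives, and regularity of distributional solutions. -/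

theorem IsTest.hasDerivAt {ψ : ℝ → ℝ} (hψ : IsTest ψ) (x : ℝ) :
    HasDerivAt ψ (deriv ψ x) x :=
  (hψ.1.differentiable (by simp) x).hasDerivAt

theorem IsTest.isTest_deriv {ψ : ℝ → ℝ} (hψ : IsTest ψ) : IsTest (deriv ψ) :=
  ⟨(contDiff_infty_iff_deriv.1 hψ.1).2, hψ.2.deriv⟩

theorem IsTest.continuous {ψ : ℝ → ℝ} (hψ : IsTest ψ) : Continuous ψ := hψ.1.continuous

theorem IsTest.integrable {ψ : ℝ → ℝ} (hψ : IsTest ψ) : Integrable ψ :=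
  hψ.continuous.integrable_of_hasCompactSupport hψ.2

theorem IsTest.exists_pos_eq_zero {ψ : ℝ → ℝ} (hψ : IsTest ψ) :
    ∃ R : ℝ, 0 < R ∧ ∀ x, R ≤ |x| → ψ x = 0 := by
  obtain ⟨R, hR, h⟩ := hψ.2.exists_pos_le_norm
  exact ⟨R, hR, fun x hx => h x (by simpa using hx)⟩

theorem IsTest.integrable_smul {E : Type*} [NormedAddCommGroup E] [NormedSpace ℝ E]
    {ψ : ℝ → ℝ} (hψ : IsTest ψ) {u : ℝ → E} (hu : LocallyIntegrable u) :
    Integrable fun x => ψ x • u x :=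
  hu.integrable_smul_left_of_hasCompactSupport hψ.continuous hψ.2

theorem intervalIntegrable_of_locallyIntegrable {E : Type*} [NormedAddCommGroup E]
    {u : ℝ → E} (hu : LocallyIntegrable u) (a b : ℝ) : IntervalIntegrable u volume a b :=
  intervalIntegrable_iff.mpr
    ((hu.integrableOn_isCompact isCompact_uIcc).mono_set Set.uIoc_subset_uIcc)

theorem continuous_primitive_of_locallyIntegrable {E : Type*} [NormedAddCommGroup E]
    [NormedSpace ℝ E] {u : ℝ → E} (hu : LocallyIntegrable u) :
    Continuous fun x => ∫ t in (0 : ℝ)..x, u t :=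
  intervalIntegral.continuous_primitive (intervalIntegrable_of_locallyIntegrable hu) 0

/-- Since `h` is only locally integrable, its primitive is merely absolutely continuous, with
derivative `h` almost everywhere by Lebesgue differentiation. Integration by parts is therefore the
one for absolutely continuous functions, on an interval containing the support of `ψ`. -/
theorem integral_deriv_mul_primitive {h : ℝ → ℝ} (hh : LocallyIntegrable h) {ψ : ℝ → ℝ}
    (hψ : IsTest ψ) :
    ∫ x, deriv ψ x * (∫ t in (0 : ℝ)..x, h t) = -∫ x, ψ x * h x := by
  obtain ⟨R, hR, hR0⟩ := hψ.exists_pos_eq_zero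
  obtain ⟨R', hR', hR0'⟩ := hψ.isTest_deriv.exists_pos_eq_zero
  set M := max R R' with hM
  have hMR : R ≤ M := le_max_left _ _
  have hMR' : R' ≤ M := le_max_right _ _
  have hsupp : ∀ F : ℝ → ℝ, (∀ x, M ≤ |x| → F x = 0) → ∫ x, F x = ∫ x in (-M)..M, F x := by
    intro F hF
    refine (intervalIntegral.integral_eq_integral_of_support_subset ?_).symm
    intro x hx
    have : |x| < M := by
      by_contra hcon
      exact hx (hF x (not_lt.1 hcon))
    exact ⟨(abs_lt.1 this).1, (abs_lt.1 this).2.le⟩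
  rw [hsupp _ fun x hx => by simp [hR0' x (hMR'.trans hx)],
    hsupp _ fun x hx => by simp [hR0 x (hMR.trans hx)]]
  have hac : AbsolutelyContinuousOnInterval ψ (-M) M :=
    ContDiffOn.absolutelyContinuousOnInterval (hψ.1.of_le (by exact_mod_cast le_top)).contDiffOn
  have h0 : (0 : ℝ) ∈ Set.uIcc (-M) M := by
    rw [Set.uIcc_of_le (by linarith)]
    constructor <;> linarith
  have hac' : AbsolutelyContinuousOnInterval (fun x => ∫ t in (0 : ℝ)..x, h t) (-M) M :=
    (intervalIntegrable_of_locallyIntegrable hh _ _).absolutelyContinuousOnInterval_intervalIntegral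
      h0
  have key := hac.integral_mul_deriv_eq_deriv_mul hac'
  rw [hR0 M (hMR.trans (le_abs_self _)), hR0 (-M) (by rw [abs_neg]; exact hMR.trans (le_abs_self _))]
    at key
  have hcongr : ∫ x in (-M)..M, ψ x * deriv (fun x => ∫ t in (0 : ℝ)..x, h t) x
      = ∫ x in (-M)..M, ψ x * h x := by
    refine intervalIntegral.integral_congr_ae ?_
    filter_upwards [LocallyIntegrable.ae_hasDerivAt_integral hh] with x hx _
    rw [(hx 0).deriv]
  rw [hcongr] at key
  linarith

theorem integral_deriv_smul_primitive {h : ℝ → ℂ} (hh : LocallyIntegrable h) {ψ : ℝ → ℝ}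
    (hψ : IsTest ψ) :
    ∫ x, deriv ψ x • (∫ t in (0 : ℝ)..x, h t) = -∫ x, ψ x • h x := by
  have hi1 := hψ.isTest_deriv.integrable_smul (continuous_primitive_of_locallyIntegrable hh).locallyIntegrable
  have hi2 := hψ.integrable_smul hh
  have key : ∀ L : ℂ →L[ℝ] ℝ,
      L (∫ x, deriv ψ x • (∫ t in (0 : ℝ)..x, h t)) = L (-∫ x, ψ x • h x) := by
    intro L
    have hL : LocallyIntegrable fun x => L (h x) := fun x => by
      obtain ⟨s, hs, hi⟩ := hh x
      exact ⟨s, hs, L.integrable_comp hi⟩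
    rw [map_neg, ← L.integral_comp_comm hi1, ← L.integral_comp_comm hi2]
    have := integral_deriv_mul_primitive hL hψ
    simp only [map_smul, smul_eq_mul]
    rw [← this]
    congr 1
    ext x
    rw [L.intervalIntegral_comp_comm (intervalIntegrable_of_locallyIntegrable hh 0 x)]
  apply Complex.ext
  · exact key Complex.reCLM
  · exact key Complex.imCLM

theorem exists_isTest_integral_eq_one : ∃ η : ℝ → ℝ, IsTest η ∧ ∫ x, η x = 1 := by
  let b : ContDiffBump (0 : ℝ) := ⟨1, 2, one_pos, one_lt_two⟩
  exact ⟨b.normed volume, ⟨b.contDiff_normed, b.hasCompactSupport_normed⟩, b.integral_normed⟩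

/-- The primitive started to the left of the support vanishes there, and it vanishes to the right of
the support because the mean is zero. -/
theorem IsTest.exists_isTest_deriv_eq {θ : ℝ → ℝ} (hθ : IsTest θ) (h0 : ∫ x, θ x = 0) :
    ∃ Θ : ℝ → ℝ, IsTest Θ ∧ deriv Θ = θ := by
  have hd : ∀ x, HasDerivAt (fun x => ∫ t in (0 : ℝ)..x, θ t) (θ x) x := fun x =>
    hθ.continuous.integral_hasStrictDerivAt 0 x |>.hasDerivAt
  obtain ⟨R, hR, hR0⟩ := hθ.exists_pos_eq_zero
  set c : ℝ := ∫ t in (0 : ℝ)..(-R), θ t with hc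
  have hd' : ∀ x, HasDerivAt (fun x => (∫ t in (0 : ℝ)..x, θ t) - c) (θ x) x := fun x =>
    (hd x).sub_const c
  have hder : deriv (fun x => (∫ t in (0 : ℝ)..x, θ t) - c) = θ := funext fun x => (hd' x).deriv
  refine ⟨fun x => (∫ t in (0 : ℝ)..x, θ t) - c, ⟨?_, ?_⟩, hder⟩
  · rw [contDiff_infty_iff_deriv, hder]
    exact ⟨fun x => (hd' x).differentiableAt, hθ.1⟩
  · have hii : ∀ a b, IntervalIntegrable θ volume a b := fun a b =>
      hθ.continuous.intervalIntegrable a b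
    have heq : ∀ x, (∫ t in (0 : ℝ)..x, θ t) - c = ∫ t in (-R)..x, θ t := fun x =>
      intervalIntegral.integral_interval_sub_left (hii _ _) (hii _ _)
    refine HasCompactSupport.intro (isCompact_Icc (a := -R) (b := R)) fun x hx => ?_
    rw [heq]
    by_cases h1 : x < -R
    · rw [intervalIntegral.integral_symm, neg_eq_zero]
      have : ∫ t in x..(-R), θ t = ∫ t in x..(-R), (0 : ℝ) := by
        refine intervalIntegral.integral_congr fun t ht => ?_
        rw [Set.uIcc_of_le h1.le] at ht
        exact hR0 t (by rw [le_abs]; right; linarith [ht.2])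
      simpa using this
    · have h2 : R < x := by
        by_contra h2
        exact hx ⟨not_lt.1 h1, not_lt.1 h2⟩
      rw [← h0]
      have hs : Function.support θ ⊆ Set.Ioc (-x) x := by
        intro y hy
        have : |y| < R := by
          by_contra hcon
          exact hy (hR0 y (not_lt.1 hcon))
        exact ⟨by linarith [(abs_lt.1 this).1], by linarith [(abs_lt.1 this).2]⟩
      rw [← intervalIntegral.integral_eq_integral_of_support_subset hs,
        ← intervalIntegral.integral_add_adjacent_intervals (hii (-x) (-R)) (hii (-R) x)]
      have : ∫ t in (-x)..(-R), θ t = ∫ t in (-x)..(-R), (0 : ℝ) := by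
        refine intervalIntegral.integral_congr fun t ht => ?_
        rw [Set.uIcc_of_le (by linarith)] at ht
        exact hR0 t (by rw [le_abs]; right; linarith [ht.2])
      rw [this]
      simp

theorem IsTest.sub_smul {ψ η : ℝ → ℝ} (hψ : IsTest ψ) (hη : IsTest η) (c : ℝ) :
    IsTest fun x => ψ x - c * η x :=
  ⟨hψ.1.sub (contDiff_const.mul hη.1), hψ.2.sub (hη.2.mul_left)⟩

/-- With `η` a test function of mass one, `ψ - (∫ ψ) η` has mean zero and is thus the derivative of
a test function. Testing against it shows that `w` acts on `ψ` as the constant `∫ η w`. -/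
theorem ae_eq_const_of_weakDeriv_eq_zero {w : ℝ → ℂ} (hw : LocallyIntegrable w)
    (h : ∀ ψ : ℝ → ℝ, IsTest ψ → ∫ x, deriv ψ x • w x = 0) :
    ∃ c : ℂ, w =ᵐ[volume] fun _ => c := by
  obtain ⟨η, hη, hη1⟩ := exists_isTest_integral_eq_one
  refine ⟨∫ x, η x • w x, ?_⟩
  refine ae_eq_of_integral_contDiff_smul_eq hw (locallyIntegrable_const _) fun ψ h1 h2 => ?_
  have hψ : IsTest ψ := ⟨h1, h2⟩
  obtain ⟨Θ, hΘ, hΘd⟩ := (hψ.sub_smul hη (∫ x, ψ x)).exists_isTest_deriv_eq (by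
    rw [integral_sub hψ.integrable (hη.integrable.const_mul _), integral_const_mul, hη1]; ring)
  have := h Θ hΘ
  rw [hΘd] at this
  simp only [sub_smul, mul_smul] at this
  have hi : Integrable fun x => (∫ x, ψ x) • η x • w x := (hη.integrable_smul hw).fun_smul _
  rw [integral_sub (hψ.integrable_smul hw) hi, integral_smul, sub_eq_zero] at this
  rw [this, integral_smul_const]

/-- The slope must be the value of the distribution `u'` at a bump of mass one, that is `-∫ η' u`.
Subtracting the corresponding linear function leaves a function of zero weak derivative. -/
theorem ae_eq_affine_of_weakDeriv_deriv_eq_zero {u : ℝ → ℂ} (hu : LocallyIntegrable u)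
    (h : ∀ ψ : ℝ → ℝ, IsTest ψ → ∫ x, deriv (deriv ψ) x • u x = 0) :
    ∃ a b : ℂ, u =ᵐ[volume] fun x : ℝ => a + x * b := by
  obtain ⟨η, hη, hη1⟩ := exists_isTest_integral_eq_one
  set b : ℂ := -∫ x, deriv η x • u x with hb
  have hlin : Continuous fun x : ℝ => (x : ℂ) * b := by fun_prop
  have hw : LocallyIntegrable fun x : ℝ => u x - x * b := hu.sub hlin.locallyIntegrable
  obtain ⟨a, ha⟩ := ae_eq_const_of_weakDeriv_eq_zero hw fun ψ hψ => by
    obtain ⟨Θ, hΘ, hΘd⟩ := (hψ.sub_smul hη (∫ x, ψ x)).exists_isTest_deriv_eq (by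
      rw [integral_sub hψ.integrable (hη.integrable.const_mul _), integral_const_mul, hη1]; ring)
    have h1 := h Θ hΘ
    have hd : deriv (deriv Θ) = fun x => deriv ψ x - (∫ x, ψ x) * deriv η x := by
      rw [hΘd]
      ext x
      exact ((hψ.hasDerivAt x).sub ((hη.hasDerivAt x).const_mul _)).deriv
    rw [hd] at h1
    simp only [sub_smul, mul_smul] at h1
    have hi : Integrable fun x => (∫ x, ψ x) • deriv η x • u x :=
      (hη.isTest_deriv.integrable_smul hu).fun_smul _
    rw [integral_sub (hψ.isTest_deriv.integrable_smul hu) hi, integral_smul, sub_eq_zero] at h1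
    have h2 := integral_deriv_smul_primitive (locallyIntegrable_const b) hψ
    simp only [intervalIntegral.integral_const, sub_zero, integral_smul_const] at h2
    simp only [smul_sub]
    rw [integral_sub (hψ.isTest_deriv.integrable_smul hu)
      (hψ.isTest_deriv.integrable_smul hlin.locallyIntegrable), h1]
    have h3 : ∫ x : ℝ, deriv ψ x • ((x : ℂ) * b) = ∫ x : ℝ, deriv ψ x • x • b := by
      simp only [Complex.real_smul]
    rw [h3, h2, hb]
    simp
  refine ⟨a, b, ?_⟩
  filter_upwards [ha] with x hx
  rw [← hx]; ring

/-- A weak solution of `u'' = h` with `h` locally integrable is almost everywhere equal to a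
`C¹` function whose derivative is a primitive of `h`. -/
theorem exists_hasDerivAt_of_weak_deriv_deriv {u h : ℝ → ℂ} (hu : LocallyIntegrable u)
    (hh : LocallyIntegrable h)
    (H : ∀ ψ : ℝ → ℝ, IsTest ψ → ∫ x, deriv (deriv ψ) x • u x = ∫ x, ψ x • h x) :
    ∃ (v v' : ℝ → ℂ) (b : ℂ), u =ᵐ[volume] v ∧ (∀ x, HasDerivAt v (v' x) x) ∧
      v' = fun x => (∫ t in (0 : ℝ)..x, h t) + b := by
  set P : ℝ → ℂ := fun x => ∫ t in (0 : ℝ)..x, h t with hP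
  have hPc : Continuous P := continuous_primitive_of_locallyIntegrable hh
  set Q : ℝ → ℂ := fun x => ∫ t in (0 : ℝ)..x, P t with hQ
  have hQc : Continuous Q := continuous_primitive_of_locallyIntegrable hPc.locallyIntegrable
  obtain ⟨a, b, hab⟩ := ae_eq_affine_of_weakDeriv_deriv_eq_zero (hu.sub hQc.locallyIntegrable)
    fun ψ hψ => by
      simp only [Pi.sub_apply, smul_sub]
      rw [integral_sub (hψ.isTest_deriv.isTest_deriv.integrable_smul hu)
        (hψ.isTest_deriv.isTest_deriv.integrable_smul hQc.locallyIntegrable), H ψ hψ,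
        integral_deriv_smul_primitive hPc.locallyIntegrable hψ.isTest_deriv,
        integral_deriv_smul_primitive hh hψ]
      simp
  refine ⟨fun x => Q x + (a + x * b), fun x => P x + b, b, ?_, fun x => ?_, rfl⟩
  · filter_upwards [hab] with x hx
    rw [← hx]
    simp
  · have h1 : HasDerivAt Q (P x) x := (hPc.integral_hasStrictDerivAt 0 x).hasDerivAt
    have h2 : HasDerivAt (fun x : ℝ => a + (x : ℂ) * b) b x := by
      simpa using ((Complex.ofRealCLM.hasDerivAt (x := x)).mul_const b).const_add a
    exact h1.add h2

theorem integral_deriv_smul_eq_neg {E : Type*} [NormedAddCommGroup E] [NormedSpace ℝ E]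
    {u u' : ℝ → E} (hu : ∀ x, HasDerivAt u (u' x) x) (hu' : LocallyIntegrable u')
    {ψ : ℝ → ℝ} (hψ : IsTest ψ) :
    ∫ x, deriv ψ x • u x = -∫ x, ψ x • u' x := by
  have hc : Continuous u := continuous_iff_continuousAt.2 fun x => (hu x).continuousAt
  have h0 := integral_eq_zero_of_hasDerivAt_of_integrable
    (f := fun x => ψ x • u x) (f' := fun x => ψ x • u' x + deriv ψ x • u x)
    (fun x => (hψ.hasDerivAt x).smul (hu x))
    ((hψ.integrable_smul hu').add (hψ.isTest_deriv.integrable_smul hc.locallyIntegrable))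
    (hψ.integrable_smul hc.locallyIntegrable)
  rw [integral_add (hψ.integrable_smul hu')
    (hψ.isTest_deriv.integrable_smul hc.locallyIntegrable)] at h0
  exact eq_neg_of_add_eq_zero_right h0

theorem hasWeakDeriv_of_hasDerivAt {E : Type*} [NormedAddCommGroup E] [NormedSpace ℝ E]
    {u u' : ℝ → E} (hu : ∀ x, HasDerivAt u (u' x) x) (hu' : LocallyIntegrable u') :
    HasWeakDeriv u u' :=
  ⟨(continuous_iff_continuousAt.2 fun x => (hu x).continuousAt).locallyIntegrable, hu',
    fun _ hψ => integral_deriv_smul_eq_neg hu hu' hψ⟩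

theorem memH1_of_hasDerivAt {E : Type*} [NormedAddCommGroup E] [NormedSpace ℝ E]
    {u u' : ℝ → E} (hu : ∀ x, HasDerivAt u (u' x) x) (h2 : MemLp u 2) (h2' : MemLp u' 2) :
    MemH1 u :=
  ⟨h2, u', h2', hasWeakDeriv_of_hasDerivAt hu (h2'.locallyIntegrable (by norm_num))⟩

theorem MemH1.congr_ae {E : Type*} [NormedAddCommGroup E] [NormedSpace ℝ E] {u w : ℝ → E}
    (hu : MemH1 u) (h : u =ᵐ[volume] w) : MemH1 w := by
  obtain ⟨hu2, v, hv2, hl, hlv, hw⟩ := hu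
  refine ⟨hu2.ae_eq h, v, hv2, hl.congr h, hlv, fun ψ hψ => ?_⟩
  rw [← hw ψ hψ]
  refine integral_congr_ae ?_
  filter_upwards [h] with x hx
  rw [hx]

theorem MemH1.memLp_deriv {E : Type*} [NormedAddCommGroup E] [NormedSpace ℝ E] [CompleteSpace E]
    {u w w' : ℝ → E}
    (hu : MemH1 u) (h : u =ᵐ[volume] w) (hw : ∀ x, HasDerivAt w (w' x) x)
    (hw' : LocallyIntegrable w') : MemLp w' 2 := by
  obtain ⟨-, v, hv2, -, hlv, hv⟩ := hu.congr_ae h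
  refine hv2.ae_eq ?_
  refine ae_eq_of_integral_contDiff_smul_eq hlv hw' fun ψ h1 h2 => ?_
  have hψ : IsTest ψ := ⟨h1, h2⟩
  have := hv ψ hψ
  rw [integral_deriv_smul_eq_neg hw hw' hψ] at this
  exact (neg_injective this).symm

theorem SchrodingerEq.congr_ae {V : ℝ → ℝ} {u f w k : ℝ → ℂ} (h : SchrodingerEq V u f)
    (hu : u =ᵐ[volume] w) (hf : f =ᵐ[volume] k) : SchrodingerEq V w k := by
  intro ψ hψ
  calc _ = ∫ x, (-deriv (deriv ψ) x + V x * ψ x) • u x := by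
        refine integral_congr_ae ?_
        filter_upwards [hu] with x hx
        rw [hx]
    _ = ∫ x, ψ x • f x := h ψ hψ
    _ = _ := by
        refine integral_congr_ae ?_
        filter_upwards [hf] with x hx
        rw [hx]

theorem locallyIntegrable_continuous_smul {V : ℝ → ℝ} (hV : Continuous V) {u : ℝ → ℂ}
    (hu : LocallyIntegrable u) : LocallyIntegrable fun x => V x • u x := by
  rw [locallyIntegrable_iff] at hu ⊢
  intro K hK
  exact (hu K hK).continuousOn_smul hV.continuousOn hK

theorem integral_schrodinger {V : ℝ → ℝ} (hV : Continuous V) {u : ℝ → ℂ}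
    (hu : LocallyIntegrable u) {ψ : ℝ → ℝ} (hψ : IsTest ψ) :
    ∫ x, (-deriv (deriv ψ) x + V x * ψ x) • u x =
      -(∫ x, deriv (deriv ψ) x • u x) + ∫ x, ψ x • (V x • u x) := by
  rw [← integral_neg, ← integral_add (hψ.isTest_deriv.isTest_deriv.integrable_smul hu).fun_neg
    (hψ.integrable_smul (locallyIntegrable_continuous_smul hV hu))]
  congr 1
  ext x
  rw [add_smul, neg_smul, smul_smul, mul_comm (V x)]

theorem schrodingerEq_of_hasDerivAt {V : ℝ → ℝ} (hV : Continuous V) {u u' f : ℝ → ℂ}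
    (hf : Continuous f) (hu : ∀ x, HasDerivAt u (u' x) x)
    (hu' : ∀ x, HasDerivAt u' (V x * u x - f x) x) : SchrodingerEq V u f := by
  intro ψ hψ
  have hc : Continuous u := continuous_iff_continuousAt.2 fun x => (hu x).continuousAt
  have hc' : Continuous u' := continuous_iff_continuousAt.2 fun x => (hu' x).continuousAt
  have hVu : Continuous fun x => (V x : ℂ) * u x := by fun_prop
  rw [integral_schrodinger hV hc.locallyIntegrable hψ,
    integral_deriv_smul_eq_neg hu hc'.locallyIntegrable hψ.isTest_deriv,
    integral_deriv_smul_eq_neg hu' (hVu.sub hf).locallyIntegrable hψ]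
  simp only [smul_sub]
  rw [integral_sub (hψ.integrable_smul hVu.locallyIntegrable)
    (hψ.integrable_smul hf.locallyIntegrable)]
  simp only [Complex.real_smul]
  ring

theorem SchrodingerEq.weak_deriv_deriv {V : ℝ → ℝ} (hV : Continuous V) {u f : ℝ → ℂ}
    (h : SchrodingerEq V u f) (hu : LocallyIntegrable u) (hf : LocallyIntegrable f)
    (ψ : ℝ → ℝ) (hψ : IsTest ψ) :
    ∫ x, deriv (deriv ψ) x • u x = ∫ x, ψ x • (V x • u x - f x) := by
  have h1 := h ψ hψ
  rw [integral_schrodinger hV hu hψ] at h1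
  simp only [smul_sub]
  rw [integral_sub (hψ.integrable_smul (locallyIntegrable_continuous_smul hV hu))
    (hψ.integrable_smul hf), ← h1]
  ring

/-- A distributional solution of `(-∂ₓ² + V) u = f` with `f` almost everywhere equal to a
continuous function is almost everywhere equal to a classical solution. -/
theorem SchrodingerEq.exists_continuous {V : ℝ → ℝ} (hV : Continuous V) {u f : ℝ → ℂ}
    (h : SchrodingerEq V u f) (hu : LocallyIntegrable u) (hf : LocallyIntegrable f) :
    ∃ v : ℝ → ℂ, Continuous v ∧ u =ᵐ[volume] v := by
  obtain ⟨v, v', -, huv, hv, -⟩ := exists_hasDerivAt_of_weak_deriv_deriv hu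
    ((locallyIntegrable_continuous_smul hV hu).sub hf) (h.weak_deriv_deriv hV hu hf)
  exact ⟨v, continuous_iff_continuousAt.2 fun x => (hv x).continuousAt, huv⟩

theorem SchrodingerEq.hasDerivAt_of_continuous {V : ℝ → ℝ} (hV : Continuous V) {u f : ℝ → ℂ}
    (h : SchrodingerEq V u f) (hu : Continuous u) (hf : Continuous f) :
    ∃ u' : ℝ → ℂ, (∀ x, HasDerivAt u (u' x) x) ∧
      ∀ x, HasDerivAt u' (V x * u x - f x) x := by
  have hVu : Continuous fun x => V x • u x - f x := by fun_prop
  obtain ⟨v, v', b, huv, hv, hv'⟩ := exists_hasDerivAt_of_weak_deriv_deriv hu.locallyIntegrable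
    hVu.locallyIntegrable (h.weak_deriv_deriv hV hu.locallyIntegrable hf.locallyIntegrable)
  have hvc : Continuous v := continuous_iff_continuousAt.2 fun x => (hv x).continuousAt
  obtain rfl : u = v := (hu.ae_eq_iff_eq volume hvc).1 huv
  refine ⟨v', hv, fun x => ?_⟩
  have := (hVu.integral_hasStrictDerivAt 0 x).hasDerivAt.add_const b
  rw [hv']
  simpa using this

/-- Regularity is gained in two passes: locally integrable right-hand sides already give continuous
representatives of `X` and `Y`, and substituting these makes the right-hand sides continuous, so the
equations hold classically. -/
theorem exists_classical_of_schrodingerEq_system {V W : ℝ → ℝ} (hV : Continuous V)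
    (hW : Continuous W) {X Y : ℝ → ℂ} {lam : ℂ} (hX : MemH1 X) (hY : MemH1 Y)
    (h1 : SchrodingerEq V X fun x => lam * Y x) (h2 : SchrodingerEq W Y fun x => lam * X x) :
    ∃ x x' y y' : ℝ → ℂ, X =ᵐ[volume] x ∧ Y =ᵐ[volume] y ∧
      (∀ t, HasDerivAt x (x' t) t) ∧ (∀ t, HasDerivAt x' (V t * x t - lam * y t) t) ∧
      (∀ t, HasDerivAt y (y' t) t) ∧ (∀ t, HasDerivAt y' (W t * y t - lam * x t) t) ∧
      MemLp x 2 ∧ MemLp x' 2 ∧ MemLp y 2 ∧ MemLp y' 2 := by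
  have hXl : LocallyIntegrable X := hX.1.locallyIntegrable (by norm_num)
  have hYl : LocallyIntegrable Y := hY.1.locallyIntegrable (by norm_num)
  have hXl' : LocallyIntegrable fun x => lam * X x := by
    simpa only [smul_eq_mul] using! hXl.smul lam
  have hYl' : LocallyIntegrable fun x => lam * Y x := by
    simpa only [smul_eq_mul] using! hYl.smul lam
  obtain ⟨x, hxc, hx⟩ := h1.exists_continuous hV hXl hYl'
  obtain ⟨y, hyc, hy⟩ := h2.exists_continuous hW hYl hXl'
  obtain ⟨x', hx1, hx2⟩ := (h1.congr_ae hx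
    (hy.fun_comp fun z => lam * z)).hasDerivAt_of_continuous hV hxc (hyc.const_mul lam)
  obtain ⟨y', hy1, hy2⟩ := (h2.congr_ae hy
    (hx.fun_comp fun z => lam * z)).hasDerivAt_of_continuous hW hyc (hxc.const_mul lam)
  have hx'c : Continuous x' := continuous_iff_continuousAt.2 fun t => (hx2 t).continuousAt
  have hy'c : Continuous y' := continuous_iff_continuousAt.2 fun t => (hy2 t).continuousAt
  exact ⟨x, x', y, y', hx, hy, hx1, hx2, hy1, hy2, hX.1.ae_eq hx,
    hX.memLp_deriv hx hx1 hx'c.locallyIntegrable, hY.1.ae_eq hy,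
    hY.memLp_deriv hy hy1 hy'c.locallyIntegrable⟩

/-! ### Global existence and uniqueness for ordinary differential equations. -/

open scoped NNReal BoundedContinuousFunction in
/-- A globally Lipschitz autonomous vector field has a global integral curve through every point:
the Picard operator is a contraction for the weight `exp (-2K|t|)`. -/
theorem exists_forall_hasDerivAt_of_lipschitzWith {E : Type*} [NormedAddCommGroup E]
    [NormedSpace ℝ E] [CompleteSpace E] {f : E → E} {K : ℝ≥0} (hf : LipschitzWith K f) (v₀ : E) :
    ∃ γ : ℝ → E, γ 0 = v₀ ∧ ∀ t, HasDerivAt γ (f (γ t)) t := by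
  -- The contraction factor will be `K / μ ≤ 1 / 2`; the `+ 1` keeps `μ` positive when `K = 0`.
  set μ : ℝ := 2 * K + 1 with hμ
  have hμ0 : 0 < μ := by positivity
  have hexp : ∀ (C : ℝ), 0 ≤ C → ∀ (h : ℝ → E) (t : ℝ), Continuous h →
      (∀ τ, ‖h τ‖ ≤ C * Real.exp (μ * |τ|)) →
      ‖∫ τ in (0 : ℝ)..t, h τ‖ ≤ C / μ * Real.exp (μ * |t|) := by
    have hpos : ∀ (C : ℝ), 0 ≤ C → ∀ (h : ℝ → E) (t : ℝ), 0 ≤ t → Continuous h →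
        (∀ τ, ‖h τ‖ ≤ C * Real.exp (μ * |τ|)) →
        ‖∫ τ in (0 : ℝ)..t, h τ‖ ≤ C / μ * Real.exp (μ * |t|) := by
      intro C hC h t ht hc hb
      have hd : ∀ τ, HasDerivAt (fun τ => C / μ * Real.exp (μ * τ)) (C * Real.exp (μ * τ)) τ := by
        intro τ
        refine ((((hasDerivAt_id τ).const_mul μ).exp).const_mul (C / μ)).congr_deriv ?_
        simp only [id, mul_one]
        field_simp
      have hci : Continuous fun τ => C * Real.exp (μ * τ) := by fun_prop
      calc ‖∫ τ in (0 : ℝ)..t, h τ‖ ≤ ∫ τ in (0 : ℝ)..t, C * Real.exp (μ * τ) := by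
            refine intervalIntegral.norm_integral_le_of_norm_le ht (ae_of_all _ fun τ hτ => ?_)
              (hci.intervalIntegrable _ _)
            have := hb τ
            rwa [abs_of_pos hτ.1] at this
        _ = C / μ * Real.exp (μ * t) - C / μ * Real.exp (μ * 0) :=
            intervalIntegral.integral_eq_sub_of_hasDerivAt (fun τ _ => hd τ)
              (hci.intervalIntegrable _ _)
        _ ≤ _ := by
            rw [abs_of_nonneg ht]
            have : 0 ≤ C / μ * Real.exp (μ * 0) := by positivity
            linarith
    intro C hC h t hc hb
    rcases le_total 0 t with ht | ht
    · exact hpos C hC h t ht hc hb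
    · have := hpos C hC (fun τ => h (-τ)) (-t) (by linarith) (by fun_prop)
        (fun τ => by simpa using hb (-τ))
      rw [intervalIntegral.integral_comp_neg] at this
      rw [intervalIntegral.integral_symm, norm_neg]
      simpa using this
  have hfc : Continuous f := hf.continuous
  have hfn : ∀ v, ‖f v‖ ≤ ‖f 0‖ + K * ‖v‖ := fun v => by
    have := hf.norm_sub_le v 0
    rw [sub_zero] at this
    linarith [norm_le_norm_add_norm_sub' (f v) (f 0)]
  set w : ℝ → ℝ := fun t => Real.exp (μ * |t|) with hw
  have hwc : Continuous w := by fun_prop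
  have hw1 : ∀ t, 1 ≤ w t := fun t => Real.one_le_exp (by positivity)
  have hw0 : ∀ t, 0 < w t := fun t => Real.exp_pos _
  have hcomp : ∀ u : ℝ →ᵇ E, Continuous fun τ => f (w τ • u τ) := fun u =>
    hfc.comp (hwc.smul u.continuous)
  have hbd : ∀ (u : ℝ →ᵇ E) (τ : ℝ), ‖f (w τ • u τ)‖ ≤ (‖f 0‖ + K * ‖u‖) * w τ := by
    intro u τ
    refine (hfn _).trans ?_
    rw [norm_smul, Real.norm_of_nonneg (hw0 τ).le]
    have h1 := u.norm_coe_le_norm τ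
    have h2 := hw1 τ
    have h3 : (K : ℝ) * (w τ * ‖u τ‖) ≤ K * (w τ * ‖u‖) := by gcongr
    nlinarith [norm_nonneg (f 0)]
  -- The unknown is the rescaled curve `w⁻¹ γ`, so that the weighted norm becomes the plain sup norm
  -- on bounded continuous functions.
  let Φ : (ℝ →ᵇ E) → (ℝ →ᵇ E) := fun u =>
    BoundedContinuousFunction.ofNormedAddCommGroup
      (fun t => (w t)⁻¹ • (v₀ + ∫ τ in (0 : ℝ)..t, f (w τ • u τ)))
      ((hwc.inv₀ fun t => (hw0 t).ne').smul (continuous_const.add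
        (continuous_primitive_of_locallyIntegrable (hcomp u).locallyIntegrable)))
      (‖v₀‖ + (‖f 0‖ + K * ‖u‖) / μ) (fun t => by
        rw [norm_smul, norm_inv, Real.norm_of_nonneg (hw0 t).le, inv_mul_le_iff₀ (hw0 t)]
        have h1 := hexp _ (by positivity) _ t (hcomp u) (hbd u)
        calc _ ≤ ‖v₀‖ + ‖∫ τ in (0 : ℝ)..t, f (w τ • u τ)‖ := norm_add_le _ _
          _ ≤ w t * ‖v₀‖ + (‖f 0‖ + K * ‖u‖) / μ * w t := by
              gcongr
              exact le_mul_of_one_le_left (norm_nonneg _) (hw1 t)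
          _ = _ := by ring)
  have hΦ : ∀ u t, Φ u t = (w t)⁻¹ • (v₀ + ∫ τ in (0 : ℝ)..t, f (w τ • u τ)) := fun _ _ => rfl
  have hcontr : ContractingWith (1 / 2) Φ := by
    refine ⟨by norm_num, LipschitzWith.of_dist_le_mul fun u v => ?_⟩
    rw [BoundedContinuousFunction.dist_le (by positivity)]
    intro t
    rw [hΦ, hΦ, dist_eq_norm, ← smul_sub, norm_smul, norm_inv, Real.norm_of_nonneg (hw0 t).le,
      inv_mul_le_iff₀ (hw0 t), add_sub_add_left_eq_sub, ← intervalIntegral.integral_sub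
      ((hcomp u).intervalIntegrable _ _) ((hcomp v).intervalIntegrable _ _)]
    have h1 := hexp (K * dist u v) (by positivity)
      (fun τ => f (w τ • u τ) - f (w τ • v τ)) t ((hcomp u).sub (hcomp v)) (fun τ => by
        refine (hf.norm_sub_le _ _).trans ?_
        rw [← smul_sub, norm_smul, Real.norm_of_nonneg (hw0 τ).le, ← dist_eq_norm, mul_assoc,
          mul_comm (w τ)]
        gcongr
        exact BoundedContinuousFunction.dist_coe_le_dist τ)
    refine h1.trans ?_
    have h2 : K * dist u v / μ ≤ 1 / 2 * dist u v := by
      rw [div_le_iff₀ hμ0, hμ]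
      nlinarith [dist_nonneg (x := u) (y := v)]
    calc _ ≤ 1 / 2 * dist u v * Real.exp (μ * |t|) := by gcongr
      _ = _ := by simp only [hw]; push_cast; ring
  have hfix := hcontr.fixedPoint_isFixedPt
  set u := hcontr.fixedPoint Φ
  have hu : ∀ t, w t • u t = v₀ + ∫ τ in (0 : ℝ)..t, f (w τ • u τ) := by
    intro t
    have : Φ u t = u t := by rw [hfix]
    rw [← this, hΦ, smul_smul, mul_inv_cancel₀ (hw0 t).ne', one_smul]
  refine ⟨fun t => w t • u t, by simp [hu 0], fun t => ?_⟩
  have h1 := ((hcomp u).integral_hasStrictDerivAt 0 t).hasDerivAt.const_add v₀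
  exact h1.congr_of_eventuallyEq (Eventually.of_forall hu)

/-- Gronwall uniqueness for second order differential inequalities. -/
theorem eq_zero_of_norm_deriv_deriv_le {E : Type*} [NormedAddCommGroup E] [NormedSpace ℝ E]
    {u u' u'' : ℝ → E} {C : ℝ → ℝ} (hC : Continuous C) (h1 : ∀ x, HasDerivAt u (u' x) x)
    (h2 : ∀ x, HasDerivAt u' (u'' x) x) (hb : ∀ x, ‖u'' x‖ ≤ C x * ‖u x‖)
    {a : ℝ} (h0 : u a = 0) (h0' : u' a = 0) : ∀ x, u x = 0 := by
  have main : ∀ {u u' u'' : ℝ → E} {C : ℝ → ℝ} {a : ℝ}, Continuous C →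
      (∀ x, HasDerivAt u (u' x) x) → (∀ x, HasDerivAt u' (u'' x) x) →
      (∀ x, ‖u'' x‖ ≤ C x * ‖u x‖) → u a = 0 → u' a = 0 → ∀ x, a ≤ x → u x = 0 := by
    intro u u' u'' C a hC h1 h2 hb h0 h0' x hx
    obtain ⟨M, hM⟩ := (isCompact_Icc (a := a) (b := x)).bddAbove_image hC.continuousOn
    have hd : ∀ t, HasDerivAt (fun t => (u t, u' t)) (u' t, u'' t) t := fun t =>
      (h1 t).prodMk (h2 t)
    have := eq_zero_of_abs_deriv_le_mul_abs_self_of_eq_zero_right (f := fun t => (u t, u' t))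
      (f' := fun t => (u' t, u'' t)) (K := max 1 |M|) (a := a) (b := x)
      (fun t _ => (hd t).continuousAt.continuousWithinAt)
      (fun t _ => (hd t).hasDerivWithinAt) (by simp [h0, h0']) (fun t ht => by
        have hCt : C t ≤ |M| := (hM ⟨t, ⟨ht.1, ht.2.le⟩, rfl⟩).trans (le_abs_self M)
        simp only [Prod.norm_def]
        refine max_le ?_ ?_
        · calc ‖u' t‖ ≤ 1 * max ‖u t‖ ‖u' t‖ := by rw [one_mul]; exact le_max_right _ _
            _ ≤ _ := by gcongr; exact le_max_left _ _
        · calc ‖u'' t‖ ≤ C t * ‖u t‖ := hb t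
            _ ≤ |M| * ‖u t‖ := by gcongr
            _ ≤ _ := by gcongr; exacts [le_max_right _ _, le_max_left _ _]) x ⟨hx, le_rfl⟩
    exact congrArg Prod.fst this
  intro x
  rcases le_total a x with hx | hx
  · exact main hC h1 h2 hb h0 h0' x hx
  · have := main (u := fun t => u (-t)) (u' := fun t => -u' (-t)) (u'' := fun t => u'' (-t))
      (C := fun t => C (-t)) (a := -a) (by fun_prop)
      (fun t => by simpa [Function.comp_def] using (h1 (-t)).scomp t (hasDerivAt_neg t))
      (fun t => by simpa [Function.comp_def] using ((h2 (-t)).scomp t (hasDerivAt_neg t)).fun_neg)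
      (fun t => hb (-t)) (by simpa using h0) (by simpa using h0') (-x) (by linarith)
    simpa using this

/-! ### The nonlinearity near zero. -/

/-- The potential perturbing `-∂ₓ² + ω` in the second transformed equation, as a function of
`s = φ²`. -/
def pertTwo (g : ℝ → ℝ) (s : ℝ) : ℝ := 2 * (primitive g s / s) - g s

/-- The potential perturbing `-∂ₓ² + ω` in the first transformed equation, as a function of
`s = φ²`. -/
def pertOne (g : ℝ → ℝ) (s : ℝ) : ℝ := 6 * (primitive g s / s) - 5 * g s + 2 * s * deriv g s

/-- The square of the logarithmic derivative of a solitary wave, as a function of `s = φ²`. -/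
def logDerivSq (g : ℝ → ℝ) (ω s : ℝ) : ℝ := ω - s / 2 + primitive g s / s

section Nonlinearity

variable {g : ℝ → ℝ}

theorem H1.hasDerivAt (h : H1 g) {s : ℝ} (hs : 0 < s) : HasDerivAt g (deriv g s) s :=
  (((h.1 s hs).contDiffAt (Ioi_mem_nhds hs)).differentiableAt (by norm_num)).hasDerivAt

theorem H1.contDiffOn_deriv (h : H1 g) : ContDiffOn ℝ 4 (deriv g) (Set.Ioi 0) :=
  ((contDiffOn_succ_iff_deriv_of_isOpen (n := 4) isOpen_Ioi).1 h.1).2.2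

theorem H1.hasDerivAt_deriv (h : H1 g) {s : ℝ} (hs : 0 < s) :
    HasDerivAt (deriv g) (iteratedDeriv 2 g s) s := by
  have := (((h.contDiffOn_deriv s hs).contDiffAt (Ioi_mem_nhds hs)).differentiableAt
    (by norm_num)).hasDerivAt
  rwa [iteratedDeriv_succ, iteratedDeriv_one]

theorem H1.continuousOn (h : H1 g) : ContinuousOn g (Set.Ici 0) := h.2.1.continuousOn

theorem H1.continuousOn_deriv (h : H1 g) : ContinuousOn (deriv g) (Set.Ioi 0) :=
  h.contDiffOn_deriv.continuousOn

theorem H1.isLittleO (h : H1 g) : g =o[𝓝[>] 0] fun s => s := by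
  simpa using h.2.2.1 0 (by norm_num)

theorem H1.tendsto_deriv (h : H1 g) : Tendsto (deriv g) (𝓝[>] 0) (𝓝 0) := by
  have := h.2.2.1 1 (by norm_num)
  simp only [iteratedDeriv_one, Nat.cast_one, sub_self, zpow_zero] at this
  exact (isLittleO_one_iff ℝ).1 this

theorem H1.tendsto_mul_deriv_deriv (h : H1 g) :
    Tendsto (fun s => s * iteratedDeriv 2 g s) (𝓝[>] 0) (𝓝 0) := by
  have := h.2.2.1 2 (by norm_num)
  rw [isLittleO_iff] at this
  rw [Metric.tendsto_nhds]
  intro ε hε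
  filter_upwards [this (half_pos hε), self_mem_nhdsWithin] with s hs hs0
  have hs0' : (0 : ℝ) < s := hs0
  rw [dist_zero_right, norm_mul]
  have h1 : ‖s ^ (1 - ((2 : ℕ) : ℤ))‖ = s⁻¹ := by
    rw [norm_zpow, Real.norm_of_nonneg hs0'.le]
    norm_num
  rw [h1] at hs
  calc ‖s‖ * ‖iteratedDeriv 2 g s‖ ≤ s * (ε / 2 * s⁻¹) := by
        rw [Real.norm_of_nonneg hs0'.le]; gcongr
    _ = ε / 2 := by field_simp
    _ < ε := half_lt_self hε

theorem H1.zero (h : H1 g) : g 0 = 0 := by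
  have h1 : Tendsto g (𝓝[>] 0) (𝓝 0) :=
    h.isLittleO.trans_tendsto (tendsto_nhdsWithin_of_tendsto_nhds tendsto_id)
  have h2 : Tendsto g (𝓝[>] 0) (𝓝 (g 0)) :=
    (h.continuousOn 0 Set.self_mem_Ici).mono_left (nhdsWithin_mono _ Set.Ioi_subset_Ici_self)
  exact tendsto_nhds_unique h2 h1

theorem primitive_zero : primitive g 0 = 0 := by simp [primitive]

theorem H1.intervalIntegrable (h : H1 g) {s : ℝ} (hs : 0 ≤ s) :
    IntervalIntegrable g volume 0 s := by
  refine (h.continuousOn.mono ?_).intervalIntegrable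
  rw [Set.uIcc_of_le hs]
  exact Set.Icc_subset_Ici_self

theorem H1.hasDerivAt_primitive (h : H1 g) {s : ℝ} (hs : 0 < s) :
    HasDerivAt (primitive g) (g s) s :=
  intervalIntegral.integral_hasDerivAt_right (h.intervalIntegrable hs.le)
    (ContinuousOn.stronglyMeasurableAtFilter isOpen_Ioi
      (h.continuousOn.mono Set.Ioi_subset_Ici_self) s hs) (h.hasDerivAt hs).continuousAt

theorem H1.continuousOn_primitive (h : H1 g) : ContinuousOn (primitive g) (Set.Ici 0) := by
  intro s hs
  have h1 : ContinuousOn (primitive g) (Set.uIcc 0 (s + 1)) :=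
    intervalIntegral.continuousOn_primitive_interval
      ((intervalIntegrable_iff' ).1 (h.intervalIntegrable (by linarith [Set.mem_Ici.1 hs])))
  rw [Set.uIcc_of_le (by linarith [Set.mem_Ici.1 hs])] at h1
  refine (h1 s ⟨hs, by linarith⟩).mono_of_mem_nhdsWithin ?_
  rw [← Set.Ici_inter_Iic]
  exact inter_mem self_mem_nhdsWithin (mem_nhdsWithin_of_mem_nhds (Iic_mem_nhds (by linarith)))

/-- The derivative of `t g'(t) - g(t)` is `t g''(t)`, and the function vanishes at `0`; apply the
mean value theorem. -/
theorem H1.abs_mul_deriv_sub_le (h : H1 g) {S ε : ℝ}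
    (hε : ∀ s, 0 < s → s ≤ S → |s * iteratedDeriv 2 g s| ≤ ε) {s : ℝ} (hs : 0 < s) (hsS : s ≤ S) :
    |s * deriv g s - g s| ≤ ε * s := by
  have hd : ∀ t, 0 < t → HasDerivAt (fun t => t * deriv g t - g t) (t * iteratedDeriv 2 g t) t := by
    intro t ht
    exact (((hasDerivAt_id t).mul (h.hasDerivAt_deriv ht)).sub (h.hasDerivAt ht)).congr_deriv
      (by simp)
  have hc : ContinuousOn (fun t => t * deriv g t - g t) (Set.Icc 0 s) := by
    intro t ht
    rcases ht.1.eq_or_lt with rfl | ht0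
    · have h1 : ContinuousWithinAt (fun t => t * deriv g t) (Set.Ici 0) 0 := by
        rw [← continuousWithinAt_Ioi_iff_Ici, ContinuousWithinAt, zero_mul]
        have := (tendsto_nhdsWithin_of_tendsto_nhds (s := Set.Ioi (0 : ℝ))
          (tendsto_id (α := ℝ) (x := 𝓝 0))).mul h.tendsto_deriv
        simpa using this
      exact (h1.sub (h.continuousOn 0 Set.self_mem_Ici)).mono Set.Icc_subset_Ici_self
    · exact (hd t ht0).continuousAt.continuousWithinAt
  obtain ⟨c, hc1, hc2⟩ := exists_hasDerivAt_eq_slope _ _ hs hc fun t ht => hd t ht.1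
  have h2 := hε c hc1.1 (hc1.2.le.trans hsS)
  simp only [zero_mul, h.zero, sub_zero] at hc2
  rw [hc2, abs_div, abs_of_pos hs, div_le_iff₀ hs] at h2
  exact h2

/-- The derivative of `G(t) - t g(t) / 2` is `-(t g'(t) - g(t)) / 2`, which the previous estimate
controls. -/
theorem H1.abs_primitive_sub_le (h : H1 g) {S ε : ℝ} (hε0 : 0 ≤ ε)
    (hε : ∀ s, 0 < s → s ≤ S → |s * iteratedDeriv 2 g s| ≤ ε) {s : ℝ} (hs : 0 < s) (hsS : s ≤ S) :
    |primitive g s - s * g s / 2| ≤ ε * s ^ 2 / 2 := by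
  have hd : ∀ t, 0 < t → HasDerivAt (fun t => primitive g t - t * g t / 2)
      (-(t * deriv g t - g t) / 2) t := by
    intro t ht
    refine ((h.hasDerivAt_primitive ht).sub
      (((hasDerivAt_id t).mul (h.hasDerivAt ht)).div_const 2)).congr_deriv ?_
    simp only [id]
    ring
  have hc : ContinuousOn (fun t => primitive g t - t * g t / 2) (Set.Icc 0 s) :=
    (h.continuousOn_primitive.sub ((continuousOn_id.mul h.continuousOn).div_const 2)).mono
      Set.Icc_subset_Ici_self
  obtain ⟨c, hc1, hc2⟩ := exists_hasDerivAt_eq_slope _ _ hs hc fun t ht => hd t ht.1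
  have h2 := h.abs_mul_deriv_sub_le hε hc1.1 (hc1.2.le.trans hsS)
  simp only [zero_mul, primitive_zero, sub_zero, zero_div] at hc2
  have h3 : |(primitive g s - s * g s / 2) / s| ≤ ε * s / 2 := by
    rw [← hc2, abs_div, abs_neg, abs_of_pos (two_pos : (0 : ℝ) < 2)]
    have : ε * c ≤ ε * s := by gcongr; exact hc1.2.le
    linarith
  rw [abs_div, abs_of_pos hs, div_le_iff₀ hs] at h3
  linarith

/-- The bounds on the perturbations by `sup |s g''(s)|`. -/
theorem H1.abs_pert_le (h : H1 g) {S ε : ℝ} (hε0 : 0 ≤ ε)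
    (hε : ∀ s, 0 < s → s ≤ S → |s * iteratedDeriv 2 g s| ≤ ε) {s : ℝ} (hs : 0 < s) (hsS : s ≤ S) :
    |pertOne g s| ≤ 5 * ε * s ∧ |pertTwo g s| ≤ ε * s := by
  have h1 := abs_le.1 (h.abs_mul_deriv_sub_le hε hs hsS)
  have h2 := h.abs_primitive_sub_le hε0 hε hs hsS
  have h3 : |primitive g s / s - g s / 2| ≤ ε * s / 2 := by
    have : primitive g s / s - g s / 2 = (primitive g s - s * g s / 2) / s := by field_simp
    rw [this, abs_div, abs_of_pos hs, div_le_iff₀ hs]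
    linarith
  have h4 := abs_le.1 h3
  -- `pertTwo` is `2 (G/s - g/2)` and `pertOne` is `6 (G/s - g/2) + 2 (s g' - g)`, whence the
  -- factors `1` and `3 + 2 = 5`.
  unfold pertOne pertTwo
  constructor <;> rw [abs_le] <;> constructor <;> linarith

theorem H1.exists_abs_le (h : H1 g) {η : ℝ} (hη : 0 < η) :
    ∃ δ : ℝ, 0 < δ ∧ ∀ s, 0 < s → s ≤ δ →
      |g s| ≤ η * s ∧ |primitive g s| ≤ η * s ^ 2 ∧ |s * iteratedDeriv 2 g s| ≤ η := by
  have h1 := (isLittleO_iff.1 h.isLittleO) hη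
  have h2 := (Metric.tendsto_nhds.1 h.tendsto_mul_deriv_deriv) η hη
  obtain ⟨u, hu, hsub⟩ := mem_nhdsGT_iff_exists_Ioc_subset.1 (h1.and h2)
  have hu : 0 < u := hu
  have hg : ∀ s, 0 < s → s ≤ u → |g s| ≤ η * s := by
    intro s hs hsu
    have := (hsub ⟨hs, hsu⟩).1
    simpa [abs_of_pos hs] using this
  refine ⟨u, hu, fun s hs hsu => ⟨hg s hs hsu, ?_, ?_⟩⟩
  · obtain ⟨c, hc1, hc2⟩ := exists_hasDerivAt_eq_slope (primitive g) g hs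
      (h.continuousOn_primitive.mono Set.Icc_subset_Ici_self) fun t ht =>
        h.hasDerivAt_primitive ht.1
    have h3 := hg c hc1.1 (hc1.2.le.trans hsu)
    rw [hc2, primitive_zero, sub_zero, sub_zero, abs_div, abs_of_pos hs, div_le_iff₀ hs] at h3
    calc _ ≤ η * c * s := h3
      _ ≤ η * s * s := by gcongr; exact hc1.2.le
      _ = _ := by ring
  · have := (hsub ⟨hs, hsu⟩).2
    rw [dist_zero_right] at this
    exact this.le

theorem abs_mul_deriv_deriv_le_eps {ω η : ℝ} (hη0 : 0 ≤ η)
    (hη : ∀ s, 0 < s → s ≤ 3 * ω → |s * iteratedDeriv 2 g s| ≤ η) {s : ℝ} (hs : 0 ≤ s)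
    (hs' : s ≤ 3 * ω) : |s * iteratedDeriv 2 g s| ≤ eps g ω := by
  refine le_csSup ⟨η, ?_⟩ ⟨s, ⟨hs, hs'⟩, rfl⟩
  rintro _ ⟨t, ht, rfl⟩
  rcases ht.1.eq_or_lt with rfl | ht0
  · simpa using hη0
  · exact hη t ht0 ht.2

theorem eps_nonneg (ω : ℝ) : 0 ≤ eps g ω := by
  refine Real.sSup_nonneg ?_
  rintro _ ⟨t, -, rfl⟩
  exact abs_nonneg _

theorem eps_le {ω η : ℝ} (hω : 0 ≤ ω) (hη0 : 0 ≤ η)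
    (hη : ∀ s, 0 < s → s ≤ 3 * ω → |s * iteratedDeriv 2 g s| ≤ η) : eps g ω ≤ η := by
  refine csSup_le ⟨_, ⟨0, ⟨le_rfl, by linarith⟩, rfl⟩⟩ ?_
  rintro _ ⟨t, ht, rfl⟩
  rcases ht.1.eq_or_lt with rfl | ht0
  · simpa using hη0
  · exact hη t ht0 ht.2

theorem H1.hasDerivAt_primitive_div (h : H1 g) {s : ℝ} (hs : 0 < s) :
    HasDerivAt (fun s => primitive g s / s) (g s / s - primitive g s / s ^ 2) s := by
  refine ((h.hasDerivAt_primitive hs).div (hasDerivAt_id s) hs.ne').congr_deriv ?_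
  simp only [id]
  field_simp

theorem H1.hasDerivAt_logDerivSq (h : H1 g) (ω : ℝ) {s : ℝ} (hs : 0 < s) :
    HasDerivAt (logDerivSq g ω) (-1 / 2 + (g s / s - primitive g s / s ^ 2)) s := by
  refine ((((hasDerivAt_id s).div_const 2).const_sub ω).add
    (h.hasDerivAt_primitive_div hs)).congr_deriv ?_
  ring

/-- Standing smallness assumption on the frequency: `g(s) = o(s)` and `s g''(s) = o(1)` are
quantified on a fixed interval `(0, δ]` that contains `(0, 3ω]`. -/
def IsSmall (g : ℝ → ℝ) (δ ω : ℝ) : Prop :=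
  0 < ω ∧ 3 * ω ≤ δ ∧ ∀ s, 0 < s → s ≤ δ →
    |g s| ≤ 1 / 16 * s ∧ |primitive g s| ≤ 1 / 16 * s ^ 2 ∧ |s * iteratedDeriv 2 g s| ≤ 1 / 16

theorem H1.exists_isSmall (h : H1 g) :
    ∃ δ : ℝ, 0 < δ ∧ ∀ ω, 0 < ω → ω < δ / 3 → IsSmall g δ ω := by
  obtain ⟨δ, hδ, hb⟩ := h.exists_abs_le (η := 1 / 16) (by norm_num)
  exact ⟨δ, hδ, fun ω hω hω' => ⟨hω, by linarith, hb⟩⟩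

variable {δ ω : ℝ}

theorem IsSmall.abs_div_le (hsm : IsSmall g δ ω) {s : ℝ} (hs : 0 < s) (hs' : s ≤ δ) :
    |g s / s| ≤ 1 / 16 ∧ |primitive g s / s ^ 2| ≤ 1 / 16 ∧ |primitive g s / s| ≤ 1 / 16 * s := by
  obtain ⟨h1, h2, -⟩ := hsm.2.2 s hs hs'
  refine ⟨?_, ?_, ?_⟩
  · rw [abs_div, abs_of_pos hs, div_le_iff₀ hs]; exact h1
  · rw [abs_div, abs_of_pos (pow_pos hs 2), div_le_iff₀ (pow_pos hs 2)]; exact h2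
  · rw [abs_div, abs_of_pos hs, div_le_iff₀ hs]; linarith

/-- The cubic term contributes `-1/2` to the derivative, while `g/s` and `G/s²` contribute at most
`1/16` each. -/
theorem H1.strictAntiOn_logDerivSq (h : H1 g) (hsm : IsSmall g δ ω) :
    StrictAntiOn (logDerivSq g ω) (Set.Ioc 0 δ) := by
  refine strictAntiOn_of_deriv_neg (convex_Ioc 0 δ)
    (fun s hs => (h.hasDerivAt_logDerivSq ω hs.1).continuousAt.continuousWithinAt) fun s hs => ?_
  rw [interior_Ioc] at hs
  rw [(h.hasDerivAt_logDerivSq ω hs.1).deriv]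
  obtain ⟨h1, h2, -⟩ := hsm.abs_div_le hs.1 hs.2.le
  linarith [(abs_le.1 h1).2, (abs_le.1 h2).1]

/-- The logarithmic derivative vanishes at exactly one small amplitude. -/
theorem H1.exists_logDerivSq_eq_zero (h : H1 g) (hsm : IsSmall g δ ω) :
    ∃ s₀, 0 < s₀ ∧ s₀ ≤ 3 * ω ∧ logDerivSq g ω s₀ = 0 := by
  have hω := hsm.1
  have hc : ContinuousOn (logDerivSq g ω) (Set.Icc ω (3 * ω)) := fun s hs =>
    (h.hasDerivAt_logDerivSq ω (hω.trans_le hs.1)).continuousAt.continuousWithinAt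
  have h3 := (hsm.abs_div_le (s := 3 * ω) (by linarith) hsm.2.1).2.2
  have h4 := (hsm.abs_div_le (s := ω) hω (by linarith [hsm.2.1])).2.2
  obtain ⟨s, hs, hs0⟩ := intermediate_value_Icc' (by linarith) hc
    (show (0 : ℝ) ∈ _ from ⟨by unfold logDerivSq; linarith [(abs_le.1 h3).2],
      by unfold logDerivSq; linarith [(abs_le.1 h4).1]⟩)
  exact ⟨s, hω.trans_le hs.1, hs.2, hs0⟩

end Nonlinearity

/-! ### The equation of the inverse profile: uniqueness and decay. -/

/-- The vector field of the second order equation satisfied by the inverse `1 / φ` of a solitary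
wave, extended by a constant below the minimum `k₀`. -/
def inverseField (g : ℝ → ℝ) (ω k₀ k : ℝ) : ℝ :=
  (ω + pertTwo g ((max k k₀ ^ 2)⁻¹)) * max k k₀

section Wave

variable {g : ℝ → ℝ} {δ ω : ℝ}

theorem IsSmall.abs_pert_le (h : H1 g) (hsm : IsSmall g δ ω) {s : ℝ} (hs : 0 < s)
    (hs' : s ≤ 3 * ω) : |pertOne g s| ≤ 15 / 16 * ω ∧ |pertTwo g s| ≤ 3 / 16 * ω := by
  obtain ⟨h1, h2⟩ := h.abs_pert_le (S := 3 * ω) (by norm_num)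
    (fun s hs hs' => (hsm.2.2 s hs (hs'.trans hsm.2.1)).2.2) hs hs'
  constructor <;> linarith

theorem H1.hasDerivAt_pertTwo (h : H1 g) {s : ℝ} (hs : 0 < s) :
    HasDerivAt (pertTwo g) (2 * (g s / s - primitive g s / s ^ 2) - deriv g s) s :=
  ((h.hasDerivAt_primitive_div hs).const_mul 2).sub (h.hasDerivAt hs)

theorem hasDerivAt_inv_sq {m : ℝ} (hm : 0 < m) :
    HasDerivAt (fun m : ℝ => (m ^ 2)⁻¹) (-2 * (m ^ 2)⁻¹ / m) m := by
  refine ((hasDerivAt_pow 2 m).inv (pow_pos hm 2).ne').congr_deriv ?_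
  field_simp
  norm_num
  ring

/-- The derivative of `(ω + pertTwo g (m⁻²)) m` in `m` is exactly `ω + pertOne g (m⁻²)`, at most `ω
+ 15 ω / 16` in absolute value. The truncation at `k₀` is 1-Lipschitz. -/
theorem H1.lipschitzWith_inverseField (h : H1 g) (hsm : IsSmall g δ ω) {k₀ : ℝ} (hk₀ : 0 < k₀)
    (hk₀' : (k₀ ^ 2)⁻¹ ≤ 3 * ω) (a b : ℝ) :
    |inverseField g ω k₀ a - inverseField g ω k₀ b| ≤ 2 * ω * |a - b| := by
  have hd : ∀ m ∈ Set.Ici k₀, HasDerivWithinAt (fun m => (ω + pertTwo g ((m ^ 2)⁻¹)) * m)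
      (ω + pertOne g ((m ^ 2)⁻¹)) (Set.Ici k₀) m := by
    intro m hm
    have hm0 : 0 < m := hk₀.trans_le hm
    have hs : 0 < (m ^ 2)⁻¹ := by positivity
    refine HasDerivAt.hasDerivWithinAt ?_
    refine ((((h.hasDerivAt_pertTwo hs).comp m (hasDerivAt_inv_sq hm0)).const_add ω).mul
      (hasDerivAt_id m)).congr_deriv ?_
    simp only [Function.comp, id, pertOne, pertTwo]
    set s := (m ^ 2)⁻¹
    field_simp
    ring
  have key := (convex_Ici k₀).norm_image_sub_le_of_norm_hasDerivWithin_le hd (C := 2 * ω)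
    (fun m hm => by
      have hm0 : 0 < m := hk₀.trans_le hm
      have hs : 0 < (m ^ 2)⁻¹ := by positivity
      have hs' : (m ^ 2)⁻¹ ≤ 3 * ω := by
        refine le_trans ?_ hk₀'
        have : k₀ ≤ m := hm
        gcongr
      have := abs_le.1 (hsm.abs_pert_le h hs hs').1
      have hω := hsm.1
      rw [Real.norm_eq_abs, abs_le]
      constructor <;> linarith)
    (Set.mem_Ici.2 (le_max_right b k₀)) (Set.mem_Ici.2 (le_max_right a k₀))
  refine le_trans key ?_
  have hω := hsm.1
  gcongr
  exact abs_max_sub_max_le_abs a b k₀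

/-- The function `u - c x² / 2` is convex with a critical point at `0`, hence minimal there. -/
theorem add_sq_le_of_le_deriv_deriv {u u' u'' : ℝ → ℝ} {c : ℝ} (h1 : ∀ x, HasDerivAt u (u' x) x)
    (h2 : ∀ x, HasDerivAt u' (u'' x) x) (hc : ∀ x, c ≤ u'' x) (h0 : u' 0 = 0) (x : ℝ) :
    u 0 + c * x ^ 2 / 2 ≤ u x := by
  have hd1 : ∀ x, HasDerivAt (fun x => u x - c * x ^ 2 / 2) (u' x - c * x) x := fun x =>
    ((h1 x).sub (((hasDerivAt_pow 2 x).const_mul c).div_const 2)).congr_deriv (by simp; ring)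
  have hd2 : ∀ x, HasDerivAt (fun x => u' x - c * x) (u'' x - c) x := fun x =>
    ((h2 x).sub ((hasDerivAt_id x).const_mul c)).congr_deriv (by simp)
  have hmono : Monotone fun x => u' x - c * x :=
    monotone_of_hasDerivAt_nonneg hd2 fun x => sub_nonneg.2 (hc x)
  have hcont : Continuous fun x => u x - c * x ^ 2 / 2 :=
    continuous_iff_continuousAt.2 fun x => (hd1 x).continuousAt
  rcases le_total 0 x with hx | hx
  · have : MonotoneOn (fun x => u x - c * x ^ 2 / 2) (Set.Ici 0) := by
      refine monotoneOn_of_deriv_nonneg (convex_Ici 0) hcont.continuousOn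
        (fun y _ => (hd1 y).differentiableAt.differentiableWithinAt) fun y hy => ?_
      rw [interior_Ici] at hy
      rw [(hd1 y).deriv]
      have := hmono (le_of_lt hy)
      simpa [h0] using this
    have := this Set.self_mem_Ici hx hx
    simp only at this
    linarith
  · have : AntitoneOn (fun x => u x - c * x ^ 2 / 2) (Set.Iic 0) := by
      refine antitoneOn_of_deriv_nonpos (convex_Iic 0) hcont.continuousOn
        (fun y _ => (hd1 y).differentiableAt.differentiableWithinAt) fun y hy => ?_
      rw [interior_Iic] at hy
      rw [(hd1 y).deriv]
      have := hmono (le_of_lt hy)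
      simpa [h0] using this
    have := this hx Set.self_mem_Iic hx
    simp only at this
    linarith

theorem H1.le_inverseField (h : H1 g) (hsm : IsSmall g δ ω) {k₀ : ℝ} (hk₀ : 0 < k₀)
    (hk₀' : (k₀ ^ 2)⁻¹ ≤ 3 * ω) (k : ℝ) : ω / 2 * k₀ ≤ inverseField g ω k₀ k := by
  have hm : k₀ ≤ max k k₀ := le_max_right _ _
  have hm0 : 0 < max k k₀ := hk₀.trans_le hm
  have hs : 0 < (max k k₀ ^ 2)⁻¹ := by positivity
  have hs' : (max k k₀ ^ 2)⁻¹ ≤ 3 * ω := by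
    refine le_trans ?_ hk₀'
    gcongr
  have := abs_le.1 (hsm.abs_pert_le h hs hs').2
  have hω := hsm.1
  have h1 : ω / 2 ≤ ω + pertTwo g ((max k k₀ ^ 2)⁻¹) := by linarith
  exact mul_le_mul h1 hm hk₀.le (by linarith)

/-- Quadratic growth of `k = 1/φ` gives `φ² = O(x⁻⁴)`. This is enough for the sequel, which needs
only that `φ²` is dominated by a weight `σ` with `σ` and `|x| σ` integrable. -/
theorem H1.lower_bound_of_inverseField (h : H1 g) (hsm : IsSmall g δ ω) {k₀ : ℝ} (hk₀ : 0 < k₀)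
    (hk₀' : (k₀ ^ 2)⁻¹ ≤ 3 * ω) {k k' : ℝ → ℝ} (hk : ∀ x, HasDerivAt k (k' x) x)
    (hk' : ∀ x, HasDerivAt k' (inverseField g ω k₀ (k x)) x) (h0 : k 0 = k₀) (h0' : k' 0 = 0)
    (x : ℝ) : k₀ * (1 + ω * x ^ 2 / 4) ≤ k x := by
  have := add_sq_le_of_le_deriv_deriv hk hk' (fun x => h.le_inverseField hsm hk₀ hk₀' (k x)) h0' x
  rw [h0] at this
  linarith

namespace IsSolitaryWave

variable {φ : ℝ → ℝ}

theorem hasDerivAt (hφ : IsSolitaryWave g ω φ) (x : ℝ) : HasDerivAt φ (deriv φ x) x :=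
  (hφ.contDiff.differentiable (by norm_num) x).hasDerivAt

theorem hasDerivAt_deriv (hφ : IsSolitaryWave g ω φ) (x : ℝ) :
    HasDerivAt (deriv φ) (ω * φ x - φ x ^ 3 + φ x * g (φ x ^ 2)) x := by
  rw [← hφ.eqn x]
  have : ContDiff ℝ 1 (deriv φ) := (contDiff_succ_iff_deriv (n := 1)).1 hφ.contDiff |>.2.2
  exact (this.differentiable (by norm_num) x).hasDerivAt

theorem continuous (hφ : IsSolitaryWave g ω φ) : Continuous φ := hφ.contDiff.continuous

theorem continuous_comp_sq (hφ : IsSolitaryWave g ω φ) {F : ℝ → ℝ}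
    (hF : ContinuousOn F (Set.Ici 0)) : Continuous fun x => F (φ x ^ 2) :=
  hF.comp_continuous (by have := hφ.continuous; fun_prop) fun x => Set.mem_Ici.2 (sq_nonneg _)

/-- A zero of a nonnegative function is a minimum, so `φ'` vanishes there too, and uniqueness for
the equation makes `φ` identically zero. -/
theorem pos (h : H1 g) (hφ : IsSolitaryWave g ω φ) (x : ℝ) : 0 < φ x := by
  refine lt_of_le_of_ne (hφ.nonneg x) fun hx => hφ.ne_zero ?_
  have hmin : IsLocalMin φ x := Eventually.of_forall fun y => by rw [← hx]; exact hφ.nonneg y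
  have hc := hφ.continuous
  have hgc := hφ.continuous_comp_sq h.continuousOn
  funext y
  refine eq_zero_of_norm_deriv_deriv_le (C := fun x => |ω - φ x ^ 2 + g (φ x ^ 2)|)
    ((continuous_const.sub (hc.pow 2)).add hgc).abs
    hφ.hasDerivAt hφ.hasDerivAt_deriv (fun z => le_of_eq ?_) hx.symm hmin.deriv_eq_zero y
  rw [Real.norm_eq_abs, Real.norm_eq_abs, ← abs_mul]
  congr 1
  ring

theorem deriv_zero (hφ : IsSolitaryWave g ω φ) : deriv φ 0 = 0 := by
  have h1 : HasDerivAt (fun x => φ (-x)) (-deriv φ 0) 0 := by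
    have h2 : HasDerivAt φ (deriv φ 0) (-0) := by rw [neg_zero]; exact hφ.hasDerivAt 0
    simpa [Function.comp_def] using h2.scomp (0 : ℝ) (hasDerivAt_neg (0 : ℝ))
  have h3 : (fun x => φ (-x)) = φ := funext hφ.even
  rw [h3] at h1
  have := h1.unique (hφ.hasDerivAt 0)
  linarith

theorem hasDerivAt_sq (hφ : IsSolitaryWave g ω φ) (x : ℝ) :
    HasDerivAt (fun x => φ x ^ 2) (2 * φ x * deriv φ x) x := by
  refine ((hφ.hasDerivAt x).pow 2).congr_deriv ?_
  norm_num

/-- Conservation of energy. -/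
theorem deriv_sq (h : H1 g) (hφ : IsSolitaryWave g ω φ) (x : ℝ) :
    deriv φ x ^ 2 = φ x ^ 2 * logDerivSq g ω (φ x ^ 2) := by
  set E : ℝ → ℝ := fun x => deriv φ x ^ 2 - (ω * φ x ^ 2 - (φ x ^ 2) ^ 2 / 2 + primitive g (φ x ^ 2))
    with hE
  have hd : ∀ x, HasDerivAt E 0 x := by
    intro x
    have hs : 0 < φ x ^ 2 := pow_pos (hφ.pos h x) 2
    have h1 := (hφ.hasDerivAt_deriv x).pow 2
    have h2 := hφ.hasDerivAt_sq x
    have h3 := (h.hasDerivAt_primitive hs).comp x h2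
    refine (h1.sub (((h2.const_mul ω).sub ((h2.pow 2).div_const 2)).add h3)).congr_deriv ?_
    simp only [Nat.cast_ofNat]
    ring
  have hconst : ∀ x, E x = E 0 := fun x =>
    is_const_of_deriv_eq_zero (fun x => (hd x).differentiableAt) (fun x => (hd x).deriv) x 0
  have hφ0 : Tendsto φ atTop (𝓝 0) := hφ.tendsto_zero.mono_left atTop_le_cocompact
  have hpot : Tendsto (fun x => ω * φ x ^ 2 - (φ x ^ 2) ^ 2 / 2 + primitive g (φ x ^ 2)) atTop
      (𝓝 0) := by
    have h1 : Tendsto (fun x => φ x ^ 2) atTop (𝓝 0) := by simpa using hφ0.pow 2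
    have h2 : Tendsto (fun x => primitive g (φ x ^ 2)) atTop (𝓝 0) := by
      have := (h.continuousOn_primitive 0 Set.self_mem_Ici).tendsto
      rw [primitive_zero] at this
      exact this.comp (tendsto_nhdsWithin_iff.2 ⟨h1, Eventually.of_forall fun x => Set.mem_Ici.2 (sq_nonneg _)⟩)
    simpa using ((h1.const_mul ω).sub ((h1.pow 2).div_const 2)).add h2
  have hsq : Tendsto (fun x => deriv φ x ^ 2) atTop (𝓝 (E 0)) := by
    have := hpot.const_add (E 0)
    rw [add_zero] at this
    refine this.congr fun x => ?_
    rw [← hconst x]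
    simp only [hE]
    ring
  -- The energy is the limit of `φ'²` at infinity. It is identified along mean value points `c n >
  -- n`, where `φ'` equals the increment `φ (n + 1) - φ n`, which tends to `0`.
  have hE0 : E 0 = 0 := by
    have hmv : ∀ n : ℕ, ∃ c : ℝ, (n : ℝ) < c ∧ deriv φ c = φ (n + 1) - φ n := by
      intro n
      obtain ⟨c, hc, hc'⟩ := exists_deriv_eq_slope φ (lt_add_one (n : ℝ))
        hφ.continuous.continuousOn
        (fun x _ => (hφ.hasDerivAt x).differentiableAt.differentiableWithinAt)
      exact ⟨c, hc.1, by rw [hc']; simp⟩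
    choose c hc1 hc2 using hmv
    have hct : Tendsto c atTop atTop :=
      tendsto_atTop_mono (fun n => (hc1 n).le) tendsto_natCast_atTop_atTop
    have h1 := hsq.comp hct
    have h2 : Tendsto (fun n : ℕ => (φ (n + 1) - φ n) ^ 2) atTop (𝓝 0) := by
      have h3 := hφ0.comp (tendsto_natCast_atTop_atTop (R := ℝ))
      have h4 := hφ0.comp ((tendsto_natCast_atTop_atTop (R := ℝ)).atTop_add
        (tendsto_const_nhds (x := (1 : ℝ))))
      simpa using (h4.sub h3).pow 2
    refine tendsto_nhds_unique h1 (h2.congr fun n => ?_)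
    simp only [Function.comp, hc2]
  have := hconst x
  rw [hE0] at this
  simp only [hE] at this
  have hp := hφ.pos h x
  unfold logDerivSq
  field_simp
  linarith

/-- As `φ²` tends to `0`, it takes every value `t` in `(0, φ(x)²]`, and at such a point the energy
identity writes `φ'²` as `t` times the quantity in question. -/
theorem logDerivSq_nonneg (h : H1 g) (hφ : IsSolitaryWave g ω φ) {x t : ℝ} (ht : 0 < t)
    (hx : t ≤ φ x ^ 2) : 0 ≤ logDerivSq g ω t := by
  have h1 : Tendsto (fun x => φ x ^ 2) atTop (𝓝 0) := by
    simpa using (hφ.tendsto_zero.mono_left atTop_le_cocompact).pow 2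
  obtain ⟨y, hxy, hy⟩ := ((eventually_ge_atTop x).and (h1.eventually (gt_mem_nhds ht))).exists
  have hc : Continuous fun x => φ x ^ 2 := hφ.continuous.pow 2
  obtain ⟨z, -, hz⟩ := intermediate_value_Icc' hxy hc.continuousOn ⟨hy.le, hx⟩
  simp only at hz
  have h2 := hφ.deriv_sq h z
  rw [hz] at h2
  by_contra hcon
  have := mul_neg_of_pos_of_neg ht (not_le.1 hcon)
  linarith [sq_nonneg (deriv φ z)]

/-- Just beyond its root `s₀`, the strictly decreasing `logDerivSq` is negative, so `φ²` cannot get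
there. Capping with `3 ω` stays within the range of monotonicity; no a priori smallness of `φ` is
assumed. -/
theorem sq_le (h : H1 g) (hsm : IsSmall g δ ω) (hφ : IsSolitaryWave g ω φ) {s₀ : ℝ}
    (hs₀ : 0 < s₀) (hs₀' : s₀ < 3 * ω) (hz : logDerivSq g ω s₀ = 0) (x : ℝ) : φ x ^ 2 ≤ s₀ := by
  by_contra hcon
  rw [not_le] at hcon
  have hlt : s₀ < min (φ x ^ 2) (3 * ω) := lt_min hcon hs₀'
  have h1 := hφ.logDerivSq_nonneg h (hs₀.trans hlt) (min_le_left _ _)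
  have h2 := h.strictAntiOn_logDerivSq hsm ⟨hs₀, (hs₀'.le.trans hsm.2.1)⟩
    ⟨hs₀.trans hlt, (min_le_right _ _).trans hsm.2.1⟩ hlt
  linarith

theorem sq_zero (h : H1 g) (hsm : IsSmall g δ ω) (hφ : IsSolitaryWave g ω φ) {s₀ : ℝ}
    (hs₀ : 0 < s₀) (hs₀' : s₀ < 3 * ω) (hz : logDerivSq g ω s₀ = 0) : φ 0 ^ 2 = s₀ := by
  have hs : 0 < φ 0 ^ 2 := pow_pos (hφ.pos h 0) 2
  have h1 := hφ.deriv_sq h 0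
  rw [hφ.deriv_zero, zero_pow two_ne_zero, eq_comm, mul_eq_zero, or_iff_right hs.ne'] at h1
  have h2 := hφ.sq_le h hsm hs₀ hs₀' hz 0
  exact (h.strictAntiOn_logDerivSq hsm).injOn ⟨hs, h2.trans (hs₀'.le.trans hsm.2.1)⟩
    ⟨hs₀, hs₀'.le.trans hsm.2.1⟩ (h1.trans hz.symm)

theorem hasDerivAt_inv (h : H1 g) (hφ : IsSolitaryWave g ω φ) (x : ℝ) :
    HasDerivAt (fun x => (φ x)⁻¹) (-deriv φ x / φ x ^ 2) x :=
  (hφ.hasDerivAt x).inv (hφ.pos h x).ne'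

theorem hasDerivAt_deriv_inv (h : H1 g) (hsm : IsSmall g δ ω) (hφ : IsSolitaryWave g ω φ) {s₀ : ℝ}
    (hs₀ : 0 < s₀) (hs₀' : s₀ < 3 * ω) (hz : logDerivSq g ω s₀ = 0) (x : ℝ) :
    HasDerivAt (fun x => -deriv φ x / φ x ^ 2) (inverseField g ω (√s₀)⁻¹ (φ x)⁻¹) x := by
  have hp := hφ.pos h x
  have hle : (√s₀)⁻¹ ≤ (φ x)⁻¹ := by
    have := Real.le_sqrt_of_sq_le (hφ.sq_le h hsm hs₀ hs₀' hz x)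
    gcongr
  have hE := hφ.deriv_sq h x
  refine ((hφ.hasDerivAt_deriv x).neg.div (hφ.hasDerivAt_sq x) (pow_pos hp 2).ne').congr_deriv ?_
  rw [inverseField, max_eq_left hle, inv_pow, inv_inv]
  unfold pertTwo
  unfold logDerivSq at hE
  simp only [Pi.neg_apply]
  field_simp at hE ⊢
  linear_combination hE

end IsSolitaryWave

theorem IsSmall.exists_root (h : H1 g) (hsm : IsSmall g δ ω) :
    ∃ s₀, 0 < s₀ ∧ s₀ < 3 * ω ∧ logDerivSq g ω s₀ = 0 := by
  obtain ⟨s₀, h0, h1, h2⟩ := h.exists_logDerivSq_eq_zero hsm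
  refine ⟨s₀, h0, lt_of_le_of_ne h1 ?_, h2⟩
  rintro rfl
  have hω := hsm.1
  have h3 := (hsm.abs_div_le (s := 3 * ω) (by linarith) hsm.2.1).2.2
  unfold logDerivSq at h2
  linarith [(abs_le.1 h3).2]

theorem inv_sqrt_sq_inv {s₀ : ℝ} (hs₀ : 0 < s₀) : ((√s₀)⁻¹ ^ 2)⁻¹ = s₀ := by
  rw [inv_pow, inv_inv, Real.sq_sqrt hs₀.le]

/-- The inverses of both profiles solve the same Lipschitz equation with the same data at `0`:
evenness gives zero slope, and the energy fixes the height. -/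
theorem IsSolitaryWave.eq (h : H1 g) (hsm : IsSmall g δ ω) {φ ψ : ℝ → ℝ}
    (hφ : IsSolitaryWave g ω φ) (hψ : IsSolitaryWave g ω ψ) : φ = ψ := by
  obtain ⟨s₀, h0, h1, h2⟩ := hsm.exists_root h
  have hk₀ : 0 < (√s₀)⁻¹ := by positivity
  have hk₀' : ((√s₀)⁻¹ ^ 2)⁻¹ ≤ 3 * ω := by rw [inv_sqrt_sq_inv h0]; exact h1.le
  have heq : φ 0 = ψ 0 := by
    have := (hφ.sq_zero h hsm h0 h1 h2).trans (hψ.sq_zero h hsm h0 h1 h2).symm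
    exact (sq_eq_sq₀ (hφ.nonneg 0) (hψ.nonneg 0)).1 this
  funext x
  have := eq_zero_of_norm_deriv_deriv_le (C := fun _ => 2 * ω) (a := 0) continuous_const
    (fun x => (hφ.hasDerivAt_inv h x).sub (hψ.hasDerivAt_inv h x))
    (fun x => (hφ.hasDerivAt_deriv_inv h hsm h0 h1 h2 x).sub
      (hψ.hasDerivAt_deriv_inv h hsm h0 h1 h2 x))
    (fun x => h.lipschitzWith_inverseField hsm hk₀ hk₀' _ _) (by simp [heq])
    (by simp [hφ.deriv_zero, hψ.deriv_zero]) x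
  simp only [Pi.sub_apply, sub_eq_zero] at this
  exact inv_injective this

theorem IsSolitaryWave.sq_le_decay (h : H1 g) (hsm : IsSmall g δ ω) {φ : ℝ → ℝ}
    (hφ : IsSolitaryWave g ω φ) (x : ℝ) : φ x ^ 2 ≤ 3 * ω / (1 + ω * x ^ 2 / 4) ^ 2 := by
  obtain ⟨s₀, h0, h1, h2⟩ := hsm.exists_root h
  have hω := hsm.1
  have hk₀ : 0 < (√s₀)⁻¹ := by positivity
  have hk₀' : ((√s₀)⁻¹ ^ 2)⁻¹ ≤ 3 * ω := by rw [inv_sqrt_sq_inv h0]; exact h1.le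
  have h3 := h.lower_bound_of_inverseField hsm hk₀ hk₀' (hφ.hasDerivAt_inv h)
    (hφ.hasDerivAt_deriv_inv h hsm h0 h1 h2) (by
      rw [← hφ.sq_zero h hsm h0 h1 h2, Real.sqrt_sq (hφ.nonneg 0)]) (by simp [hφ.deriv_zero]) x
  have h4 : 0 < 1 + ω * x ^ 2 / 4 := by positivity
  have hp := hφ.pos h x
  have h5 : ((√s₀)⁻¹ * (1 + ω * x ^ 2 / 4)) ^ 2 ≤ ((φ x)⁻¹) ^ 2 := by gcongr
  rw [mul_pow, inv_pow, inv_pow, Real.sq_sqrt h0.le] at h5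
  have h6 : (1 + ω * x ^ 2 / 4) ^ 2 * φ x ^ 2 ≤ s₀ := by
    have h7 : 0 < φ x ^ 2 := by positivity
    field_simp at h5
    linarith
  rw [le_div_iff₀ (by positivity)]
  linarith

end Wave

/-! ### The dominating weight and its moments. -/

/-- The weight `3ω (1 + ωx²/4)⁻²` that dominates the square of the solitary wave. -/
def decayWeight (ω x : ℝ) : ℝ := 3 * ω / (1 + ω * x ^ 2 / 4) ^ 2

section Weight

variable {ω : ℝ}

theorem one_le_one_add_mul_sq (hω : 0 < ω) (x : ℝ) : 1 ≤ 1 + ω * x ^ 2 / 4 := by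
  have : 0 ≤ ω * x ^ 2 := by positivity
  linarith

theorem decayWeight_nonneg (hω : 0 < ω) (x : ℝ) : 0 ≤ decayWeight ω x := by
  unfold decayWeight; positivity

theorem continuous_decayWeight (hω : 0 < ω) : Continuous (decayWeight ω) := by
  unfold decayWeight
  exact continuous_const.div (by fun_prop) fun x =>
    (pow_pos (zero_lt_one.trans_le (one_le_one_add_mul_sq hω x)) 2).ne'

theorem decayWeight_le (hω : 0 < ω) (x : ℝ) : decayWeight ω x ≤ 3 * ω := by
  unfold decayWeight
  have h := one_le_one_add_mul_sq hω x
  rw [div_le_iff₀ (by positivity)]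
  have : 1 ≤ (1 + ω * x ^ 2 / 4) ^ 2 := one_le_pow₀ h
  nlinarith

theorem decayWeight_mul_sq_le (hω : 0 < ω) (x : ℝ) : decayWeight ω x * x ^ 2 ≤ 3 := by
  unfold decayWeight
  have h := one_le_one_add_mul_sq hω x
  rw [div_mul_eq_mul_div, div_le_iff₀ (by positivity)]
  nlinarith [sq_nonneg (1 - ω * x ^ 2 / 4)]

theorem integrable_inv_one_add_mul_sq (hω : 0 < ω) :
    Integrable fun x : ℝ => 3 * ω * (1 + (√ω / 2 * x) ^ 2)⁻¹ :=
  (integrable_inv_one_add_sq.comp_mul_left' (by positivity)).const_mul _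

theorem integral_inv_one_add_mul_sq_le (hω : 0 < ω) :
    ∫ x : ℝ, 3 * ω * (1 + (√ω / 2 * x) ^ 2)⁻¹ ≤ 24 * √ω := by
  have hs : 0 < √ω := Real.sqrt_pos.2 hω
  rw [integral_const_mul, Measure.integral_comp_mul_left (fun y => (1 + y ^ 2)⁻¹) (√ω / 2),
    integral_univ_inv_one_add_sq, smul_eq_mul, abs_of_pos (by positivity)]
  have hω' : 3 * ω = 3 * √ω * √ω := by rw [mul_assoc, Real.mul_self_sqrt hω.le]
  rw [hω']
  field_simp
  -- The exact value is `6 π √ω`.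
  nlinarith [Real.pi_le_four]

theorem decayWeight_le_inv (hω : 0 < ω) (x : ℝ) :
    decayWeight ω x ≤ 3 * ω * (1 + (√ω / 2 * x) ^ 2)⁻¹ := by
  have h := one_le_one_add_mul_sq hω x
  have he : 1 + (√ω / 2 * x) ^ 2 = 1 + ω * x ^ 2 / 4 := by
    rw [mul_pow, div_pow, Real.sq_sqrt hω.le]; ring
  rw [he, ← div_eq_mul_inv, decayWeight]
  gcongr
  exact le_self_pow₀ h two_ne_zero

theorem integrable_decayWeight (hω : 0 < ω) : Integrable (decayWeight ω) :=
  (integrable_inv_one_add_mul_sq hω).mono' (continuous_decayWeight hω).aestronglyMeasurable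
    (ae_of_all _ fun x => by
      rw [Real.norm_of_nonneg (decayWeight_nonneg hω x)]
      exact decayWeight_le_inv hω x)

theorem integral_decayWeight_le (hω : 0 < ω) : ∫ x, decayWeight ω x ≤ 24 * √ω :=
  (integral_mono (integrable_decayWeight hω) (integrable_inv_one_add_mul_sq hω)
    (decayWeight_le_inv hω)).trans (integral_inv_one_add_mul_sq_le hω)

theorem integrableOn_mul_decayWeight_and_integral (hω : 0 < ω) :
    IntegrableOn (fun x => x * decayWeight ω x) (Set.Ioi 0) ∧
      ∫ x in Set.Ioi (0 : ℝ), x * decayWeight ω x = 6 := by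
  have hd : ∀ x ∈ Set.Ici (0 : ℝ),
      HasDerivAt (fun x => -6 * (1 + ω * x ^ 2 / 4)⁻¹) (x * decayWeight ω x) x := by
    intro x _
    have h := zero_lt_one.trans_le (one_le_one_add_mul_sq hω x)
    have h1 : HasDerivAt (fun x => 1 + ω * x ^ 2 / 4) (ω * x / 2) x :=
      ((((hasDerivAt_pow 2 x).const_mul ω).div_const 4).const_add 1).congr_deriv (by simp; ring)
    refine ((h1.inv h.ne').const_mul (-6)).congr_deriv ?_
    unfold decayWeight
    field_simp
    ring
  have ht : Tendsto (fun x => -6 * (1 + ω * x ^ 2 / 4)⁻¹) atTop (𝓝 0) := by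
    have h1 : Tendsto (fun x : ℝ => 1 + ω * x ^ 2 / 4) atTop atTop :=
      tendsto_atTop_add_const_left _ _
        (((tendsto_pow_atTop two_ne_zero).const_mul_atTop hω).atTop_div_const (by norm_num))
    simpa using (tendsto_inv_atTop_zero.comp h1).const_mul (-6)
  have hpos : ∀ x ∈ Set.Ioi (0 : ℝ), 0 ≤ x * decayWeight ω x := fun x hx =>
    mul_nonneg (le_of_lt hx) (decayWeight_nonneg hω x)
  refine ⟨integrableOn_Ioi_deriv_of_nonneg' hd hpos ht, ?_⟩
  rw [integral_Ioi_of_hasDerivAt_of_nonneg' hd hpos ht]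
  norm_num

theorem decayWeight_neg (x : ℝ) : decayWeight ω (-x) = decayWeight ω x := by
  simp [decayWeight]

theorem integral_abs_mul_decayWeight (hω : 0 < ω) : ∫ x, |x| * decayWeight ω x = 12 := by
  have h := integral_comp_abs (f := fun x => x * decayWeight ω x)
  rw [(integrableOn_mul_decayWeight_and_integral hω).2] at h
  have h2 : ∫ x, |x| * decayWeight ω x = ∫ x, |x| * decayWeight ω |x| := by
    congr 1
    ext x
    rcases abs_choice x with hx | hx <;> rw [hx]
    rw [decayWeight_neg]
  rw [h2, h]
  norm_num

theorem integrable_abs_mul_decayWeight (hω : 0 < ω) :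
    Integrable fun x => |x| * decayWeight ω x := by
  -- A non-integrable function has Bochner integral `0` by convention, whereas this integral has
  -- been computed to be `12`.
  by_contra hcon
  have h := integral_abs_mul_decayWeight hω
  rw [integral_undef hcon] at h
  norm_num at h

end Weight

/-! ### Existence of the solitary wave. -/

section Existence

variable {g : ℝ → ℝ} {δ ω : ℝ}

/-- The energy of the inverse equation is conserved, and it starts at zero because `s₀` is a root of
`logDerivSq`. Only on this zero level is the equation for `k` equivalent to the profile equation for
`1/k`. -/
theorem H1.deriv_sq_of_inverseField (h : H1 g) {s₀ : ℝ} (hs₀ : 0 < s₀)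
    (hz : logDerivSq g ω s₀ = 0) {k k' : ℝ → ℝ} (hk : ∀ x, HasDerivAt k (k' x) x)
    (hk' : ∀ x, HasDerivAt k' (inverseField g ω (√s₀)⁻¹ (k x)) x) (h0 : k 0 = (√s₀)⁻¹)
    (h0' : k' 0 = 0) (hge : ∀ x, (√s₀)⁻¹ ≤ k x) (x : ℝ) :
    k' x ^ 2 = k x ^ 2 * logDerivSq g ω ((k x ^ 2)⁻¹) := by
  have hk₀ : 0 < (√s₀)⁻¹ := by positivity
  set E : ℝ → ℝ := fun x => k' x ^ 2 - k x ^ 2 * logDerivSq g ω ((k x ^ 2)⁻¹) with hE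
  have hd : ∀ x, HasDerivAt E 0 x := by
    intro x
    have hkx : 0 < k x := hk₀.trans_le (hge x)
    have hs : 0 < (k x ^ 2)⁻¹ := by positivity
    have h1 := (h.hasDerivAt_logDerivSq ω hs).comp x ((hasDerivAt_inv_sq hkx).comp x (hk x))
    refine (((hk' x).pow 2).sub (((hk x).pow 2).mul h1)).congr_deriv ?_
    rw [inverseField, max_eq_left (hge x)]
    simp only [Function.comp, logDerivSq, pertTwo, Nat.cast_ofNat, Pi.pow_apply]
    set G := primitive g (k x ^ 2)⁻¹
    set γ := g (k x ^ 2)⁻¹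
    field_simp
    ring
  have hconst : E x = E 0 :=
    is_const_of_deriv_eq_zero (fun x => (hd x).differentiableAt) (fun x => (hd x).deriv) x 0
  have hE0 : E 0 = 0 := by
    simp only [hE, h0, h0', inv_sqrt_sq_inv hs₀, hz]
    ring
  rw [hE0] at hconst
  exact sub_eq_zero.1 hconst

theorem contDiff_two_of_hasDerivAt {E : Type*} [NormedAddCommGroup E] [NormedSpace ℝ E]
    {u u' u'' : ℝ → E} (h1 : ∀ x, HasDerivAt u (u' x) x) (h2 : ∀ x, HasDerivAt u' (u'' x) x)
    (hc : Continuous u'') : ContDiff ℝ 2 u := by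
  have hd1 : deriv u = u' := funext fun x => (h1 x).deriv
  have hd2 : deriv u' = u'' := funext fun x => (h2 x).deriv
  refine (contDiff_succ_iff_deriv (n := 1)).2
    ⟨fun x => (h1 x).differentiableAt, by simp, ?_⟩
  rw [hd1, contDiff_one_iff_deriv, hd2]
  exact ⟨fun x => (h2 x).differentiableAt, hc⟩

theorem memLp_two_of_sq_le_decayWeight (hω : 0 < ω) {u : ℝ → ℝ} (hu : Continuous u) {C : ℝ}
    (hle : ∀ x, u x ^ 2 ≤ C * decayWeight ω x) : MemLp u 2 := by
  rw [memLp_two_iff_integrable_sq hu.aestronglyMeasurable]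
  exact ((integrable_decayWeight hω).const_mul C).mono' (hu.pow 2).aestronglyMeasurable
    (ae_of_all _ fun x => by rw [Real.norm_of_nonneg (sq_nonneg _)]; exact hle x)

theorem tendsto_decayWeight (hω : 0 < ω) : Tendsto (decayWeight ω) (cocompact ℝ) (𝓝 0) := by
  have h1 : Tendsto (fun x : ℝ => 1 + ω * ‖x‖ ^ 2 / 4) (cocompact ℝ) atTop :=
    tendsto_atTop_add_const_left _ _ ((((tendsto_pow_atTop two_ne_zero).comp
      (tendsto_norm_cocompact_atTop (E := ℝ))).const_mul_atTop hω).atTop_div_const (by norm_num))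
  have h2 := ((tendsto_pow_atTop two_ne_zero).comp h1).const_div_atTop (3 * ω)
  refine h2.congr fun x => ?_
  simp [decayWeight]

theorem logDerivSq_le (hsm : IsSmall g δ ω) {s : ℝ} (hs : 0 < s) (hs' : s ≤ 3 * ω) :
    logDerivSq g ω s ≤ 2 * ω := by
  have h1 := (hsm.abs_div_le hs (hs'.trans hsm.2.1)).2.2
  unfold logDerivSq
  linarith [(abs_le.1 h1).2, hsm.1]

theorem H1.exists_isSolitaryWave (h : H1 g) (hsm : IsSmall g δ ω) :
    ∃ φ, IsSolitaryWave g ω φ := by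
  obtain ⟨s₀, hs₀, hs₀', hz⟩ := hsm.exists_root h
  have hω := hsm.1
  have hk₀ : 0 < (√s₀)⁻¹ := by positivity
  have hk₀' : ((√s₀)⁻¹ ^ 2)⁻¹ ≤ 3 * ω := by rw [inv_sqrt_sq_inv hs₀]; exact hs₀'.le
  have hLip : LipschitzWith (2 * ω).toNNReal (inverseField g ω (√s₀)⁻¹) :=
    LipschitzWith.of_dist_le_mul fun a b => by
      rw [Real.dist_eq, Real.dist_eq, Real.coe_toNNReal _ (by positivity)]
      exact h.lipschitzWith_inverseField hsm hk₀ hk₀' a b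
  obtain ⟨γ, hγ0, hγ⟩ := exists_forall_hasDerivAt_of_lipschitzWith
    (f := fun v : ℝ × ℝ => (v.2, inverseField g ω (√s₀)⁻¹ v.1))
    (LipschitzWith.prod_snd.prodMk (hLip.comp LipschitzWith.prod_fst)) ((√s₀)⁻¹, 0)
  set k : ℝ → ℝ := fun x => (γ x).1 with hkdef
  set k' : ℝ → ℝ := fun x => (γ x).2 with hkdef'
  have hk : ∀ x, HasDerivAt k (k' x) x := fun x => (hγ x).fst
  have hk' : ∀ x, HasDerivAt k' (inverseField g ω (√s₀)⁻¹ (k x)) x := fun x => (hγ x).snd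
  have h0 : k 0 = (√s₀)⁻¹ := by simp [hkdef, hγ0]
  have h0' : k' 0 = 0 := by simp [hkdef', hγ0]
  have hlow := h.lower_bound_of_inverseField hsm hk₀ hk₀' hk hk' h0 h0'
  have hge : ∀ x, (√s₀)⁻¹ ≤ k x := fun x =>
    (le_mul_of_one_le_right hk₀.le (one_le_one_add_mul_sq hω x)).trans (hlow x)
  have hkpos : ∀ x, 0 < k x := fun x => hk₀.trans_le (hge x)
  have hen := h.deriv_sq_of_inverseField hs₀ hz hk hk' h0 h0' hge
  have heven : ∀ x, k (-x) = k x := by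
    intro x
    have := eq_zero_of_norm_deriv_deriv_le (u := fun x => k (-x) - k x)
      (u' := fun x => -k' (-x) - k' x)
      (u'' := fun x => inverseField g ω (√s₀)⁻¹ (k (-x)) - inverseField g ω (√s₀)⁻¹ (k x))
      (C := fun _ => 2 * ω) (a := 0) continuous_const
      (fun x => (by simpa [Function.comp_def] using (hk (-x)).scomp x (hasDerivAt_neg x) :
        HasDerivAt (fun x => k (-x)) (-k' (-x)) x).fun_sub (hk x))
      (fun x => (by simpa [Function.comp_def] using
          ((hk' (-x)).scomp x (hasDerivAt_neg x)).fun_neg :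
        HasDerivAt (fun x => -k' (-x)) (inverseField g ω (√s₀)⁻¹ (k (-x))) x).fun_sub (hk' x))
      (fun x => h.lipschitzWith_inverseField hsm hk₀ hk₀' _ _) (by simp) (by simp [h0']) x
    exact sub_eq_zero.1 this
  set φ : ℝ → ℝ := fun x => (k x)⁻¹ with hφ
  set φ' : ℝ → ℝ := fun x => -k' x / k x ^ 2 with hφ'
  have hφpos : ∀ x, 0 < φ x := fun x => inv_pos.2 (hkpos x)
  have hd1 : ∀ x, HasDerivAt φ (φ' x) x := fun x => (hk x).inv (hkpos x).ne'
  have hd2 : ∀ x, HasDerivAt φ' (ω * φ x - φ x ^ 3 + φ x * g (φ x ^ 2)) x := by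
    intro x
    have hkx := hkpos x
    refine ((hk' x).neg.div ((hk x).pow 2) (pow_pos hkx 2).ne').congr_deriv ?_
    have hE := hen x
    rw [inverseField, max_eq_left (hge x)]
    simp only [hφ, inv_pow]
    simp only [Pi.neg_apply, pertTwo, logDerivSq, Nat.cast_ofNat, Pi.pow_apply] at hE ⊢
    set G := primitive g (k x ^ 2)⁻¹
    set γ := g (k x ^ 2)⁻¹
    field_simp at hE ⊢
    linear_combination k x * hE
  have hsq : ∀ x, φ x ^ 2 ≤ decayWeight ω x := by
    intro x
    have h4 := zero_lt_one.trans_le (one_le_one_add_mul_sq hω x)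
    have h5 : ((√s₀)⁻¹ * (1 + ω * x ^ 2 / 4)) ^ 2 ≤ k x ^ 2 := by gcongr; exact hlow x
    rw [mul_pow, inv_pow, Real.sq_sqrt hs₀.le] at h5
    have h6 : (s₀⁻¹ * (1 + ω * x ^ 2 / 4) ^ 2)⁻¹ = s₀ / (1 + ω * x ^ 2 / 4) ^ 2 := by
      field_simp
    calc φ x ^ 2 = (k x ^ 2)⁻¹ := by simp [hφ]
      _ ≤ (s₀⁻¹ * (1 + ω * x ^ 2 / 4) ^ 2)⁻¹ := by gcongr
      _ = s₀ / (1 + ω * x ^ 2 / 4) ^ 2 := h6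
      _ ≤ decayWeight ω x := by unfold decayWeight; gcongr
  have hφc : Continuous φ := continuous_iff_continuousAt.2 fun x => (hd1 x).continuousAt
  have hφc' : Continuous φ' := continuous_iff_continuousAt.2 fun x => (hd2 x).continuousAt
  have hφ'sq : ∀ x, φ' x ^ 2 ≤ 2 * ω * decayWeight ω x := by
    intro x
    have hkx := hkpos x
    have h1 : φ' x ^ 2 = φ x ^ 2 * logDerivSq g ω (φ x ^ 2) := by
      simp only [hφ, hφ', inv_pow]
      rw [div_pow, neg_sq, hen x]
      field_simp
    rw [h1, mul_comm]
    have h2 := logDerivSq_le hsm (pow_pos (hφpos x) 2)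
      ((hsq x).trans (decayWeight_le hω x))
    exact mul_le_mul h2 (hsq x) (sq_nonneg _) (by positivity)
  have hgc : Continuous fun x => g (φ x ^ 2) :=
    h.continuousOn.comp_continuous (by fun_prop) fun x => Set.mem_Ici.2 (sq_nonneg _)
  refine ⟨φ, ⟨memH1_of_hasDerivAt hd1
    (memLp_two_of_sq_le_decayWeight hω hφc (C := 1) (by simpa using hsq))
    (memLp_two_of_sq_le_decayWeight hω hφc' hφ'sq), contDiff_two_of_hasDerivAt hd1 hd2
    (((continuous_const.mul hφc).sub (hφc.pow 3)).add (hφc.mul hgc)), fun x => ?_, fun x => ?_, fun x => (hφpos x).le, fun hcon => ?_, ?_⟩⟩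
  · rw [show deriv φ = φ' from funext fun x => (hd1 x).deriv, (hd2 x).deriv]
  · simp only [hφ, heven]
  · exact (hφpos 0).ne' (congrFun hcon 0)
  · have h1 : Tendsto (fun x => φ x ^ 2) (cocompact ℝ) (𝓝 0) :=
      squeeze_zero (fun x => sq_nonneg _) hsq (tendsto_decayWeight hω)
    have h2 := (Real.continuous_sqrt.tendsto 0).comp h1
    rw [Real.sqrt_zero] at h2
    refine h2.congr fun x => ?_
    simp [Real.sqrt_sq (hφpos x).le]

theorem H1.existsUnique_isSolitaryWave (h : H1 g) (hsm : IsSmall g δ ω) :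
    ∃! φ, IsSolitaryWave g ω φ := by
  obtain ⟨φ, hφ⟩ := h.exists_isSolitaryWave hsm
  exact ⟨φ, hφ, fun ψ hψ => hψ.eq h hsm hφ⟩

theorem H1.isSolitaryWave_solitaryWave (h : H1 g) (hsm : IsSmall g δ ω) :
    IsSolitaryWave g ω (solitaryWave g ω) :=
  Classical.epsilon_spec (h.exists_isSolitaryWave hsm)

end Existence

/-! ### Boundary terms, and the virial argument. -/

theorem tendsto_atTop_zero_of_le_mul_integrable {J J' w : ℝ → ℝ}
    (hJ : ∀ x, HasDerivAt J (J' x) x) (hJ' : Integrable J') (hw : Integrable w)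
    (hle : ∀ x, |J x| ≤ (1 + |x|) * w x) : Tendsto J atTop (𝓝 0) := by
  have h1 := tendsto_limUnder_of_hasDerivAt_of_integrableOn_Ioi (a := 0) (fun x _ => hJ x)
    hJ'.integrableOn
  set m := limUnder atTop J
  by_cases hm : m = 0
  · rwa [hm] at h1
  exfalso
  have hm' : 0 < |m| := abs_pos.2 hm
  have h2 : ∀ᶠ x in atTop, |m| / 2 < |J x| :=
    h1.abs.eventually (lt_mem_nhds (half_lt_self hm'))
  obtain ⟨R, hR⟩ := eventually_atTop.1 h2
  -- For `x > S`, `|m| / 2 < |J x| ≤ 2 x w x`: a nonzero limit `m` would make `1/x` integrable at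
  -- infinity, being at most `(4 / |m|) w`.
  set S := max R 1
  refine not_integrableOn_Ioi_inv (a := S) ?_
  refine (hw.integrableOn.const_mul (4 / |m|)).mono' measurable_inv.aestronglyMeasurable ?_
  refine (ae_restrict_iff' measurableSet_Ioi).2 (ae_of_all _ fun x hx => ?_)
  have hx : S < x := hx
  have hx1 : 1 < x := (le_max_right R 1).trans_lt hx
  have h3 := hR x ((le_max_left R 1).trans hx.le)
  have h4 := hle x
  rw [abs_of_pos (by linarith : 0 < x)] at h4
  rw [Real.norm_of_nonneg (by positivity)]
  have hw0 : 0 ≤ w x := by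
    by_contra hcon
    nlinarith [abs_nonneg (J x)]
  have h5 : |m| ≤ 4 * w x * x := by nlinarith
  rw [div_mul_eq_mul_div, le_div_iff₀ hm', inv_mul_le_iff₀ (by linarith)]
  linarith

theorem integral_eq_zero_of_le_mul_integrable {J J' w : ℝ → ℝ}
    (hJ : ∀ x, HasDerivAt J (J' x) x) (hJ' : Integrable J') (hw : Integrable w)
    (hle : ∀ x, |J x| ≤ (1 + |x|) * w x) : ∫ x, J' x = 0 := by
  have h1 := tendsto_atTop_zero_of_le_mul_integrable hJ hJ' hw hle
  have h2 := tendsto_atTop_zero_of_le_mul_integrable (J := fun x => J (-x))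
    (J' := fun x => -J' (-x)) (w := fun x => w (-x))
    (fun x => by simpa [Function.comp_def] using (hJ (-x)).scomp x (hasDerivAt_neg x))
    hJ'.comp_neg.neg hw.comp_neg (fun x => by simpa using hle (-x))
  have h3 : Tendsto J atBot (𝓝 0) := by
    have := h2.comp tendsto_neg_atBot_atTop
    simpa [Function.comp_def] using this
  rw [integral_of_hasDerivAt_of_tendsto hJ hJ' h3 h1, sub_zero]

/-- The one-dimensional embedding `|A(x) - A(0)|² ≤ |x| ∫ A'²`. -/
theorem sub_sq_le_abs_mul_integral_sq {A A' : ℝ → ℝ} (hA : ∀ x, HasDerivAt A (A' x) x)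
    (hc : Continuous A') (hi : Integrable fun x => A' x ^ 2) (x : ℝ) :
    (A x - A 0) ^ 2 ≤ |x| * ∫ y, A' y ^ 2 := by
  have main : ∀ a b : ℝ, a < b → (A b - A a) ^ 2 ≤ (b - a) * ∫ y, A' y ^ 2 := by
    intro a b hab
    have hba : 0 < b - a := sub_pos.2 hab
    have h1 : ∫ y in a..b, A' y = A b - A a :=
      intervalIntegral.integral_eq_sub_of_hasDerivAt (fun y _ => hA y) (hc.intervalIntegrable _ _)
    have h2 : ∫ y in a..b, A' y ^ 2 ≤ ∫ y, A' y ^ 2 := by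
      rw [intervalIntegral.integral_of_le hab.le]
      exact setIntegral_le_integral hi (ae_of_all _ fun y => sq_nonneg _)
    -- With `t` the mean of `A'`, expanding `∫ (A' - t)² ≥ 0` is the Cauchy–Schwarz inequality.
    set t := (A b - A a) / (b - a) with ht
    have h3 : 0 ≤ ∫ y in a..b, (A' y - t) ^ 2 :=
      intervalIntegral.integral_nonneg hab.le fun y _ => sq_nonneg _
    have h4 : ∫ y in a..b, (A' y - t) ^ 2
        = (∫ y in a..b, A' y ^ 2) - 2 * t * (A b - A a) + t ^ 2 * (b - a) := by
      have : ∀ y, (A' y - t) ^ 2 = A' y ^ 2 - 2 * t * A' y + t ^ 2 := fun y => by ring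
      simp only [this]
      rw [intervalIntegral.integral_add, intervalIntegral.integral_sub,
        intervalIntegral.integral_const_mul, h1, intervalIntegral.integral_const, smul_eq_mul]
      · ring
      all_goals exact Continuous.intervalIntegrable (by fun_prop) _ _
    have h5 : t * (b - a) = A b - A a := div_mul_cancel₀ _ hba.ne'
    have h6 : t * (A b - A a) ≤ ∫ y, A' y ^ 2 := by
      rw [h4] at h3
      have : t ^ 2 * (b - a) = t * (A b - A a) := by rw [sq, mul_assoc, h5]
      linarith
    calc (A b - A a) ^ 2 = (b - a) * (t * (A b - A a)) := by
          rw [sq, ← h5]; ring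
      _ ≤ _ := by gcongr
  rcases lt_trichotomy x 0 with hx | rfl | hx
  · have := main x 0 hx
    rw [abs_of_neg hx]
    nlinarith
  · simp
  · have := main 0 x hx
    rw [abs_of_pos hx]
    simpa using this

/-- A bounded continuous multiple of an integrable function is integrable. -/
theorem integrable_mul_of_abs_le {u q : ℝ → ℝ} (hu : Integrable u) (hq : Continuous q) {C : ℝ}
    (hC : ∀ x, |q x| ≤ C) : Integrable fun x => q x * u x :=
  hu.bdd_mul hq.aestronglyMeasurable (ae_of_all _ hC)

/-- The virial identity for `A'' = (ω - l) A + f A + d B`. -/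
theorem virial_identity {ω l : ℝ} {f d A A' B : ℝ → ℝ} (hA : ∀ x, HasDerivAt A (A' x) x)
    (hA' : ∀ x, HasDerivAt A' ((ω - l) * A x + f x * A x + d x * B x) x)
    (hA2 : MemLp A 2) (hA2' : MemLp A' 2)
    (iQ : Integrable fun x => f x * A x ^ 2 + 2 * x * f x * (A x * A' x)
      + 2 * x * d x * (B x * A' x) + d x * (A x * B x)) :
    2 * (∫ x, A' x ^ 2) + ∫ x, (f x * A x ^ 2 + 2 * x * f x * (A x * A' x)
      + 2 * x * d x * (B x * A' x) + d x * (A x * B x)) = 0 := by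
  have iA : Integrable fun x => A x ^ 2 := hA2.integrable_sq
  have iA' : Integrable fun x => A' x ^ 2 := hA2'.integrable_sq
  -- This is the equation multiplied by `2 x A' + A`. The terms in `ω - l` form an exact derivative
  -- and drop out, so the sign of `ω - l` plays no role. The boundary terms grow at most like `|x|`
  -- times an integrable function.
  have hder : ∀ x, HasDerivAt (fun x => x * A' x ^ 2 - (ω - l) * (x * A x ^ 2) + A x * A' x)
      (2 * A' x ^ 2 + (f x * A x ^ 2 + 2 * x * f x * (A x * A' x)
        + 2 * x * d x * (B x * A' x) + d x * (A x * B x))) x := by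
    intro x
    refine ((((hasDerivAt_id x).mul ((hA' x).pow 2)).sub
      (((hasDerivAt_id x).mul ((hA x).pow 2)).const_mul (ω - l))).add
      ((hA x).mul (hA' x))).congr_deriv ?_
    simp only [id, Pi.pow_apply, Nat.cast_ofNat]
    ring
  have h0 := integral_eq_zero_of_le_mul_integrable hder ((iA'.const_mul 2).add iQ)
    (w := fun x => 2 * A' x ^ 2 + (|ω - l| + 1) * A x ^ 2)
    ((iA'.const_mul _).add (iA.const_mul _)) (fun x => by
      have h1 : |A x * A' x| ≤ A x ^ 2 + A' x ^ 2 := by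
        rw [abs_le]
        constructor <;> nlinarith [sq_nonneg (A x + A' x), sq_nonneg (A x - A' x)]
      have h2 : |x * A' x ^ 2| = |x| * A' x ^ 2 := by
        rw [abs_mul, abs_of_nonneg (sq_nonneg (A' x))]
      have h3 : |(ω - l) * (x * A x ^ 2)| = |ω - l| * (|x| * A x ^ 2) := by
        rw [abs_mul, abs_mul, abs_of_nonneg (sq_nonneg (A x))]
      have h4 := abs_add_le (x * A' x ^ 2 - (ω - l) * (x * A x ^ 2)) (A x * A' x)
      have h5 := abs_sub (x * A' x ^ 2) ((ω - l) * (x * A x ^ 2))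
      have h6 : 0 ≤ |x| * A' x ^ 2 := by positivity
      have h7 : 0 ≤ |x| * A x ^ 2 := by positivity
      have h8 : 0 ≤ |ω - l| * A x ^ 2 := by positivity
      have h9 := sq_nonneg (A' x)
      linarith)
  rw [integral_add (iA'.const_mul 2) iQ, integral_const_mul] at h0
  exact h0

/-- Pointwise lower bound for the integrand of the virial identity. -/
theorem virial_density_ge {ω e s x f d a a' b a₀ α : ℝ} (hω : 0 < ω) (he : 0 ≤ e)
    (he' : e ≤ 1 / 100) (hs0 : 0 ≤ s) (hs1 : s ≤ 3 * ω) (hs2 : s * x ^ 2 ≤ 3) (hf : |f| ≤ e * s)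
    (hd : |d| ≤ e * s) (hr : (a - a₀) ^ 2 ≤ |x| * α) :
    a₀ ^ 2 * f - (e + 1 / 48) * α * (|x| * s) - 48 * e ^ 2 * a₀ ^ 2 * s - 1 / 2 * a' ^ 2
      - 25 / 2 * e ^ 2 * (s * a ^ 2) - 2 * ω * b ^ 2 ≤
      f * a ^ 2 + 2 * x * f * (a * a') + 2 * x * d * (b * a') + d * (a * b) := by
  have hx2 : e ^ 2 * x ^ 2 * s ^ 2 ≤ 3 * e ^ 2 * s := by
    have := mul_le_mul_of_nonneg_left hs2 (by positivity : 0 ≤ e ^ 2 * s)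
    linarith
  -- Here `a` is replaced by its value `a₀` at the origin. The weight `1/48` in Young's inequality
  -- is chosen because `|x| s` will integrate to `12`, which makes the cost `α / 4`.
  have t1 : a₀ ^ 2 * f - (e + 1 / 48) * α * (|x| * s) - 48 * e ^ 2 * a₀ ^ 2 * s
      ≤ f * a ^ 2 := by
    have h1 : |f * (a ^ 2 - a₀ ^ 2)| ≤ s * ((e + 1 / 48) * (|x| * α) + 48 * e ^ 2 * a₀ ^ 2) := by
      have h2 : |a ^ 2 - a₀ ^ 2| ≤ (a - a₀) ^ 2 + 2 * |a₀| * |a - a₀| := by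
        have : a ^ 2 - a₀ ^ 2 = (a - a₀) ^ 2 + 2 * a₀ * (a - a₀) := by ring
        rw [this]
        refine (abs_add_le _ _).trans (le_of_eq ?_)
        rw [abs_of_nonneg (sq_nonneg _), abs_mul, abs_mul, abs_two]
      have h3 : e * ((a - a₀) ^ 2 + 2 * |a₀| * |a - a₀|) ≤
          (e + 1 / 48) * (|x| * α) + 48 * e ^ 2 * a₀ ^ 2 := by
        have h4 := sq_nonneg (|a - a₀| / 48 - e * |a₀|)
        rw [sub_sq, mul_pow, div_pow, sq_abs, sq_abs] at h4
        have h5 := mul_le_mul_of_nonneg_left hr (by linarith : 0 ≤ e + 1 / 48)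
        linarith
      calc |f * (a ^ 2 - a₀ ^ 2)| ≤ e * s * ((a - a₀) ^ 2 + 2 * |a₀| * |a - a₀|) := by
            rw [abs_mul]; gcongr
        _ = s * (e * ((a - a₀) ^ 2 + 2 * |a₀| * |a - a₀|)) := by ring
        _ ≤ _ := by gcongr
    have h2 := (abs_le.1 h1).1
    linarith
  have t2 : -(1 / 4 * a' ^ 2 + 12 * e ^ 2 * (s * a ^ 2)) ≤ 2 * x * f * (a * a') := by
    have h1 : |2 * x * f * (a * a')| ≤ 2 * |x| * (e * s) * (|a| * |a'|) := by
      rw [abs_mul, abs_mul, abs_mul, abs_mul, abs_two]; gcongr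
    have h2 := sq_nonneg (|a'| / 2 - 2 * (|x| * (e * s) * |a|))
    have h3 : (|x| * (e * s) * |a|) ^ 2 = e ^ 2 * x ^ 2 * s ^ 2 * a ^ 2 := by
      rw [mul_pow, mul_pow, sq_abs, sq_abs]; ring
    have h4 := mul_le_mul_of_nonneg_right hx2 (sq_nonneg (a))
    rw [sub_sq, div_pow, sq_abs, mul_pow, h3] at h2
    linarith [(abs_le.1 h1).1]
  have t3 : -(1 / 4 * a' ^ 2 + 1 / 2 * ω * b ^ 2) ≤ 2 * x * d * (b * a') := by
    have h1 : |2 * x * d * (b * a')| ≤ 2 * |x| * (e * s) * (|b| * |a'|) := by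
      rw [abs_mul, abs_mul, abs_mul, abs_mul, abs_two]; gcongr
    have h2 := sq_nonneg (|a'| / 2 - 2 * (|x| * (e * s) * |b|))
    have h3 : (|x| * (e * s) * |b|) ^ 2 = e ^ 2 * x ^ 2 * s ^ 2 * b ^ 2 := by
      rw [mul_pow, mul_pow, sq_abs, sq_abs]; ring
    have h4 := mul_le_mul_of_nonneg_right hx2 (sq_nonneg (b))
    have h5 : 3 * e ^ 2 * s * b ^ 2 ≤ 1 / 8 * ω * b ^ 2 := by
      refine mul_le_mul_of_nonneg_right ?_ (sq_nonneg _)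
      have h6 : e ^ 2 ≤ 1 / 10000 := by nlinarith
      have h7 : e ^ 2 * s ≤ 1 / 10000 * (3 * ω) := mul_le_mul h6 hs1 hs0 (by norm_num)
      linarith
    rw [sub_sq, div_pow, sq_abs, mul_pow, h3] at h2
    linarith [(abs_le.1 h1).1]
  have t4 : -(1 / 2 * e ^ 2 * (s * a ^ 2) + 3 / 2 * ω * b ^ 2) ≤ d * (a * b) := by
    have h1 : |d * (a * b)| ≤ e * s * (|a| * |b|) := by
      rw [abs_mul, abs_mul]; gcongr
    have h2 := mul_nonneg hs0 (sq_nonneg (e * |a| - |b|))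
    rw [sub_sq, mul_pow, sq_abs, sq_abs] at h2
    have h3 := mul_le_mul_of_nonneg_right hs1 (sq_nonneg (b))
    linarith [(abs_le.1 h1).1]
  linarith

/-- Absence of square integrable solutions, by a virial identity: a system which is a small
perturbation of `(-∂² + ω - l) A = 0`, `(-∂² + ω + l) B = 0` and for which the leading perturbation
`f` is repulsive in the mean has no nontrivial solution. -/
theorem eq_zero_of_virial {ω l e : ℝ} (hω : 0 < ω) (hl : 0 ≤ l) (he : 0 ≤ e) (he' : e ≤ 1 / 100)
    {f d A A' B B' : ℝ → ℝ} (hf : Continuous f) (hd : Continuous d)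
    (hfe : ∀ x, |f x| ≤ e * decayWeight ω x) (hde : ∀ x, |d x| ≤ e * decayWeight ω x)
    (hint : 13000 * e ^ 2 * √ω ≤ ∫ x, f x)
    (hA : ∀ x, HasDerivAt A (A' x) x)
    (hA' : ∀ x, HasDerivAt A' ((ω - l) * A x + f x * A x + d x * B x) x)
    (hB : ∀ x, HasDerivAt B (B' x) x)
    (hB' : ∀ x, HasDerivAt B' ((ω + l) * B x + f x * B x + d x * A x) x)
    (hA2 : MemLp A 2) (hA2' : MemLp A' 2) (hB2 : MemLp B 2) (hB2' : MemLp B' 2) (x : ℝ) :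
    A x = 0 := by
  have hAc : Continuous A := continuous_iff_continuousAt.2 fun x => (hA x).continuousAt
  have hBc : Continuous B := continuous_iff_continuousAt.2 fun x => (hB x).continuousAt
  have hAc' : Continuous A' := continuous_iff_continuousAt.2 fun x => (hA' x).continuousAt
  set σ := decayWeight ω with hσ
  have hσ0 := decayWeight_nonneg hω
  have hσ1 := decayWeight_le hω
  have hσ2 := decayWeight_mul_sq_le hω
  have hσc := continuous_decayWeight hω
  have iA : Integrable fun x => A x ^ 2 := hA2.integrable_sq
  have iA' : Integrable fun x => A' x ^ 2 := hA2'.integrable_sq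
  have iB : Integrable fun x => B x ^ 2 := hB2.integrable_sq
  have iB' : Integrable fun x => B' x ^ 2 := hB2'.integrable_sq
  have iAA' : Integrable fun x => A x * A' x := hA2.integrable_mul hA2'
  have iAB : Integrable fun x => A x * B x := hA2.integrable_mul hB2
  have iBA' : Integrable fun x => B x * A' x := hB2.integrable_mul hA2'
  have iBB' : Integrable fun x => B x * B' x := hB2.integrable_mul hB2'
  have hfb : ∀ x, |f x| ≤ e * (3 * ω) := fun x => (hfe x).trans (by gcongr; exact hσ1 x)
  have hdb : ∀ x, |d x| ≤ e * (3 * ω) := fun x => (hde x).trans (by gcongr; exact hσ1 x)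
  have hxσ : ∀ x, |x| * σ x ≤ 3 + 3 * ω := by
    intro x
    have h1 := hσ1 x
    have h2 := hσ2 x
    have h3 := hσ0 x
    have h4 : |x| ≤ 1 + x ^ 2 := by
      rw [← sq_abs]; nlinarith [sq_nonneg (|x| - 1), abs_nonneg x]
    nlinarith
  have hxfb : ∀ x, |2 * x * f x| ≤ 2 * (e * (3 + 3 * ω)) := by
    intro x
    rw [abs_mul, abs_mul, abs_two, mul_assoc]
    have := hxσ x
    have h1 : |x| * |f x| ≤ |x| * (e * σ x) := by gcongr; exact hfe x
    nlinarith
  have hxdb : ∀ x, |2 * x * d x| ≤ 2 * (e * (3 + 3 * ω)) := by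
    intro x
    rw [abs_mul, abs_mul, abs_two, mul_assoc]
    have := hxσ x
    have h1 : |x| * |d x| ≤ |x| * (e * σ x) := by gcongr; exact hde x
    nlinarith
  have ifi : Integrable f := ((integrable_decayWeight hω).const_mul e).mono'
    hf.aestronglyMeasurable (ae_of_all _ hfe)
  set α := ∫ x, A' x ^ 2 with hα
  have hα0 : 0 ≤ α := integral_nonneg fun x => sq_nonneg _
  have hsob := sub_sq_le_abs_mul_integral_sq hA hAc' iA'
  have iσA : Integrable fun x => σ x * A x ^ 2 :=
    integrable_mul_of_abs_le iA hσc (C := 3 * ω) fun x => by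
      rw [abs_of_nonneg (hσ0 x)]; exact hσ1 x
  have iσ := integrable_decayWeight hω
  have ixσ := integrable_abs_mul_decayWeight hω
  -- the weighted norm of `A`
  have hN : ∫ x, σ x * A x ^ 2 ≤ 48 * √ω * A 0 ^ 2 + 24 * α := by
    calc ∫ x, σ x * A x ^ 2 ≤ ∫ x, (2 * A 0 ^ 2 * σ x + 2 * α * (|x| * σ x)) := by
          refine integral_mono iσA ((iσ.const_mul _).add (ixσ.const_mul _)) fun x => ?_
          have h1 : A x ^ 2 ≤ 2 * A 0 ^ 2 + 2 * (|x| * α) := by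
            nlinarith [hsob x, sq_nonneg (A x - 2 * A 0)]
          have := mul_le_mul_of_nonneg_left h1 (hσ0 x)
          simp only
          linarith
      _ = 2 * A 0 ^ 2 * (∫ x, σ x) + 2 * α * 12 := by
          rw [integral_add (iσ.const_mul _) (ixσ.const_mul _), integral_const_mul,
            integral_const_mul, integral_abs_mul_decayWeight hω]
      _ ≤ _ := by
          have h1 := integral_decayWeight_le hω
          have h2 := mul_le_mul_of_nonneg_left h1 (by positivity : 0 ≤ 2 * A 0 ^ 2)
          linarith
  set N := 48 * √ω * A 0 ^ 2 + 24 * α with hNdef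
  -- the energy estimate for `B`
  have hBest : ω * ∫ x, B x ^ 2 ≤ 6 * e ^ 2 * N := by
    have hder : ∀ x, HasDerivAt (fun x => B x * B' x)
        (B' x ^ 2 + (ω + l) * B x ^ 2 + f x * B x ^ 2 + d x * (A x * B x)) x := fun x =>
      ((hB x).mul (hB' x)).congr_deriv (by ring)
    have hi1 : Integrable fun x => f x * B x ^ 2 := integrable_mul_of_abs_le iB hf hfb
    have hi2 : Integrable fun x => d x * (A x * B x) := integrable_mul_of_abs_le iAB hd hdb
    have h0 := integral_eq_zero_of_hasDerivAt_of_integrable hder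
      (((iB'.add (iB.const_mul _)).add hi1).add hi2) iBB'
    -- Of the coercivity `ω + l`, the part `l ≥ 0` is dropped, and `f` and the coupling `d` each
    -- consume at most `ω / 4`.
    have h1 : ∫ x, (ω / 2 * B x ^ 2 - 3 * e ^ 2 * (σ x * A x ^ 2)) ≤ 0 := by
      rw [← h0]
      refine integral_mono ((iB.const_mul _).sub (iσA.const_mul _))
        (((iB'.add (iB.const_mul _)).add hi1).add hi2) fun x => ?_
      simp only
      have h2 : -(e * (3 * ω)) * B x ^ 2 ≤ f x * B x ^ 2 := by
        gcongr; exact (abs_le.1 (hfb x)).1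
      have h3 : -(ω / 4 * B x ^ 2 + 3 * e ^ 2 * (σ x * A x ^ 2)) ≤ d x * (A x * B x) := by
        have h4 : |d x * (A x * B x)| ≤ e * σ x * (|A x| * |B x|) := by
          rw [abs_mul, abs_mul]; gcongr; exact hde x
        have h5 : e * σ x * (|A x| * |B x|) ≤ ω / 4 * B x ^ 2 + 3 * e ^ 2 * (σ x * A x ^ 2) := by
          rw [← sq_abs (B x), ← sq_abs (A x)]
          have h6 : 0 ≤ (ω / 2 * |B x| - e * σ x * |A x|) ^ 2 := sq_nonneg _
          have h7 : (e * σ x * |A x|) ^ 2 ≤ 3 * ω * e ^ 2 * (σ x * |A x| ^ 2) := by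
            have h8 : σ x * σ x ≤ 3 * ω * σ x := mul_le_mul_of_nonneg_right (hσ1 x) (hσ0 x)
            have h9 := mul_le_mul_of_nonneg_right h8 (by positivity : 0 ≤ e ^ 2 * |A x| ^ 2)
            linarith
          have h10 : ω * (e * σ x * (|A x| * |B x|)) ≤
              ω * (ω / 4 * |B x| ^ 2 + 3 * e ^ 2 * (σ x * |A x| ^ 2)) := by linarith
          exact le_of_mul_le_mul_left h10 hω
        linarith [(abs_le.1 h4).1]
      have h4 : 0 ≤ l * B x ^ 2 := by positivity
      have h5 : e * (3 * ω) * B x ^ 2 ≤ ω / 4 * B x ^ 2 := by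
        gcongr; nlinarith
      linarith [sq_nonneg (B' x)]
    rw [integral_sub (iB.const_mul _) (iσA.const_mul _), integral_const_mul,
      integral_const_mul] at h1
    have h2 := mul_le_mul_of_nonneg_left hN (by positivity : 0 ≤ 6 * e ^ 2)
    linarith
  set Q : ℝ → ℝ := fun x => f x * A x ^ 2 + 2 * x * f x * (A x * A' x)
    + 2 * x * d x * (B x * A' x) + d x * (A x * B x) with hQ
  have iQ : Integrable Q :=
    (((integrable_mul_of_abs_le iA hf hfb).add
      (integrable_mul_of_abs_le iAA' (by fun_prop) hxfb)).add
      (integrable_mul_of_abs_le iBA' (by fun_prop) hxdb)).add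
      (integrable_mul_of_abs_le iAB hd hdb)
  have hvir : 2 * α + ∫ x, Q x = 0 := virial_identity hA hA' hA2 hA2' iQ
  have j1 : Integrable fun x => A 0 ^ 2 * f x - (e + 1 / 48) * α * (|x| * σ x) :=
    (ifi.const_mul _).sub (ixσ.const_mul _)
  have j2 : Integrable fun x => A 0 ^ 2 * f x - (e + 1 / 48) * α * (|x| * σ x)
      - 48 * e ^ 2 * A 0 ^ 2 * σ x := j1.sub (iσ.const_mul _)
  have j3 : Integrable fun x => A 0 ^ 2 * f x - (e + 1 / 48) * α * (|x| * σ x)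
      - 48 * e ^ 2 * A 0 ^ 2 * σ x - 1 / 2 * A' x ^ 2 := j2.sub (iA'.const_mul _)
  have j4 : Integrable fun x => A 0 ^ 2 * f x - (e + 1 / 48) * α * (|x| * σ x)
      - 48 * e ^ 2 * A 0 ^ 2 * σ x - 1 / 2 * A' x ^ 2 - 25 / 2 * e ^ 2 * (σ x * A x ^ 2) :=
    j3.sub (iσA.const_mul _)
  -- the lower bound
  have hlow : ∫ x, (A 0 ^ 2 * f x - (e + 1 / 48) * α * (|x| * σ x) - 48 * e ^ 2 * A 0 ^ 2 * σ x
      - 1 / 2 * A' x ^ 2 - 25 / 2 * e ^ 2 * (σ x * A x ^ 2) - 2 * ω * B x ^ 2) ≤ ∫ x, Q x := by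
    refine integral_mono (j4.sub (iB.const_mul _)) iQ fun x => ?_
    simp only [hQ]
    exact virial_density_ge hω he he' (hσ0 x) (hσ1 x) (hσ2 x) (hfe x) (hde x) (hsob x)
  rw [integral_sub j4 (iB.const_mul _), integral_sub j3 (iσA.const_mul _),
    integral_sub j2 (iA'.const_mul _), integral_sub j1 (iσ.const_mul _),
    integral_sub (ifi.const_mul _) (ixσ.const_mul _)] at hlow
  simp only [integral_const_mul] at hlow
  rw [integral_abs_mul_decayWeight hω, ← hα] at hlow
  -- The errors in `A(0)²` total `(48 · 24 + (25/2 + 12) · 48) e² √ω = 2328 e² √ω`, less than the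
  -- `13000 e² √ω` supplied by `∫ f`. The errors in `α` total less than `2 α`.
  have hα_zero : α ≤ 0 := by
    have hA0 : 0 ≤ A 0 ^ 2 := sq_nonneg _
    have g1 := mul_le_mul_of_nonneg_left hint hA0
    have g2 := mul_le_mul_of_nonneg_left (integral_decayWeight_le hω)
      (by positivity : 0 ≤ 48 * e ^ 2 * A 0 ^ 2)
    have g3 := mul_le_mul_of_nonneg_left hN (by positivity : 0 ≤ 25 / 2 * e ^ 2)
    have g4 : e ^ 2 * α ≤ 1 / 10000 * α := by gcongr; nlinarith
    have g5 : e * α ≤ 1 / 100 * α := by gcongr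
    have g6 : 0 ≤ e ^ 2 * √ω * A 0 ^ 2 := by positivity
    rw [hNdef] at g3 hBest
    linarith
  have hα_eq : α = 0 := le_antisymm hα_zero hα0
  have hconst : ∀ y, A y = A 0 := by
    intro y
    have h1 := hsob y
    rw [← hα, hα_eq, mul_zero] at h1
    have h2 : (A y - A 0) ^ 2 = 0 := le_antisymm h1 (sq_nonneg _)
    exact sub_eq_zero.1 (pow_eq_zero_iff two_ne_zero |>.1 h2)
  have hAconst : A = fun _ => A 0 := funext hconst
  rw [hAconst, memLp_const_iff (by norm_num) (by norm_num)] at hA2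
  rw [hconst x]
  simpa using hA2

/-! ### Energy identities and reality of the eigenvalue. -/

open scoped ComplexConjugate in
/-- The energy identity for `Z'' = q Z - lam W`. -/
theorem energy_identity {q : ℝ → ℝ} (hq : Continuous q) {C : ℝ} (hC : ∀ x, |q x| ≤ C)
    {Z Z' W : ℝ → ℂ} {lam : ℂ} (hZ : ∀ x, HasDerivAt Z (Z' x) x)
    (hZ' : ∀ x, HasDerivAt Z' (q x * Z x - lam * W x) x) (hZ2 : MemLp Z 2) (hZ2' : MemLp Z' 2)
    (hW2 : MemLp W 2) :
    ((∫ x, (‖Z' x‖ ^ 2 + q x * ‖Z x‖ ^ 2) : ℝ) : ℂ) = lam * ∫ x, conj (Z x) * W x := by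
  have hcZ2 : MemLp (fun x => conj (Z x)) 2 := hZ2.star
  have hcZ2' : MemLp (fun x => conj (Z' x)) 2 := hZ2'.star
  have i1 : Integrable fun x => conj (Z x) * Z' x := hcZ2.integrable_mul hZ2'
  have i2 : Integrable fun x => conj (Z x) * W x := hcZ2.integrable_mul hW2
  have i3 : Integrable fun x => conj (Z' x) * Z' x := hcZ2'.integrable_mul hZ2'
  have i4 : Integrable fun x => conj (Z x) * Z x := hcZ2.integrable_mul hZ2
  have i5 : Integrable fun x => (q x : ℂ) * (conj (Z x) * Z x) :=
    i4.bdd_mul (c := C) (by fun_prop) (ae_of_all _ fun x => by simpa using hC x)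
  have i6 : Integrable fun x => conj (Z' x) * Z' x + (q x : ℂ) * (conj (Z x) * Z x) := i3.add i5
  have i7 : Integrable fun x => lam * (conj (Z x) * W x) := i2.const_mul _
  have hder : ∀ x, HasDerivAt (fun x => conj (Z x) * Z' x)
      (conj (Z' x) * Z' x + (q x : ℂ) * (conj (Z x) * Z x) - lam * (conj (Z x) * W x)) x := by
    intro x
    have h1 : HasDerivAt (fun x => conj (Z x)) (conj (Z' x)) x := (hZ x).star
    exact (h1.mul (hZ' x)).congr_deriv (by ring)
  have h0 := integral_eq_zero_of_hasDerivAt_of_integrable hder (i6.sub i7) i1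
  rw [integral_sub i6 i7, sub_eq_zero, integral_const_mul] at h0
  rw [← h0, ← integral_complex_ofReal]
  congr 1
  ext x
  rw [← Complex.normSq_eq_conj_mul_self, ← Complex.normSq_eq_conj_mul_self,
    Complex.normSq_eq_norm_sq, Complex.normSq_eq_norm_sq]
  push_cast
  rfl

/-- A nonnegative energy forces positivity, and its vanishing forces the function to vanish. -/
theorem energy_nonneg_and {E : Type*} [NormedAddCommGroup E] {q : ℝ → ℝ} (hq : Continuous q)
    {c C : ℝ} (hc : 0 < c)
    (hcq : ∀ x, c ≤ q x) (hC : ∀ x, |q x| ≤ C) {Z Z' : ℝ → E} (hZ : Continuous Z)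
    (hZ2 : MemLp Z 2) (hZ2' : MemLp Z' 2) :
    0 ≤ ∫ x, (‖Z' x‖ ^ 2 + q x * ‖Z x‖ ^ 2) ∧
      (∫ x, (‖Z' x‖ ^ 2 + q x * ‖Z x‖ ^ 2) ≤ 0 → ∀ x, Z x = 0) := by
  have i1 : Integrable fun x => ‖Z x‖ ^ 2 := hZ2.norm.integrable_sq
  have i2 : Integrable fun x => ‖Z' x‖ ^ 2 := hZ2'.norm.integrable_sq
  have i3 : Integrable fun x => q x * ‖Z x‖ ^ 2 := integrable_mul_of_abs_le i1 hq hC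
  refine ⟨integral_nonneg fun x => ?_, fun h x => ?_⟩
  · have := hc.le.trans (hcq x)
    positivity
  have h1 : c * ∫ x, ‖Z x‖ ^ 2 ≤ 0 := by
    rw [← integral_const_mul]
    refine le_trans (integral_mono (i1.const_mul c) (i2.add i3) fun x => ?_) h
    have := mul_le_mul_of_nonneg_right (hcq x) (sq_nonneg ‖Z x‖)
    simp only [Pi.add_apply]
    linarith [sq_nonneg ‖Z' x‖]
  have h2 : ∫ x, ‖Z x‖ ^ 2 = 0 :=
    le_antisymm (nonpos_of_mul_nonpos_right h1 hc) (integral_nonneg fun x => sq_nonneg _)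
  rw [integral_eq_zero_iff_of_nonneg (fun x => sq_nonneg _) i1] at h2
  have h3 : (fun x => ‖Z x‖ ^ 2) = fun _ => (0 : ℝ) :=
    (Continuous.ae_eq_iff_eq volume (by fun_prop) continuous_const).1 h2
  simpa using congrFun h3 x

/-- Pairing each equation with its own unknown gives `E₁ = lam m` and `E₂ = lam m̄`, with the same
pairing `m = ∫ Z̄ W`. Hence the conjugate of `lam` times `E₂` is `lam E₁`, so `(E₁ + E₂) Im lam = 0`
with nonnegative energies. -/
theorem im_eq_zero_or_eq_zero_of_system {q₁ q₂ : ℝ → ℝ} (hq₁ : Continuous q₁) (hq₂ : Continuous q₂)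
    {c C : ℝ} (hc : 0 < c) (hcq₁ : ∀ x, c ≤ q₁ x) (hcq₂ : ∀ x, c ≤ q₂ x) (hC₁ : ∀ x, |q₁ x| ≤ C)
    (hC₂ : ∀ x, |q₂ x| ≤ C) {Z Z' W W' : ℝ → ℂ} {lam : ℂ} (hZ : ∀ x, HasDerivAt Z (Z' x) x)
    (hZ' : ∀ x, HasDerivAt Z' (q₁ x * Z x - lam * W x) x) (hW : ∀ x, HasDerivAt W (W' x) x)
    (hW' : ∀ x, HasDerivAt W' (q₂ x * W x - lam * Z x) x) (hZ2 : MemLp Z 2) (hZ2' : MemLp Z' 2)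
    (hW2 : MemLp W 2) (hW2' : MemLp W' 2) : lam.im = 0 ∨ ∀ x, Z x = 0 := by
  have hZc : Continuous Z := continuous_iff_continuousAt.2 fun x => (hZ x).continuousAt
  have hWc : Continuous W := continuous_iff_continuousAt.2 fun x => (hW x).continuousAt
  have e1 := energy_identity hq₁ hC₁ hZ hZ' hZ2 hZ2' hW2
  have e2 := energy_identity hq₂ hC₂ hW hW' hW2 hW2' hZ2
  obtain ⟨n1, z1⟩ := energy_nonneg_and hq₁ hc hcq₁ hC₁ hZc hZ2 hZ2'
  obtain ⟨n2, -⟩ := energy_nonneg_and hq₂ hc hcq₂ hC₂ hWc hW2 hW2'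
  set E₁ := ∫ x, (‖Z' x‖ ^ 2 + q₁ x * ‖Z x‖ ^ 2)
  set E₂ := ∫ x, (‖W' x‖ ^ 2 + q₂ x * ‖W x‖ ^ 2)
  rcases n1.eq_or_lt with h | h
  · exact Or.inr (z1 h.symm.le)
  left
  have hconj : (∫ x, (starRingEnd ℂ) (W x) * Z x) =
      (starRingEnd ℂ) (∫ x, (starRingEnd ℂ) (Z x) * W x) := by
    rw [← integral_conj]
    congr 1
    ext x
    simp [mul_comm]
  rw [hconj] at e2
  have e3 : (starRingEnd ℂ) lam * E₂ = lam * E₁ := by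
    have := congrArg (starRingEnd ℂ) e1
    rw [map_mul, Complex.conj_ofReal] at this
    rw [e2, this]
    ring
  have := congrArg Complex.im e3
  simp only [Complex.mul_im, Complex.conj_re, Complex.conj_im, Complex.ofReal_re,
    Complex.ofReal_im, mul_zero, zero_add] at this
  have h4 : lam.im * (E₁ + E₂) = 0 := by linarith
  exact (mul_eq_zero.1 h4).resolve_right (by positivity)

/-! ### The transformed system has only the zero solution. -/

section Transformed

variable {ω e : ℝ} {b₁ b₂ : ℝ → ℝ}

/-- The virial argument kills only the sum `z + w`. With `w = -z`, the first equation becomes `z'' =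
(ω + b₁ + l) z`, whose potential is positive as `l ≥ 0`. -/
theorem real_system_eq_zero (hω : 0 < ω) (he : 0 ≤ e) (he' : e ≤ 1 / 100) (hb₁ : Continuous b₁)
    (hb₂ : Continuous b₂) (hbe₁ : ∀ x, |b₁ x| ≤ e * decayWeight ω x)
    (hbe₂ : ∀ x, |b₂ x| ≤ e * decayWeight ω x)
    (hint : 13000 * e ^ 2 * √ω ≤ ∫ x, (b₁ x + b₂ x) / 2) {l : ℝ} (hl : 0 ≤ l)
    {z z' w w' : ℝ → ℝ} (hz : ∀ x, HasDerivAt z (z' x) x)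
    (hz' : ∀ x, HasDerivAt z' ((ω + b₁ x) * z x - l * w x) x) (hw : ∀ x, HasDerivAt w (w' x) x)
    (hw' : ∀ x, HasDerivAt w' ((ω + b₂ x) * w x - l * z x) x) (hz2 : MemLp z 2)
    (hz2' : MemLp z' 2) (hw2 : MemLp w 2) (hw2' : MemLp w' 2) (x : ℝ) : z x = 0 := by
  have hA : ∀ x, z x + w x = 0 := fun x =>
    eq_zero_of_virial hω hl he he' (f := fun x => (b₁ x + b₂ x) / 2)
      (d := fun x => (b₁ x - b₂ x) / 2) (A := fun x => z x + w x) (A' := fun x => z' x + w' x)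
      (B := fun x => z x - w x) (B' := fun x => z' x - w' x) (by fun_prop) (by fun_prop)
      (fun x => by
        have h1 := abs_le.1 (hbe₁ x); have h2 := abs_le.1 (hbe₂ x)
        rw [abs_le]; constructor <;> linarith)
      (fun x => by
        have h1 := abs_le.1 (hbe₁ x); have h2 := abs_le.1 (hbe₂ x)
        rw [abs_le]; constructor <;> linarith)
      hint (fun x => (hz x).add (hw x))
      (fun x => ((hz' x).add (hw' x)).congr_deriv (by ring))
      (fun x => (hz x).sub (hw x)) (fun x => ((hz' x).sub (hw' x)).congr_deriv (by ring))
      (hz2.add hw2) (hz2'.add hw2') (hz2.sub hw2) (hz2'.sub hw2') x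
  have hweq : ∀ x, w x = -z x := fun x => by linarith [hA x]
  have hzc : Continuous z := continuous_iff_continuousAt.2 fun x => (hz x).continuousAt
  have hb : ∀ x, |b₁ x| ≤ ω / 2 := fun x => by
    refine (hbe₁ x).trans ?_
    have := mul_le_mul he' (decayWeight_le hω x) (decayWeight_nonneg hω x) (by norm_num)
    linarith
  have hlow : ∀ x, ω / 2 ≤ ω + b₁ x + l := fun x => by linarith [(abs_le.1 (hb x)).1]
  have hq : Continuous fun x => ω + b₁ x + l := by fun_prop
  have hC : ∀ x, |ω + b₁ x + l| ≤ 2 * ω + l := fun x => by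
    have := abs_le.1 (hb x)
    rw [abs_le]; constructor <;> linarith
  refine (energy_nonneg_and hq (half_pos hω) hlow hC hzc hz2 hz2').2 (le_of_eq ?_) x
  have i1 : Integrable fun x => ‖z x‖ ^ 2 := hz2.norm.integrable_sq
  refine integral_eq_zero_of_hasDerivAt_of_integrable (f := fun x => z x * z' x) (fun x => ?_)
    (hz2'.norm.integrable_sq.add (integrable_mul_of_abs_le i1 hq hC)) (hz2.integrable_mul hz2')
  refine ((hz x).mul (hz' x)).congr_deriv ?_
  rw [hweq, Real.norm_eq_abs, Real.norm_eq_abs, sq_abs, sq_abs]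
  ring

/-- The system is invariant under `(w, l) ↦ (-w, -l)`. -/
theorem real_system_eq_zero' (hω : 0 < ω) (he : 0 ≤ e) (he' : e ≤ 1 / 100) (hb₁ : Continuous b₁)
    (hb₂ : Continuous b₂) (hbe₁ : ∀ x, |b₁ x| ≤ e * decayWeight ω x)
    (hbe₂ : ∀ x, |b₂ x| ≤ e * decayWeight ω x)
    (hint : 13000 * e ^ 2 * √ω ≤ ∫ x, (b₁ x + b₂ x) / 2) (l : ℝ)
    {z z' w w' : ℝ → ℝ} (hz : ∀ x, HasDerivAt z (z' x) x)
    (hz' : ∀ x, HasDerivAt z' ((ω + b₁ x) * z x - l * w x) x) (hw : ∀ x, HasDerivAt w (w' x) x)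
    (hw' : ∀ x, HasDerivAt w' ((ω + b₂ x) * w x - l * z x) x) (hz2 : MemLp z 2)
    (hz2' : MemLp z' 2) (hw2 : MemLp w 2) (hw2' : MemLp w' 2) (x : ℝ) : z x = 0 := by
  rcases le_total 0 l with hl | hl
  · exact real_system_eq_zero hω he he' hb₁ hb₂ hbe₁ hbe₂ hint hl hz hz' hw hw' hz2 hz2' hw2 hw2' x
  · exact real_system_eq_zero hω he he' hb₁ hb₂ hbe₁ hbe₂ hint (neg_nonneg.2 hl) hz
      (w := fun x => -w x) (w' := fun x => -w' x)
      (fun x => (hz' x).congr_deriv (by ring)) (fun x => (hw x).neg)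
      (fun x => (hw' x).neg.congr_deriv (by ring)) hz2 hz2' hw2.neg hw2'.neg x

/-- The transformed system has no nontrivial solution in `H¹`. -/
theorem transformed_system_eq_zero (hω : 0 < ω) (he : 0 ≤ e) (he' : e ≤ 1 / 100)
    (hb₁ : Continuous b₁) (hb₂ : Continuous b₂) (hbe₁ : ∀ x, |b₁ x| ≤ e * decayWeight ω x)
    (hbe₂ : ∀ x, |b₂ x| ≤ e * decayWeight ω x)
    (hint : 13000 * e ^ 2 * √ω ≤ ∫ x, (b₁ x + b₂ x) / 2) {lam : ℂ}
    {Z Z' W W' : ℝ → ℂ} (hZ : ∀ x, HasDerivAt Z (Z' x) x)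
    (hZ' : ∀ x, HasDerivAt Z' ((ω + b₁ x) * Z x - lam * W x) x)
    (hW : ∀ x, HasDerivAt W (W' x) x)
    (hW' : ∀ x, HasDerivAt W' ((ω + b₂ x) * W x - lam * Z x) x) (hZ2 : MemLp Z 2)
    (hZ2' : MemLp Z' 2) (hW2 : MemLp W 2) (hW2' : MemLp W' 2) (x : ℝ) : Z x = 0 := by
  have hb : ∀ b : ℝ → ℝ, (∀ x, |b x| ≤ e * decayWeight ω x) → ∀ x, |b x| ≤ ω / 2 := by
    intro b hbe x
    refine (hbe x).trans ?_
    have := mul_le_mul he' (decayWeight_le hω x) (decayWeight_nonneg hω x) (by norm_num)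
    linarith
  have hlow : ∀ b : ℝ → ℝ, (∀ x, |b x| ≤ e * decayWeight ω x) → ∀ x, ω / 2 ≤ ω + b x :=
    fun b hbe x => by linarith [(abs_le.1 (hb b hbe x)).1]
  have hup : ∀ b : ℝ → ℝ, (∀ x, |b x| ≤ e * decayWeight ω x) → ∀ x, |ω + b x| ≤ 2 * ω :=
    fun b hbe x => by
      have := abs_le.1 (hb b hbe x)
      rw [abs_le]; constructor <;> linarith
  rcases im_eq_zero_or_eq_zero_of_system (q₁ := fun x => ω + b₁ x) (q₂ := fun x => ω + b₂ x)
    (by fun_prop) (by fun_prop) (half_pos hω) (hlow b₁ hbe₁) (hlow b₂ hbe₂) (hup b₁ hbe₁)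
    (hup b₂ hbe₂) hZ (fun x => by simpa using hZ' x) hW (fun x => by simpa using hW' x)
    hZ2 hZ2' hW2 hW2' with hlam | h
  swap
  · exact h x
  have key : ∀ L : ℂ →L[ℝ] ℝ, (∀ (r : ℝ) (z : ℂ), L (r * z) = r * L z) →
      L (Z x) = 0 := by
    intro L hL
    have hlam' : lam = (lam.re : ℂ) := Complex.ext (by simp) (by simpa using hlam)
    have comp : ∀ {u u' : ℝ → ℂ}, (∀ x, HasDerivAt u (u' x) x) →
        ∀ x, HasDerivAt (fun x => L (u x)) (L (u' x)) x := fun h x =>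
      L.hasFDerivAt.comp_hasDerivAt x (h x)
    have mem : ∀ {u : ℝ → ℂ}, MemLp u 2 → MemLp (fun x => L (u x)) 2 := fun h =>
      h.continuousLinearMap_comp L
    refine real_system_eq_zero' hω he he' hb₁ hb₂ hbe₁ hbe₂ hint lam.re
      (comp hZ) (fun x => (comp hZ' x).congr_deriv ?_) (comp hW)
      (fun x => (comp hW' x).congr_deriv ?_) (mem hZ2) (mem hZ2') (mem hW2) (mem hW2') x
    · rw [map_sub, hlam', hL, ← Complex.ofReal_add, hL, Complex.ofReal_re]
    · rw [map_sub, hlam', hL, ← Complex.ofReal_add, hL, Complex.ofReal_re]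
  apply Complex.ext
  · exact key Complex.reCLM fun r z => by simp
  · exact key Complex.imCLM fun r z => by simp

end Transformed

/-! ### The conjugation identities. -/

section Conjugation

variable {ω lam : ℂ} {s p γ γ' Γ X X' Y Y' : ℝ → ℂ}

/-- First transformed function `φ ∂² φ⁻¹ X`, with the second derivative eliminated. -/
def transOne (lam : ℂ) (p X X' Y : ℝ → ℂ) (x : ℝ) : ℂ :=
  -2 * p x * X' x + 2 * p x ^ 2 * X x - lam * Y x

/-- Second transformed function. -/
def transTwo (ω lam : ℂ) (s p γ X Y Y' : ℝ → ℂ) (x : ℝ) : ℂ :=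
  (2 * ω - 2 * s x + 2 * γ x) * Y x - 2 * p x * Y' x - lam * X x

/-- Derivative of the first transformed function. -/
def transOneDeriv (ω lam : ℂ) (p γ Γ X X' Y Y' : ℝ → ℂ) (x : ℝ) : ℂ :=
  2 * (ω + 2 * Γ x - γ x) * (X' x - p x * X x) + 2 * p x * (lam * Y x) - lam * Y' x

/-- Derivative of the second transformed function. -/
def transTwoDeriv (ω lam : ℂ) (s p γ X X' Y Y' : ℝ → ℂ) (x : ℝ) : ℂ :=
  -p x * transTwo ω lam s p γ X Y Y' x - lam * (X' x - p x * X x)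

variable (hp2 : ∀ x, p x ^ 2 = ω - s x / 2 + Γ x)
  (hp : ∀ x, HasDerivAt p (-s x / 2 - Γ x + γ x) x)
  (hs : ∀ x, HasDerivAt s (2 * s x * p x) x)
  (hγ : ∀ x, HasDerivAt γ (γ' x * (2 * s x * p x)) x)
  (hΓ : ∀ x, HasDerivAt Γ (2 * p x * (γ x - Γ x)) x)
  (hX : ∀ x, HasDerivAt X (X' x) x)
  (hX' : ∀ x, HasDerivAt X' ((ω - s x + γ x) * X x - lam * Y x) x)
  (hY : ∀ x, HasDerivAt Y (Y' x) x)
  (hY' : ∀ x, HasDerivAt Y' ((ω - 3 * s x + γ x + 2 * s x * γ' x) * Y x - lam * X x) x)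

include hp2 hp hX hX' hY in
-- The identities are purely algebraic in `p = φ'/φ`, `s = φ²`, `γ = g(φ²)`, `γ' = g'(φ²)`, `Γ =
-- G(φ²)/φ²`. With `u = X' - p X`, the first equation reads `u' = -p u - lam Y`, and the transformed
-- function is `u' - p u = -2 p u - lam Y`.
theorem hasDerivAt_transOne (x : ℝ) :
    HasDerivAt (transOne lam p X X' Y) (transOneDeriv ω lam p γ Γ X X' Y Y' x) x := by
  refine (((((hp x).const_mul (-2)).mul (hX' x)).add ((((hp x).pow 2).const_mul 2).mul
    (hX x))).sub ((hY x).const_mul lam)).congr_deriv ?_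
  simp only [transOneDeriv, Pi.pow_apply, Nat.cast_ofNat]
  linear_combination 2 * X' x * hp2 x

include hp2 hp hγ hΓ hX hX' hY hY' in
-- The derivatives of `p` and `u` and the potential of `L₊` bring in the cubic term `s`; it is
-- absorbed into the two transformed functions, leaving the potential `ω + pertOne`.
theorem hasDerivAt_transOneDeriv (x : ℝ) :
    HasDerivAt (transOneDeriv ω lam p γ Γ X X' Y Y')
      ((ω + (6 * Γ x - 5 * γ x + 2 * s x * γ' x)) * transOne lam p X X' Y x
        - lam * transTwo ω lam s p γ X Y Y' x) x := by
  refine (((((((hΓ x).const_mul 2).const_add ω).sub (hγ x)).const_mul 2).mul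
    ((hX' x).sub ((hp x).mul (hX x)))).add (((hp x).const_mul 2).mul ((hY x).const_mul lam))).sub
    ((hY' x).const_mul lam) |>.congr_deriv ?_
  simp only [transOne, transTwo, Pi.sub_apply, Pi.mul_apply]
  linear_combination (-2 * (ω + 2 * Γ x - γ x) * X x) * hp2 x

include hp2 hp hs hγ hX hY hY' in
-- Multiplied by `φ`, the function is `2 (φ'' Y - φ' Y') - lam φ X`. As `L₊ φ' = 0`, the Wronskian
-- part has derivative `2 lam φ' X`, so the whole has derivative `-lam φ² (X/φ)'`.
theorem hasDerivAt_transTwo (x : ℝ) :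
    HasDerivAt (transTwo ω lam s p γ X Y Y') (transTwoDeriv ω lam s p γ X X' Y Y' x) x := by
  refine (((((hs x).const_mul 2).const_sub (2 * ω)).add ((hγ x).const_mul 2)).mul (hY x)).sub
    (((hp x).const_mul 2).mul (hY' x)) |>.sub ((hX x).const_mul lam) |>.congr_deriv ?_
  simp only [transTwoDeriv, transTwo, Pi.add_apply]
  linear_combination (-2 * Y' x) * hp2 x

include hp2 hp hs hγ hX hX' hY hY' in
-- With `S = ∂ - p`, apply `S` to `S* W = lam S X`: the operator `S S*` is `-∂² + p² - p'`, and `p²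
-- - p' = ω + 2 Γ - γ`.
theorem hasDerivAt_transTwoDeriv (x : ℝ) :
    HasDerivAt (transTwoDeriv ω lam s p γ X X' Y Y')
      ((ω + (2 * Γ x - γ x)) * transTwo ω lam s p γ X Y Y' x - lam * transOne lam p X X' Y x)
      x := by
  have h := hasDerivAt_transTwo (lam := lam) hp2 hp hs hγ hX hY hY' x
  refine ((hp x).neg.mul h).sub (((hX' x).sub ((hp x).mul (hX x))).const_mul lam)
    |>.congr_deriv ?_
  simp only [transOne, transTwoDeriv, Pi.neg_apply]
  linear_combination (transTwo ω lam s p γ X Y Y' x + lam * X x) * hp2 x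

end Conjugation

/-! ### Derivatives and bounds of quantities attached to the profile. -/

theorem memLp_ofReal_mul {q : ℝ → ℝ} (hq : Continuous q) {C : ℝ} (hC : ∀ x, |q x| ≤ C)
    {u : ℝ → ℂ} (hu : MemLp u 2) : MemLp (fun x => (q x : ℂ) * u x) 2 := by
  refine hu.of_le_mul (c := C) ((Complex.continuous_ofReal.comp hq).aestronglyMeasurable.mul hu.1)
    (ae_of_all _ fun x => ?_)
  rw [norm_mul, Complex.norm_real, Real.norm_eq_abs]
  gcongr
  exact hC x

namespace IsSolitaryWave

variable {g : ℝ → ℝ} {δ ω : ℝ} {φ : ℝ → ℝ}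

theorem logDeriv_sq (h : H1 g) (hφ : IsSolitaryWave g ω φ) (x : ℝ) :
    (deriv φ x / φ x) ^ 2 = ω - φ x ^ 2 / 2 + primitive g (φ x ^ 2) / φ x ^ 2 := by
  have h1 := hφ.deriv_sq h x
  have := hφ.pos h x
  rw [div_pow, h1, logDerivSq, mul_div_cancel_left₀ _ (pow_pos this 2).ne']

theorem hasDerivAt_logDeriv (h : H1 g) (hφ : IsSolitaryWave g ω φ) (x : ℝ) :
    HasDerivAt (fun x => deriv φ x / φ x)
      (-φ x ^ 2 / 2 - primitive g (φ x ^ 2) / φ x ^ 2 + g (φ x ^ 2)) x := by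
  have hp := hφ.pos h x
  refine ((hφ.hasDerivAt_deriv x).div (hφ.hasDerivAt x) hp.ne').congr_deriv ?_
  have h1 := hφ.logDeriv_sq h x
  have h2 : ((ω * φ x - φ x ^ 3 + φ x * g (φ x ^ 2)) * φ x - deriv φ x * deriv φ x) / φ x ^ 2
      = ω - φ x ^ 2 + g (φ x ^ 2) - (deriv φ x / φ x) ^ 2 := by
    field_simp
  rw [h2, h1]
  ring

theorem hasDerivAt_sq' (h : H1 g) (hφ : IsSolitaryWave g ω φ) (x : ℝ) :
    HasDerivAt (fun x => φ x ^ 2) (2 * φ x ^ 2 * (deriv φ x / φ x)) x := by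
  have hp := hφ.pos h x
  refine (hφ.hasDerivAt_sq x).congr_deriv ?_
  field_simp

theorem hasDerivAt_comp_sq (h : H1 g) (hφ : IsSolitaryWave g ω φ) (x : ℝ) :
    HasDerivAt (fun x => g (φ x ^ 2))
      (deriv g (φ x ^ 2) * (2 * φ x ^ 2 * (deriv φ x / φ x))) x :=
  (h.hasDerivAt (pow_pos (hφ.pos h x) 2)).comp x (hφ.hasDerivAt_sq' h x)

theorem hasDerivAt_primitive_div (h : H1 g) (hφ : IsSolitaryWave g ω φ) (x : ℝ) :
    HasDerivAt (fun x => primitive g (φ x ^ 2) / φ x ^ 2)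
      (2 * (deriv φ x / φ x) * (g (φ x ^ 2) - primitive g (φ x ^ 2) / φ x ^ 2)) x := by
  have hp := hφ.pos h x
  refine ((h.hasDerivAt_primitive_div (pow_pos hp 2)).comp x (hφ.hasDerivAt_sq' h x)).congr_deriv ?_
  field_simp

theorem hasDerivAt_deriv_deriv (h : H1 g) (hφ : IsSolitaryWave g ω φ) (x : ℝ) :
    HasDerivAt (fun x => ω * φ x - φ x ^ 3 + φ x * g (φ x ^ 2))
      ((ω - 3 * φ x ^ 2 + g (φ x ^ 2) + 2 * φ x ^ 2 * deriv g (φ x ^ 2)) * deriv φ x) x := by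
  have hp := hφ.pos h x
  refine ((((hφ.hasDerivAt x).const_mul ω).sub ((hφ.hasDerivAt x).pow 3)).add
    ((hφ.hasDerivAt x).mul (hφ.hasDerivAt_comp_sq h x))).congr_deriv ?_
  field_simp
  push_cast
  ring

theorem continuous_deriv (hφ : IsSolitaryWave g ω φ) : Continuous (deriv φ) :=
  continuous_iff_continuousAt.2 fun x => (hφ.hasDerivAt_deriv x).continuousAt

theorem continuous_comp_sq_of_Ioi (h : H1 g) (hφ : IsSolitaryWave g ω φ) {F : ℝ → ℝ}
    (hF : ContinuousOn F (Set.Ioi 0)) : Continuous fun x => F (φ x ^ 2) :=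
  hF.comp_continuous (hφ.continuous.pow 2) fun x => pow_pos (hφ.pos h x) 2

theorem sq_le_decayWeight (h : H1 g) (hsm : IsSmall g δ ω) (hφ : IsSolitaryWave g ω φ) (x : ℝ) :
    φ x ^ 2 ≤ decayWeight ω x := hφ.sq_le_decay h hsm x

theorem sq_le_three_mul (h : H1 g) (hsm : IsSmall g δ ω) (hφ : IsSolitaryWave g ω φ) (x : ℝ) :
    φ x ^ 2 ≤ 3 * ω := (hφ.sq_le_decayWeight h hsm x).trans (decayWeight_le hsm.1 x)

theorem deriv_sq_le (h : H1 g) (hsm : IsSmall g δ ω) (hφ : IsSolitaryWave g ω φ) (x : ℝ) :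
    deriv φ x ^ 2 ≤ 2 * ω * φ x ^ 2 := by
  have h1 := logDerivSq_le hsm (pow_pos (hφ.pos h x) 2) (hφ.sq_le_three_mul h hsm x)
  rw [hφ.deriv_sq h x, mul_comm]
  gcongr

theorem abs_logDeriv_le (h : H1 g) (hsm : IsSmall g δ ω) (hφ : IsSolitaryWave g ω φ) (x : ℝ) :
    |deriv φ x / φ x| ≤ 1 + 2 * ω := by
  have hp := hφ.pos h x
  have h1 : (deriv φ x / φ x) ^ 2 ≤ 2 * ω := by
    rw [div_pow, div_le_iff₀ (pow_pos hp 2)]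
    exact hφ.deriv_sq_le h hsm x
  rw [← sq_abs] at h1
  nlinarith [sq_nonneg (|deriv φ x / φ x| - 1), abs_nonneg (deriv φ x / φ x)]

theorem abs_comp_sq_le (h : H1 g) (hsm : IsSmall g δ ω) (hφ : IsSolitaryWave g ω φ) (x : ℝ) :
    |g (φ x ^ 2)| ≤ ω := by
  have h1 := hφ.sq_le_three_mul h hsm x
  have h2 := (hsm.2.2 _ (pow_pos (hφ.pos h x) 2) (h1.trans hsm.2.1)).1
  linarith [hsm.1]

theorem memLp (h : H1 g) (hsm : IsSmall g δ ω) (hφ : IsSolitaryWave g ω φ) : MemLp φ 2 :=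
  memLp_two_of_sq_le_decayWeight hsm.1 hφ.continuous (C := 1)
    (by simpa using hφ.sq_le_decayWeight h hsm)

theorem memLp_deriv (h : H1 g) (hsm : IsSmall g δ ω) (hφ : IsSolitaryWave g ω φ) :
    MemLp (deriv φ) 2 :=
  memLp_two_of_sq_le_decayWeight hsm.1 hφ.continuous_deriv (C := 2 * ω) fun x =>
    (hφ.deriv_sq_le h hsm x).trans (mul_le_mul_of_nonneg_left (hφ.sq_le_decayWeight h hsm x)
      (by linarith [hsm.1]))

theorem continuous_potential (h : H1 g) (hφ : IsSolitaryWave g ω φ) :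
    Continuous fun x => ω - φ x ^ 2 + g (φ x ^ 2) :=
  (continuous_const.sub (hφ.continuous.pow 2)).add (hφ.continuous_comp_sq h.continuousOn)

theorem memLp_deriv_deriv (h : H1 g) (hsm : IsSmall g δ ω) (hφ : IsSolitaryWave g ω φ) :
    MemLp (fun x => ω * φ x - φ x ^ 3 + φ x * g (φ x ^ 2)) 2 := by
  have hω := hsm.1
  refine (hφ.memLp h hsm).of_le_mul (c := 5 * ω) ?_ (ae_of_all _ fun x => ?_)
  · exact (continuous_iff_continuousAt.2 fun x =>
      (hφ.hasDerivAt_deriv_deriv h x).continuousAt).aestronglyMeasurable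
  · have h1 : ω * φ x - φ x ^ 3 + φ x * g (φ x ^ 2) = (ω - φ x ^ 2 + g (φ x ^ 2)) * φ x := by ring
    rw [h1, norm_mul]
    gcongr
    have h2 := hφ.sq_le_three_mul h hsm x
    have h3 := abs_le.1 (hφ.abs_comp_sq_le h hsm x)
    rw [Real.norm_eq_abs, abs_le]
    constructor <;> linarith [sq_nonneg (φ x)]

theorem continuous_potential_plus (h : H1 g) (hφ : IsSolitaryWave g ω φ) :
    Continuous fun x => ω - 3 * φ x ^ 2 + g (φ x ^ 2) + 2 * φ x ^ 2 * deriv g (φ x ^ 2) := by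
  have h1 := hφ.continuous
  exact ((continuous_const.sub (continuous_const.mul (h1.pow 2))).add
    (hφ.continuous_comp_sq h.continuousOn)).add
    ((continuous_const.mul (h1.pow 2)).mul (hφ.continuous_comp_sq_of_Ioi h h.continuousOn_deriv))

theorem abs_pert_le (h : H1 g) (hsm : IsSmall g δ ω) (hφ : IsSolitaryWave g ω φ) (x : ℝ) :
    |pertOne g (φ x ^ 2)| ≤ 5 * eps g ω * decayWeight ω x ∧
      |pertTwo g (φ x ^ 2)| ≤ 5 * eps g ω * decayWeight ω x := by
  have h0 := eps_nonneg (g := g) ω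
  have h1 := hφ.sq_le_decayWeight h hsm x
  have h2 := decayWeight_nonneg hsm.1 x
  have hs := pow_pos (hφ.pos h x) 2
  obtain ⟨h3, h4⟩ := h.abs_pert_le h0 (fun s hs hs' => abs_mul_deriv_deriv_le_eps
    (η := 1 / 16) (by norm_num) (fun s hs hs' => (hsm.2.2 s hs (hs'.trans hsm.2.1)).2.2)
    hs.le hs') hs (hφ.sq_le_three_mul h hsm x)
  have h5 := mul_le_mul_of_nonneg_left h1 h0
  constructor
  · linarith
  · nlinarith

theorem continuous_pertOne (h : H1 g) (hφ : IsSolitaryWave g ω φ) :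
    Continuous fun x => pertOne g (φ x ^ 2) := by
  refine hφ.continuous_comp_sq_of_Ioi h fun s hs => ?_
  have h1 := (h.hasDerivAt_primitive_div hs).continuousAt
  have h2 := (h.hasDerivAt hs).continuousAt
  have h3 := (h.hasDerivAt_deriv hs).continuousAt
  exact (((h1.const_mul 6).sub (h2.const_mul 5)).add
    ((continuousAt_id.const_mul 2).mul h3)).continuousWithinAt

theorem continuous_pertTwo (h : H1 g) (hφ : IsSolitaryWave g ω φ) :
    Continuous fun x => pertTwo g (φ x ^ 2) :=
  hφ.continuous_comp_sq_of_Ioi h fun _ hs =>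
    (h.hasDerivAt_pertTwo hs).continuousAt.continuousWithinAt

theorem exists_deriv_ne_zero (h : H1 g) (hφ : IsSolitaryWave g ω φ) : ∃ x, deriv φ x ≠ 0 := by
  by_contra! hcon
  have h1 : ∀ x, φ x = φ 0 := fun x =>
    is_const_of_deriv_eq_zero (fun x => (hφ.hasDerivAt x).differentiableAt) hcon x 0
  have h2 : Tendsto φ atTop (𝓝 0) := hφ.tendsto_zero.mono_left atTop_le_cocompact
  rw [show φ = fun _ => φ 0 from funext h1, tendsto_const_nhds_iff] at h2
  exact (hφ.pos h 0).ne' h2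

/-- At `0` the energy identity gives `ω = s/2 - G/s` with `s = φ(0)²`, so `φ''/φ = -s/2 - G/s + g`,
which is negative by smallness. -/
theorem deriv_deriv_zero_ne (h : H1 g) (hsm : IsSmall g δ ω) (hφ : IsSolitaryWave g ω φ) :
    ω * φ 0 - φ 0 ^ 3 + φ 0 * g (φ 0 ^ 2) ≠ 0 := by
  have hp := hφ.pos h 0
  have hs := pow_pos hp 2
  have h1 := hφ.logDeriv_sq h 0
  rw [hφ.deriv_zero] at h1
  have h2 := hφ.sq_le_three_mul h hsm 0
  have h3 := abs_le.1 (hsm.abs_div_le hs (h2.trans hsm.2.1)).2.2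
  have h4 := abs_le.1 (hsm.2.2 _ hs (h2.trans hsm.2.1)).1
  have h5 : ω * φ 0 - φ 0 ^ 3 + φ 0 * g (φ 0 ^ 2) = φ 0 * (ω - φ 0 ^ 2 + g (φ 0 ^ 2)) := by ring
  rw [h5]
  refine (mul_neg_of_pos_of_neg hp ?_).ne
  norm_num at h1
  linarith

end IsSolitaryWave

/-! ### From the transformed system back to the original one. -/

section Main

variable {g : ℝ → ℝ} {δ ω : ℝ} {φ : ℝ → ℝ} {lam : ℂ} {X X' Y Y' : ℝ → ℂ}

/-- The potential of `L₋` for a profile `φ`. -/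
def profileMinus (g : ℝ → ℝ) (ω : ℝ) (φ : ℝ → ℝ) (x : ℝ) : ℝ := ω - φ x ^ 2 + g (φ x ^ 2)

/-- The potential of `L₊` for a profile `φ`. -/
def profilePlus (g : ℝ → ℝ) (ω : ℝ) (φ : ℝ → ℝ) (x : ℝ) : ℝ :=
  ω - 3 * φ x ^ 2 + g (φ x ^ 2) + 2 * φ x ^ 2 * deriv g (φ x ^ 2)

theorem IsSolitaryWave.transOne_eq_zero (h : H1 g) (hsm : IsSmall g δ ω)
    (hφ : IsSolitaryWave g ω φ) (heps : eps g ω ≤ 1 / 500)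
    (hint : 13000 * (5 * eps g ω) ^ 2 * √ω ≤
      ∫ x, (pertOne g (φ x ^ 2) + pertTwo g (φ x ^ 2)) / 2)
    (hX : ∀ x, HasDerivAt X (X' x) x)
    (hX' : ∀ x, HasDerivAt X' (profileMinus g ω φ x * X x - lam * Y x) x)
    (hY : ∀ x, HasDerivAt Y (Y' x) x)
    (hY' : ∀ x, HasDerivAt Y' (profilePlus g ω φ x * Y x - lam * X x) x)
    (hX2 : MemLp X 2) (hX2' : MemLp X' 2) (hY2 : MemLp Y 2) (hY2' : MemLp Y' 2) (x : ℝ) :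
    transOne lam (fun x => ((deriv φ x / φ x : ℝ) : ℂ)) X X' Y x = 0 := by
  have hω := hsm.1
  set p : ℝ → ℝ := fun x => deriv φ x / φ x with hpdef
  have hpc : Continuous p :=
    continuous_iff_continuousAt.2 fun x => (hφ.hasDerivAt_logDeriv h x).continuousAt
  have hpb := hφ.abs_logDeriv_le h hsm
  have hpb' : ∀ x, |p x| ≤ 1 + 2 * ω := hpb
  have hφc := hφ.continuous
  have hgc := hφ.continuous_comp_sq h.continuousOn
  have hgb := hφ.abs_comp_sq_le h hsm
  have hsb := hφ.sq_le_three_mul h hsm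
  have hp2 : ∀ x, ((p x : ℝ) : ℂ) ^ 2 =
      (ω : ℂ) - ((φ x ^ 2 : ℝ) : ℂ) / 2 + ((primitive g (φ x ^ 2) / φ x ^ 2 : ℝ) : ℂ) := by
    intro x
    have := congrArg (fun r : ℝ => (r : ℂ)) (hφ.logDeriv_sq h x)
    simpa [hpdef] using this
  have hp : ∀ x, HasDerivAt (fun x => ((p x : ℝ) : ℂ)) (-((φ x ^ 2 : ℝ) : ℂ) / 2
      - ((primitive g (φ x ^ 2) / φ x ^ 2 : ℝ) : ℂ) + ((g (φ x ^ 2) : ℝ) : ℂ)) x := fun x =>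
    (hφ.hasDerivAt_logDeriv h x).ofReal_comp.congr_deriv (by push_cast; ring)
  have hs : ∀ x, HasDerivAt (fun x => ((φ x ^ 2 : ℝ) : ℂ)) (2 * ((φ x ^ 2 : ℝ) : ℂ) * (p x : ℝ)) x :=
    fun x => (hφ.hasDerivAt_sq' h x).ofReal_comp.congr_deriv (by push_cast [hpdef]; ring)
  have hγ : ∀ x, HasDerivAt (fun x => ((g (φ x ^ 2) : ℝ) : ℂ))
      (((deriv g (φ x ^ 2) : ℝ) : ℂ) * (2 * ((φ x ^ 2 : ℝ) : ℂ) * (p x : ℝ))) x :=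
    fun x => (hφ.hasDerivAt_comp_sq h x).ofReal_comp.congr_deriv (by push_cast [hpdef]; ring)
  have hΓ : ∀ x, HasDerivAt (fun x => ((primitive g (φ x ^ 2) / φ x ^ 2 : ℝ) : ℂ))
      (2 * (p x : ℝ) * (((g (φ x ^ 2) : ℝ) : ℂ)
        - ((primitive g (φ x ^ 2) / φ x ^ 2 : ℝ) : ℂ))) x :=
    fun x => (hφ.hasDerivAt_primitive_div h x).ofReal_comp.congr_deriv (by push_cast [hpdef]; ring)
  have hX'' : ∀ x, HasDerivAt X' (((ω : ℂ) - ((φ x ^ 2 : ℝ) : ℂ) + ((g (φ x ^ 2) : ℝ) : ℂ)) * X x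
      - lam * Y x) x := fun x => (hX' x).congr_deriv (by simp [profileMinus])
  have hY'' : ∀ x, HasDerivAt Y' (((ω : ℂ) - 3 * ((φ x ^ 2 : ℝ) : ℂ) + ((g (φ x ^ 2) : ℝ) : ℂ)
      + 2 * ((φ x ^ 2 : ℝ) : ℂ) * ((deriv g (φ x ^ 2) : ℝ) : ℂ)) * Y x - lam * X x) x :=
    fun x => (hY' x).congr_deriv (by simp [profilePlus])
  have hpsq : ∀ x, |2 * p x ^ 2| ≤ 2 * (1 + 2 * ω) ^ 2 := fun x => by
    rw [abs_mul, abs_two, abs_pow]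
    have := hpb' x
    gcongr
  -- With second derivatives eliminated, the transformed functions and their derivatives are
  -- combinations of `X`, `X'`, `Y`, `Y'` with bounded coefficients, hence square integrable.
  have hU2 : MemLp (fun x => X' x - (p x : ℂ) * X x) 2 := hX2'.sub (memLp_ofReal_mul hpc hpb' hX2)
  have hZ2 : MemLp (transOne lam (fun x => (p x : ℂ)) X X' Y) 2 := by
    refine (((memLp_ofReal_mul hpc hpb' (hX2'.const_mul (-2))).add
      (memLp_ofReal_mul (by fun_prop : Continuous fun x => 2 * p x ^ 2) hpsq hX2)).sub
      (hY2.const_mul lam)).ae_eq (ae_of_all _ fun x => ?_)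
    simp only [transOne, Pi.add_apply, Pi.sub_apply]
    push_cast
    ring
  have hcc : Continuous fun x => ω + pertTwo g (φ x ^ 2) := (hφ.continuous_pertTwo h).const_add ω
  have hcb : ∀ x, |ω + pertTwo g (φ x ^ 2)| ≤ 2 * ω := fun x => by
    have := abs_le.1 (hsm.abs_pert_le h (pow_pos (hφ.pos h x) 2) (hsb x)).2
    rw [abs_le]; constructor <;> linarith
  have hZ2' : MemLp (transOneDeriv ω lam (fun x => (p x : ℂ)) (fun x => ((g (φ x ^ 2) : ℝ) : ℂ))
      (fun x => ((primitive g (φ x ^ 2) / φ x ^ 2 : ℝ) : ℂ)) X X' Y Y') 2 := by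
    refine (((memLp_ofReal_mul hcc hcb (hU2.const_mul 2)).add
      (memLp_ofReal_mul hpc hpb' (hY2.const_mul (2 * lam)))).sub
      (hY2'.const_mul lam)).ae_eq (ae_of_all _ fun x => ?_)
    simp only [transOneDeriv, Pi.add_apply, Pi.sub_apply, pertTwo]
    push_cast
    ring
  have hac : Continuous fun x => 2 * ω - 2 * φ x ^ 2 + 2 * g (φ x ^ 2) :=
    (continuous_const.sub (continuous_const.mul (hφc.pow 2))).add (continuous_const.mul hgc)
  have hab : ∀ x, |2 * ω - 2 * φ x ^ 2 + 2 * g (φ x ^ 2)| ≤ 10 * ω := fun x => by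
    have h1 := abs_le.1 (hgb x)
    have h2 := hsb x
    rw [abs_le]; constructor <;> linarith [sq_nonneg (φ x)]
  have hW2 : MemLp (transTwo ω lam (fun x => ((φ x ^ 2 : ℝ) : ℂ)) (fun x => (p x : ℂ))
      (fun x => ((g (φ x ^ 2) : ℝ) : ℂ)) X Y Y') 2 := by
    refine (((memLp_ofReal_mul hac hab hY2).sub
      (memLp_ofReal_mul hpc hpb' (hY2'.const_mul 2))).sub
      (hX2.const_mul lam)).ae_eq (ae_of_all _ fun x => ?_)
    simp only [transTwo, Pi.sub_apply]
    push_cast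
    ring
  have hW2' : MemLp (transTwoDeriv ω lam (fun x => ((φ x ^ 2 : ℝ) : ℂ)) (fun x => (p x : ℂ))
      (fun x => ((g (φ x ^ 2) : ℝ) : ℂ)) X X' Y Y') 2 := by
    refine ((memLp_ofReal_mul hpc hpb' hW2).neg.sub (hU2.const_mul lam)).ae_eq
      (ae_of_all _ fun x => ?_)
    simp only [transTwoDeriv, Pi.sub_apply, Pi.neg_apply]
    ring
  exact transformed_system_eq_zero (lam := lam) hω (by have := eps_nonneg (g := g) ω; positivity)
    (by linarith) (hφ.continuous_pertOne h) (hφ.continuous_pertTwo h)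
    (fun x => (hφ.abs_pert_le h hsm x).1) (fun x => (hφ.abs_pert_le h hsm x).2) hint
    (hasDerivAt_transOne (lam := lam) (ω := (ω : ℂ)) (Y' := Y') hp2 hp hX hX'' hY)
    (fun x => (hasDerivAt_transOneDeriv (lam := lam) (ω := (ω : ℂ)) hp2 hp hγ hΓ hX hX'' hY hY'' x).congr_deriv
      (by simp only [pertOne]; push_cast; ring))
    (hasDerivAt_transTwo (lam := lam) (ω := (ω : ℂ)) hp2 hp hs hγ hX hY hY'')
    (fun x => (hasDerivAt_transTwoDeriv (lam := lam) (ω := (ω : ℂ)) hp2 hp hs hγ hX hX'' hY hY'' x).congr_deriv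
      (by simp only [pertTwo]; push_cast; ring)) hZ2 hZ2' hW2 hW2' x

/-- If the transformed function vanishes then `(X / φ)'` is constant and `lam Y` is a multiple of
`φ'`. -/
theorem IsSolitaryWave.exists_of_transOne_eq_zero (h : H1 g) (hφ : IsSolitaryWave g ω φ)
    (hX : ∀ x, HasDerivAt X (X' x) x)
    (hX' : ∀ x, HasDerivAt X' (profileMinus g ω φ x * X x - lam * Y x) x)
    (hZ : ∀ x, transOne lam (fun x => ((deriv φ x / φ x : ℝ) : ℂ)) X X' Y x = 0) :
    ∃ β : ℂ, (∀ x, HasDerivAt (fun x => X x / φ x) β x) ∧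
      ∀ x, lam * Y x = -2 * β * (deriv φ x : ℝ) := by
  have hφ0 : ∀ x, (φ x : ℂ) ≠ 0 := fun x => Complex.ofReal_ne_zero.2 (hφ.pos h x).ne'
  have hφd : ∀ x, HasDerivAt (fun x => (φ x : ℂ)) (deriv φ x : ℝ) x := fun x =>
    (hφ.hasDerivAt x).ofReal_comp
  have hφd' : ∀ x, HasDerivAt (fun x => ((deriv φ x : ℝ) : ℂ))
      (((ω * φ x - φ x ^ 3 + φ x * g (φ x ^ 2) : ℝ)) : ℂ) x := fun x =>
    (hφ.hasDerivAt_deriv x).ofReal_comp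
  set v : ℝ → ℂ := fun x => (X' x * φ x - X x * (deriv φ x : ℝ)) / (φ x : ℂ) ^ 2 with hv
  -- Here `v = (X/φ)'`, and `φ v'` is the transformed function.
  have hvd : ∀ x, HasDerivAt v 0 x := by
    intro x
    have h0 := hφ0 x
    refine ((((hX' x).mul (hφd x)).sub ((hX x).mul (hφd' x))).div ((hφd x).pow 2)
      (pow_ne_zero 2 h0)).congr_deriv ?_
    have h1 := hZ x
    simp only [transOne, Complex.ofReal_div] at h1
    simp only [profileMinus, Pi.sub_apply, Pi.mul_apply, Pi.pow_apply]
    push_cast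
    field_simp at h1 ⊢
    linear_combination h1
  have hvc : ∀ x, v x = v 0 := fun x =>
    is_const_of_deriv_eq_zero (fun x => (hvd x).differentiableAt) (fun x => (hvd x).deriv) x 0
  refine ⟨v 0, fun x => ?_, fun x => ?_⟩
  · rw [← hvc x]
    exact (hX x).div (hφd x) (hφ0 x)
  · have h0 := hφ0 x
    have h1 := hZ x
    rw [← hvc x, hv]
    simp only [transOne, Complex.ofReal_div] at h1 ⊢
    field_simp at h1 ⊢
    linear_combination -h1

/-- The kernel of `L₊` is spanned by `φ'`. -/
theorem IsSolitaryWave.exists_eq_mul_deriv (h : H1 g) (hsm : IsSmall g δ ω)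
    (hφ : IsSolitaryWave g ω φ) (hY : ∀ x, HasDerivAt Y (Y' x) x)
    (hY' : ∀ x, HasDerivAt Y' (profilePlus g ω φ x * Y x) x) (hY2 : MemLp Y 2)
    (hY2' : MemLp Y' 2) : ∃ c : ℂ, ∀ x, Y x = c * (deriv φ x : ℝ) := by
  set φ'' : ℝ → ℝ := fun x => ω * φ x - φ x ^ 3 + φ x * g (φ x ^ 2) with hφ''
  have hd1 : ∀ x, HasDerivAt (fun x => ((deriv φ x : ℝ) : ℂ)) (φ'' x : ℝ) x := fun x =>
    (hφ.hasDerivAt_deriv x).ofReal_comp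
  have hd2 : ∀ x, HasDerivAt (fun x => ((φ'' x : ℝ) : ℂ)) (profilePlus g ω φ x * (deriv φ x : ℝ)) x :=
    fun x => (hφ.hasDerivAt_deriv_deriv h x).ofReal_comp.congr_deriv (by
      simp only [profilePlus]; push_cast; ring)
  have m1 : MemLp (fun x => ((deriv φ x : ℝ) : ℂ)) 2 := (hφ.memLp_deriv h hsm).ofReal
  have m2 : MemLp (fun x => ((φ'' x : ℝ) : ℂ)) 2 := (hφ.memLp_deriv_deriv h hsm).ofReal
  have hwd : ∀ x, HasDerivAt (fun x => Y' x * (deriv φ x : ℝ) - Y x * (φ'' x : ℝ)) 0 x := fun x =>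
    (((hY' x).mul (hd1 x)).sub ((hY x).mul (hd2 x))).congr_deriv (by ring)
  have hwc : ∀ x, Y' x * (deriv φ x : ℝ) - Y x * (φ'' x : ℝ) =
      Y' 0 * (deriv φ 0 : ℝ) - Y 0 * (φ'' 0 : ℝ) := fun x =>
    is_const_of_deriv_eq_zero (fun x => (hwd x).differentiableAt) (fun x => (hwd x).deriv) x 0
  have hwi : Integrable fun x => Y' x * (deriv φ x : ℝ) - Y x * (φ'' x : ℝ) :=
    (hY2'.integrable_mul m1).sub (hY2.integrable_mul m2)
  -- The Wronskian of `Y` and `φ'` is constant and integrable on the line, hence zero. At the origin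
  -- it equals `-Y(0) φ''(0)`, since `φ'(0) = 0`.
  have hY0 : Y 0 = 0 := by
    rw [show (fun x => Y' x * (deriv φ x : ℝ) - Y x * (φ'' x : ℝ)) = fun _ =>
      Y' 0 * (deriv φ 0 : ℝ) - Y 0 * (φ'' 0 : ℝ) from funext hwc, integrable_const_iff] at hwi
    have h1 : ¬ IsFiniteMeasure (volume : Measure ℝ) := fun hfin => by
      have := hfin.measure_univ_lt_top
      simp at this
    have h2 := hwi.resolve_right h1
    rw [hφ.deriv_zero, Complex.ofReal_zero, mul_zero, zero_sub, neg_eq_zero, mul_eq_zero] at h2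
    exact h2.resolve_right (Complex.ofReal_ne_zero.2 (hφ.deriv_deriv_zero_ne h hsm))
  have hne : ((φ'' 0 : ℝ) : ℂ) ≠ 0 := Complex.ofReal_ne_zero.2 (hφ.deriv_deriv_zero_ne h hsm)
  refine ⟨Y' 0 / (φ'' 0 : ℝ), fun x => ?_⟩
  -- `Y` and the chosen multiple of `φ'` now have the same Cauchy data at `0`.
  have := eq_zero_of_norm_deriv_deriv_le (C := fun x => |profilePlus g ω φ x|) (a := 0)
    (hφ.continuous_potential_plus h).abs
    (fun x => (hY x).sub ((hd1 x).const_mul (Y' 0 / (φ'' 0 : ℝ))))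
    (fun x => (hY' x).sub ((hd2 x).const_mul (Y' 0 / (φ'' 0 : ℝ)))) (fun x => le_of_eq ?_)
    (by simp [hY0, hφ.deriv_zero]) (by simp [div_mul_cancel₀ _ hne]) x
  · exact sub_eq_zero.1 this
  · rw [← Real.norm_eq_abs, ← Complex.norm_real, ← norm_mul]
    congr 1
    simp only [Pi.sub_apply]
    ring

theorem IsSolitaryWave.eigen_solutions (h : H1 g) (hsm : IsSmall g δ ω)
    (hφ : IsSolitaryWave g ω φ) (heps : eps g ω ≤ 1 / 500)
    (hint : 13000 * (5 * eps g ω) ^ 2 * √ω ≤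
      ∫ x, (pertOne g (φ x ^ 2) + pertTwo g (φ x ^ 2)) / 2)
    (hX : ∀ x, HasDerivAt X (X' x) x)
    (hX' : ∀ x, HasDerivAt X' (profileMinus g ω φ x * X x - lam * Y x) x)
    (hY : ∀ x, HasDerivAt Y (Y' x) x)
    (hY' : ∀ x, HasDerivAt Y' (profilePlus g ω φ x * Y x - lam * X x) x)
    (hX2 : MemLp X 2) (hX2' : MemLp X' 2) (hY2 : MemLp Y 2) (hY2' : MemLp Y' 2) :
    ((∀ x, X x = 0) ∧ ∀ x, Y x = 0) ∨ (lam = 0 ∧ (∃ c : ℂ, ∀ x, X x = c * (φ x : ℝ)) ∧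
      ∃ c : ℂ, ∀ x, Y x = c * (deriv φ x : ℝ)) := by
  have hφ0 : ∀ x, (φ x : ℂ) ≠ 0 := fun x => Complex.ofReal_ne_zero.2 (hφ.pos h x).ne'
  obtain ⟨β, hβ, hY0⟩ := hφ.exists_of_transOne_eq_zero h hX hX'
    (hφ.transOne_eq_zero h hsm heps hint hX hX' hY hY' hX2 hX2' hY2 hY2')
  by_cases hlam : lam = 0
  · right
    refine ⟨hlam, ?_, hφ.exists_eq_mul_deriv h hsm hY
      (fun x => by simpa [hlam] using hY' x) hY2 hY2'⟩
    obtain ⟨x₀, hx₀⟩ := hφ.exists_deriv_ne_zero h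
    have hβ0 : β = 0 := by
      have := hY0 x₀
      rw [hlam, zero_mul, eq_comm, mul_eq_zero, or_iff_left (Complex.ofReal_ne_zero.2 hx₀)] at this
      simpa using this
    rw [hβ0] at hβ
    refine ⟨X 0 / φ 0, fun x => ?_⟩
    have h1 : X x / φ x = X 0 / φ 0 :=
      is_const_of_deriv_eq_zero (fun x => (hβ x).differentiableAt) (fun x => (hβ x).deriv) x 0
    rw [← h1, div_mul_cancel₀ _ (hφ0 x)]
  · left
    have hd1 : ∀ x, HasDerivAt (fun x => ((deriv φ x : ℝ) : ℂ))
        ((ω * φ x - φ x ^ 3 + φ x * g (φ x ^ 2) : ℝ) : ℂ) x := fun x =>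
      (hφ.hasDerivAt_deriv x).ofReal_comp
    have hd2 : ∀ x, HasDerivAt (fun x => ((ω * φ x - φ x ^ 3 + φ x * g (φ x ^ 2) : ℝ) : ℂ))
        (profilePlus g ω φ x * (deriv φ x : ℝ)) x := fun x =>
      (hφ.hasDerivAt_deriv_deriv h x).ofReal_comp.congr_deriv (by
        simp only [profilePlus]; push_cast; ring)
    have e0 : (fun x => lam * Y x) = fun x => -2 * β * ((deriv φ x : ℝ) : ℂ) := funext hY0
    have e1 : (fun x => lam * Y' x) =
        fun x => -2 * β * ((ω * φ x - φ x ^ 3 + φ x * g (φ x ^ 2) : ℝ) : ℂ) := by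
      funext x
      have h1 := (hY x).const_mul lam
      rw [e0] at h1
      exact h1.unique ((hd1 x).const_mul _)
    have hX0 : ∀ x, X x = 0 := by
      intro x
      have h1 := (hY' x).const_mul lam
      rw [e1] at h1
      have h2 := h1.unique ((hd2 x).const_mul _)
      -- `lam Y` is a multiple of `φ'`, which `L₊` annihilates, while `L₊ (lam Y) = lam² X`.
      have h3 : lam * lam * X x = 0 := by
        linear_combination (profilePlus g ω φ x : ℂ) * hY0 x - h2
      exact (mul_eq_zero.1 h3).resolve_left (mul_ne_zero hlam hlam)
    refine ⟨hX0, fun x => ?_⟩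
    have hX'0 : ∀ x, X' x = 0 := fun x => by
      have h1 := hX x
      rw [show X = fun _ => 0 from funext hX0] at h1
      exact h1.unique (hasDerivAt_const x 0)
    have h1 := hX' x
    rw [show X' = fun _ => 0 from funext hX'0] at h1
    have h2 := h1.unique (hasDerivAt_const x 0)
    rw [hX0 x, mul_zero, zero_sub, neg_eq_zero] at h2
    exact (mul_eq_zero.1 h2).resolve_left hlam

/-- The explicit solutions of the system. -/
theorem IsSolitaryWave.memH1_and_schrodingerEq (h : H1 g) (hsm : IsSmall g δ ω)
    (hφ : IsSolitaryWave g ω φ) (c : ℂ) :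
    (MemH1 (fun x => c * (φ x : ℂ)) ∧
      SchrodingerEq (profileMinus g ω φ) (fun x => c * (φ x : ℂ)) fun _ => 0) ∧
    (MemH1 (fun x => c * ((deriv φ x : ℝ) : ℂ)) ∧
      SchrodingerEq (profilePlus g ω φ) (fun x => c * ((deriv φ x : ℝ) : ℂ)) fun _ => 0) := by
  have hd0 : ∀ x, HasDerivAt (fun x => c * (φ x : ℂ)) (c * (deriv φ x : ℝ)) x := fun x =>
    (hφ.hasDerivAt x).ofReal_comp.const_mul c
  have hd1 : ∀ x, HasDerivAt (fun x => c * ((deriv φ x : ℝ) : ℂ))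
      (c * ((ω * φ x - φ x ^ 3 + φ x * g (φ x ^ 2) : ℝ) : ℂ)) x := fun x =>
    (hφ.hasDerivAt_deriv x).ofReal_comp.const_mul c
  have hd2 : ∀ x, HasDerivAt (fun x => c * ((ω * φ x - φ x ^ 3 + φ x * g (φ x ^ 2) : ℝ) : ℂ))
      (profilePlus g ω φ x * (c * (deriv φ x : ℝ)) - 0) x := fun x =>
    ((hφ.hasDerivAt_deriv_deriv h x).ofReal_comp.const_mul c).congr_deriv (by
      simp only [profilePlus]; push_cast; ring)
  have m0 : MemLp (fun x => c * (φ x : ℂ)) 2 := (hφ.memLp h hsm).ofReal.const_mul c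
  have m1 : MemLp (fun x => c * ((deriv φ x : ℝ) : ℂ)) 2 :=
    (hφ.memLp_deriv h hsm).ofReal.const_mul c
  have m2 : MemLp (fun x => c * ((ω * φ x - φ x ^ 3 + φ x * g (φ x ^ 2) : ℝ) : ℂ)) 2 :=
    (hφ.memLp_deriv_deriv h hsm).ofReal.const_mul c
  refine ⟨⟨memH1_of_hasDerivAt hd0 m0 m1, schrodingerEq_of_hasDerivAt (hφ.continuous_potential h)
    continuous_const hd0 fun x => (hd1 x).congr_deriv ?_⟩, memH1_of_hasDerivAt hd1 m1 m2,
    schrodingerEq_of_hasDerivAt (hφ.continuous_potential_plus h) continuous_const hd1 hd2⟩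
  push_cast
  ring

theorem memH1_zero : MemH1 fun _ : ℝ => (0 : ℂ) :=
  memH1_of_hasDerivAt (u' := fun _ => 0) (fun x => hasDerivAt_const x 0) MemLp.zero' MemLp.zero'

theorem schrodingerEq_zero (V : ℝ → ℝ) : SchrodingerEq V (fun _ => 0) fun _ => 0 := by
  intro ψ _
  simp

/-- The quantitative form of `(H₂)` for small frequencies. -/
theorem H2.eventually_le (h2 : H2 g) : ∀ᶠ ω in 𝓝[>] (0 : ℝ),
    13000 * (5 * eps g ω) ^ 2 * √ω ≤ ∫ x, (pertOne g (solitaryWave g ω x ^ 2)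
      + pertTwo g (solitaryWave g ω x ^ 2)) / 2 := by
  -- `325000 = 13000 · 5²`, and the average of the two perturbations is the integrand of `(H₂)`.
  filter_upwards [h2.eventually_ge_atTop 325000] with ω hω
  set I := ∫ x : ℝ, (-3 * g (solitaryWave g ω x ^ 2)
        + solitaryWave g ω x ^ 2 * deriv g (solitaryWave g ω x ^ 2)
        + 4 * (primitive g (solitaryWave g ω x ^ 2) / solitaryWave g ω x ^ 2)) with hI
  have hI' : ∫ x, (pertOne g (solitaryWave g ω x ^ 2)
      + pertTwo g (solitaryWave g ω x ^ 2)) / 2 = I := by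
    rw [hI]
    congr 1
    ext x
    simp only [pertOne, pertTwo]
    ring
  rw [hI']
  have hnn : 0 ≤ eps g ω ^ 2 * √ω := by positivity
  -- If the denominator vanished, the convention `1 / 0 = 0` would make the quotient `0`,
  -- contradicting the lower bound.
  rcases hnn.eq_or_lt with h0 | h0
  · rw [← h0] at hω
    norm_num at hω
  · rw [one_div, le_inv_mul_iff₀ h0] at hω
    linarith

end Main

end NLS

end

/-! ### Assembly of the theorem. -/

theorem theorem1 (g : ℝ → ℝ) (h1 : NLS.H1 g) (h2 : NLS.H2 g) :
    ∃ ω₀ : ℝ, 0 < ω₀ ∧ ∀ ω : ℝ, 0 < ω → ω < ω₀ →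
      (∃! φ : ℝ → ℝ, NLS.IsSolitaryWave g ω φ) ∧
      ∀ (X Y : ℝ → ℂ) (lam : ℂ),
        (NLS.MemH1 X ∧ NLS.MemH1 Y ∧ NLS.LinearizedSystem g ω X Y lam) ↔
          ((X =ᵐ[volume] 0 ∧ Y =ᵐ[volume] 0) ∨
            (lam = 0 ∧
              (∃ c : ℂ, X =ᵐ[volume] fun x => c * (NLS.solitaryWave g ω x : ℂ)) ∧
              (∃ c : ℂ, Y =ᵐ[volume] fun x => c * ((deriv (NLS.solitaryWave g ω) x : ℝ) : ℂ)))) := by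
  obtain ⟨δ, hδ, hsmall⟩ := h1.exists_isSmall
  -- The perturbations are bounded by `5 ε_ω` times the weight, and the virial argument requires `5
  -- ε_ω ≤ 1 / 100`.
  obtain ⟨δ', hδ', hb⟩ := h1.exists_abs_le (η := 1 / 500) (by norm_num)
  obtain ⟨u, hu, hsub⟩ := mem_nhdsGT_iff_exists_Ioo_subset.1 (h2.eventually_le)
  have hu : 0 < u := hu
  refine ⟨min (min (δ / 3) (δ' / 3)) u, by positivity, fun ω hω hω₀ => ?_⟩
  rw [lt_min_iff, lt_min_iff] at hω₀
  have hsm := hsmall ω hω hω₀.1.1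
  refine ⟨h1.existsUnique_isSolitaryWave hsm, ?_⟩
  have hφ := h1.isSolitaryWave_solitaryWave hsm
  have heps : NLS.eps g ω ≤ 1 / 500 := NLS.eps_le hω.le (by norm_num) fun s hs hs' =>
    (hb s hs (by linarith [hω₀.1.2])).2.2
  have hint := hsub ⟨hω, hω₀.2⟩
  intro X Y lam
  constructor
  · rintro ⟨hX, hY, hS1, hS2⟩
    obtain ⟨x, x', y, y', hXx, hYy, d1, d2, d3, d4, m1, m2, m3, m4⟩ :=
      NLS.exists_classical_of_schrodingerEq_system (hφ.continuous_potential h1)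
        (hφ.continuous_potential_plus h1) hX hY hS1 hS2
    rcases hφ.eigen_solutions h1 hsm heps hint d1 d2 d3 d4 m1 m2 m3 m4 with
      ⟨hx, hy⟩ | ⟨hl, ⟨c, hc⟩, c', hc'⟩
    · left
      exact ⟨hXx.trans (ae_of_all _ hx), hYy.trans (ae_of_all _ hy)⟩
    · right
      exact ⟨hl, ⟨c, hXx.trans (ae_of_all _ hc)⟩, c', hYy.trans (ae_of_all _ hc')⟩
  · rintro (⟨hX, hY⟩ | ⟨rfl, ⟨c, hX⟩, c', hY⟩)
    · refine ⟨NLS.memH1_zero.congr_ae hX.symm, NLS.memH1_zero.congr_ae hY.symm,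
        (NLS.schrodingerEq_zero _).congr_ae hX.symm ?_,
        (NLS.schrodingerEq_zero _).congr_ae hY.symm ?_⟩
      · filter_upwards [hY] with x hx
        simp [hx]
      · filter_upwards [hX] with x hx
        simp [hx]
    · obtain ⟨⟨hm, hs⟩, -⟩ := hφ.memH1_and_schrodingerEq h1 hsm c
      obtain ⟨-, hm', hs'⟩ := hφ.memH1_and_schrodingerEq h1 hsm c'
      exact ⟨hm.congr_ae hX.symm, hm'.congr_ae hY.symm,
        hs.congr_ae hX.symm (ae_of_all _ fun x => by simp),
        hs'.congr_ae hY.symm (ae_of_all _ fun x => by simp)⟩
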